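/- Let $\Omega\subset\mathbb R^3$ be a bounded domain with $C^\infty$ boundary $\Gamma=\partial\Omega$ and outward unit normal $\mathbf n$ (connectedness of $\Omega$ is not needed). Let $\mathbf B:\overline\Omega\to\mathbb R^3$ be a vector field of class $C^1$ up to the boundary, with $\nabla\cdot\mathbf B=0$ in $\Omega$, put $\mathbf J=\nabla\times\mathbf B$ on $\overline\Omega$, and suppose that $\mathbf J\cdot\mathbf n=0$ on $\Gamma$ (equivalently, the surface divergence $\nabla_\Gamma\cdot(\mathbf n\times\mathbf B)$ vanishes on $\Gamma$). For $x\in\mathbb R^3\setminus\Gamma$ define $$\mathbf B_t(x)=-\nabla\times\int_\Gamma\frac{\mathbf n(y)\times\mathbf B(y)}{4\pi|x-y|}\,dS(y),\qquad \mathbf B_n(x)=\nabla\int_\Gamma\frac{\mathbf B(y)\cdot\mathbf n(y)}{4\pi|x-y|}\,dS(y).$$ Then: 1. For every $x\in\Omega$, $$\mathbf B(x)=\nabla\times\int_\Omega\frac{\mathbf J(y)}{4\pi|x-y|}\,dV(y)+\mathbf B_t(x)+\mathbf B_n(x),$$ where the volume integral converges absolutely and is differentiable as a function of $x\in\Omega$,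 and the boundary integrals converge absolutely and are differentiable as functions of $x\in\mathbb R^3\setminus\Gamma$. 2. $\mathbf B_t$ and $\mathbf B_n$ are harmonic vector fields in $\mathbb R^3\setminus\Gamma$: they are smooth there, with $\nabla\times\mathbf B_t=0$, $\nabla\cdot\mathbf B_t=0$, $\nabla\times\mathbf B_n=0$, $\nabla\cdot\mathbf B_n=0$. -/

import Mathlib

open MeasureTheory Set
open scoped Gradient RealInnerProductSpace ContDiff

/-- Euclidean three-space. -/
abbrev R3 : Type := EuclideanSpace ℝ (Fin 3)

/-- The cross product on Euclidean three-space. -/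
noncomputable def cross (v w : R3) : R3 :=
  WithLp.toLp 2 (crossProduct (WithLp.ofLp v) (WithLp.ofLp w))

/-- The standard unit vectors. -/
noncomputable def stdVec (i : Fin 3) : R3 := EuclideanSpace.single i (1 : ℝ)

/-- The curl read off from a derivative `L`, where `(L (stdVec i)) j` is `∂ᵢ Fⱼ`. -/
noncomputable def curlOf (L : R3 →L[ℝ] R3) : R3 :=
  !₂[(L (stdVec 1)) 2 - (L (stdVec 2)) 1,
     (L (stdVec 2)) 0 - (L (stdVec 0)) 2,
     (L (stdVec 0)) 1 - (L (stdVec 1)) 0]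

/-- The curl of a vector field. -/
noncomputable def curl (F : R3 → R3) (x : R3) : R3 := curlOf (fderiv ℝ F x)

/-- The curl of a vector field that is defined on `s` only (on a closed region: the curl up to
the boundary). -/
noncomputable def curlWithin (F : R3 → R3) (s : Set R3) (x : R3) : R3 :=
  curlOf (fderivWithin ℝ F s x)

/-- The divergence of a vector field. -/
noncomputable def divergence (F : R3 → R3) (x : R3) : ℝ :=
  ∑ i : Fin 3, (fderiv ℝ F x (stdVec i)) i

/-- A (smooth) harmonic vector field on an open set: curl-free and divergence-free. -/
structure IsHarmonicVectorField (A : R3 → R3) (U : Set R3) : Prop where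
  smooth : ContDiffOn ℝ ∞ A U
  curl_eq_zero : ∀ x ∈ U, curl A x = 0
  div_eq_zero : ∀ x ∈ U, divergence A x = 0

/-- `ρ` is a smooth local defining function of `Ω` near the point `p`: on the open
neighbourhood `U` of `p`, the set `Ω` is `{ρ < 0}`, and the gradient of `ρ` at `p` is nonzero. -/
structure IsLocalDefiningFunction (Ω : Set R3) (p : R3) (U : Set R3) (ρ : R3 → ℝ) : Prop where
  isOpen : IsOpen U
  mem : p ∈ U
  smooth : ContDiffOn ℝ ∞ ρ U
  gradient_ne_zero : ∇ ρ p ≠ 0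
  inter_eq : Ω ∩ U = {x | x ∈ U ∧ ρ x < 0}

/-- Bounded open sets with smooth boundary, lying locally on one side of it. -/
structure IsSmoothlyBounded (Ω : Set R3) : Prop where
  isOpen : IsOpen Ω
  isBounded : Bornology.IsBounded Ω
  exists_defining : ∀ p ∈ frontier Ω, ∃ U ρ, IsLocalDefiningFunction Ω p U ρ

/-- `v` is the outward unit normal of `Ω` at the boundary point `p`. -/
def IsOutwardUnitNormal (Ω : Set R3) (p v : R3) : Prop :=
  ∃ U ρ, IsLocalDefiningFunction Ω p U ρ ∧ v = ‖∇ ρ p‖⁻¹ • ∇ ρ p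

open Classical in
/-- The outward unit normal field of `Ω` (zero where there is none). -/
noncomputable def outwardNormal (Ω : Set R3) (p : R3) : R3 :=
  if h : ∃ v, IsOutwardUnitNormal Ω p v then h.choose else 0

/-- The Green's function `1 / (4π|x - y|)` of minus the Laplacian. -/
noncomputable def newtonKernel (x y : R3) : ℝ := 1 / (4 * Real.pi * ‖x - y‖)

/-- The volume potential `∫_Ω J(y) / (4π|x - y|) dV(y)`. -/
noncomputable def volumePotential (Ω : Set R3) (J : R3 → R3) (x : R3) : R3 :=
  ∫ y in Ω, newtonKernel x y • J y

/-- The single layer potential `∫_Γ σ(y) / (4π|x - y|) dS(y)` of a scalar or vector density `σ`;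
the surface measure is the normalized two-dimensional Hausdorff measure on `Γ`. -/
noncomputable def singleLayer {F : Type*} [NormedAddCommGroup F] [NormedSpace ℝ F]
    (Γ : Set R3) (σ : R3 → F) (x : R3) : F :=
  ∫ y in Γ, newtonKernel x y • σ y ∂μHE[2]

/-- The Biot–Savart integral of `J`. -/
noncomputable def biotSavart (Ω : Set R3) (J : R3 → R3) (x : R3) : R3 :=
  curl (volumePotential Ω J) x

/-- The tangential trace `n × B`. -/
noncomputable def tangentialTrace (Ω : Set R3) (B : R3 → R3) (y : R3) : R3 :=
  cross (outwardNormal Ω y) (B y)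

/-- The normal trace `B · n`. -/
noncomputable def normalTrace (Ω : Set R3) (B : R3 → R3) (y : R3) : ℝ :=
  ⟪B y, outwardNormal Ω y⟫

/-- `B_t = - curl ∫_Γ (n × B)(y) / (4π|x - y|) dS(y)`. -/
noncomputable def tangentialField (Ω : Set R3) (B : R3 → R3) (x : R3) : R3 :=
  - curl (singleLayer (frontier Ω) (tangentialTrace Ω B)) x

/-- `B_n = grad ∫_Γ (B · n)(y) / (4π|x - y|) dS(y)`. -/
noncomputable def normalField (Ω : Set R3) (B : R3 → R3) (x : R3) : R3 :=
  ∇ (singleLayer (frontier Ω) (normalTrace Ω B)) x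

/-- A direction into `Ω` at a boundary point, read through another defining function. -/
theorem IsLocalDefiningFunction.inner_le {Ω : Set R3} {p : R3} (hp : p ∈ frontier Ω)
    {U V : Set R3} {ρ τ : R3 → ℝ} (hρ : IsLocalDefiningFunction Ω p U ρ)
    (hτ : IsLocalDefiningFunction Ω p V τ) (w : R3) (hw : ⟪∇ ρ p, w⟫ < 0) :
    ⟪∇ τ p, w⟫ ≤ 0 := by
  have key : ∀ {W : Set R3} {f : R3 → ℝ}, IsLocalDefiningFunction Ω p W f →
      HasDerivAt (fun t : ℝ => f (p + t • w)) ⟪∇ f p, w⟫ 0 ∧ f p = 0 := by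
    intro W f hf
    have hd : DifferentiableAt ℝ f p :=
      ((hf.smooth.contDiffAt (hf.isOpen.mem_nhds hf.mem)).differentiableAt (by simp))
    constructor
    · have h1 : HasDerivAt (fun t : ℝ => p + t • w) w 0 := by
        simpa using ((hasDerivAt_id (0 : ℝ)).smul_const w).const_add p
      have h2 : HasFDerivAt f (InnerProductSpace.toDual ℝ R3 (∇ f p)) (p + (0 : ℝ) • w) := by
        simpa using hd.hasGradientAt.hasFDerivAt
      have h3 := h2.comp_hasDerivAt 0 h1
      rw [InnerProductSpace.toDual_apply_apply] at h3
      exact h3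
    · apply le_antisymm
      · have hcl : p ∈ closure (Ω ∩ W) := by
          rw [Set.inter_comm]
          exact hf.isOpen.inter_closure ⟨hf.mem, hp.1⟩
        have := ContinuousWithinAt.closure_le (f := f) (g := fun _ => (0 : ℝ)) hcl
          hd.continuousAt.continuousWithinAt continuousWithinAt_const (fun y hy => by
            rw [hf.inter_eq] at hy
            exact hy.2.le)
        exact this
      · by_contra hneg
        have hpm : p ∈ Ω ∩ W := by
          rw [hf.inter_eq]
          exact ⟨hf.mem, not_le.mp hneg⟩
        have hnh : Ω ∩ W ∈ nhds p := by
          rw [hf.inter_eq]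
          exact Filter.inter_mem (hf.isOpen.mem_nhds hf.mem)
            (hd.continuousAt.eventually_lt continuousAt_const (not_le.mp hneg))
        exact hp.2 (mem_interior_iff_mem_nhds.mpr
          (Filter.mem_of_superset hnh Set.inter_subset_left))
  obtain ⟨dρ, zρ⟩ := key hρ
  obtain ⟨dτ, zτ⟩ := key hτ
  have cont : Filter.Tendsto (fun t : ℝ => p + t • w) (nhdsWithin 0 (Set.Ioi 0)) (nhds p) := by
    have : Continuous (fun t : ℝ => p + t • w) := by fun_prop
    simpa using (this.tendsto 0).mono_left nhdsWithin_le_nhds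
  have sρ := (hasDerivAt_iff_tendsto_slope.mp dρ).mono_left
    (nhdsWithin_mono 0 (s := Set.Ioi (0 : ℝ)) (fun t ht => ne_of_gt ht))
  have sτ := (hasDerivAt_iff_tendsto_slope.mp dτ).mono_left
    (nhdsWithin_mono 0 (s := Set.Ioi (0 : ℝ)) (fun t ht => ne_of_gt ht))
  refine le_of_tendsto sτ ?_
  filter_upwards [sρ.eventually_lt_const hw, cont (hρ.isOpen.mem_nhds hρ.mem),
    cont (hτ.isOpen.mem_nhds hτ.mem), self_mem_nhdsWithin] with t h1 h2 h3 ht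
  have ht : (0 : ℝ) < t := ht
  simp only [slope_def_field, zero_smul, add_zero, sub_zero, zρ, zτ] at h1 ⊢
  have h4 : ρ (p + t • w) < 0 := by
    by_contra h
    exact absurd h1 (not_lt.mpr (div_nonneg (not_lt.mp h) ht.le))
  have h5 : p + t • w ∈ Ω ∩ U := by
    rw [hρ.inter_eq]
    exact ⟨h2, h4⟩
  have h6 : p + t • w ∈ Ω ∩ V := ⟨h5.1, h3⟩
  rw [hτ.inter_eq] at h6
  exact div_nonpos_of_nonpos_of_nonneg h6.2.le ht.le

/-- Two defining functions at a boundary point have the same gradient direction. -/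
theorem IsLocalDefiningFunction.normal_unique {Ω : Set R3} {p : R3} (hp : p ∈ frontier Ω)
    {U V : Set R3} {ρ τ : R3 → ℝ} (hρ : IsLocalDefiningFunction Ω p U ρ)
    (hτ : IsLocalDefiningFunction Ω p V τ) :
    ‖∇ ρ p‖⁻¹ • ∇ ρ p = ‖∇ τ p‖⁻¹ • ∇ τ p := by
  have ha := norm_pos_iff.mpr hρ.gradient_ne_zero
  have hb := norm_pos_iff.mpr hτ.gradient_ne_zero
  have na : ‖‖∇ ρ p‖⁻¹ • ∇ ρ p‖ = 1 := by
    rw [norm_smul, norm_inv, norm_norm, inv_mul_cancel₀ ha.ne']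
  have nb : ‖‖∇ τ p‖⁻¹ • ∇ τ p‖ = 1 := by
    rw [norm_smul, norm_inv, norm_norm, inv_mul_cancel₀ hb.ne']
  have ea : ∇ ρ p = ‖∇ ρ p‖ • (‖∇ ρ p‖⁻¹ • ∇ ρ p) := by
    rw [smul_smul, mul_inv_cancel₀ ha.ne', one_smul]
  have eb : ∇ τ p = ‖∇ τ p‖ • (‖∇ τ p‖⁻¹ • ∇ τ p) := by
    rw [smul_smul, mul_inv_cancel₀ hb.ne', one_smul]
  have main := hρ.inner_le hp hτ
  generalize ‖∇ ρ p‖⁻¹ • ∇ ρ p = a at *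
  generalize ‖∇ τ p‖⁻¹ • ∇ τ p = b at *
  by_contra hab
  have hlt : ⟪a, b⟫ < 1 := (inner_lt_one_iff_real_of_norm_eq_one na nb).mpr hab
  have h1 : ⟪∇ ρ p, b - a⟫ < 0 := by
    rw [ea, real_inner_smul_left, inner_sub_right, real_inner_self_eq_norm_sq, na]
    exact mul_neg_of_pos_of_neg ha (by linarith)
  have h2 := main _ h1
  rw [eb, real_inner_smul_left, inner_sub_right, real_inner_self_eq_norm_sq, nb,
    real_inner_comm] at h2
  have h3 : 0 < ‖∇ τ p‖ * (1 ^ 2 - ⟪a, b⟫) := mul_pos hb (by linarith)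
  linarith

/-- The outward unit normal does not depend on the defining function. -/
theorem IsLocalDefiningFunction.outwardNormal_eq {Ω : Set R3} {p : R3} (hp : p ∈ frontier Ω)
    {U : Set R3} {ρ : R3 → ℝ} (hρ : IsLocalDefiningFunction Ω p U ρ) :
    outwardNormal Ω p = ‖∇ ρ p‖⁻¹ • ∇ ρ p := by
  have h : ∃ v, IsOutwardUnitNormal Ω p v := ⟨_, U, ρ, hρ, rfl⟩
  have e : outwardNormal Ω p = h.choose := by rw [outwardNormal, dif_pos h]
  obtain ⟨V, τ, hτ, hv⟩ := h.choose_spec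
  rw [e, hv]
  exact hτ.normal_unique hp hρ

/-! Replace the Newton kernel by the smooth kernel `G_ε(z) = 1 / (4π √(|z|² + ε²))` and write `u(y)
= (∇G_ε)(x - y)`, `δ_ε = -ΔG_ε`. For a constant vector `c`, the field `(u·B)c - (B·c)u - (u·c)B` has
divergence `c·(u × J - δ_ε B)` when `div B = 0` (`divergence_representation_field`), and its normal
component on `Γ` is `c·(u × (n × B) - (B·n)u)`. The divergence theorem then gives, for every `c`,
the representation formula for `∫ δ_ε(x - y) B(y) dy`. As `ε → 0`, `δ_ε` is an approximate identity
(`tendsto_integral_softDelta`), the volume term converges because `∇G_ε → ∇G_0` in `L¹` on balls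
(`hasFDerivAt_volumePotential`), and the boundary terms converge because the kernel is bounded on
`Γ` as seen from `x ∉ Γ`.

Off `Γ` the layer potentials are differentiated under the integral sign, so they are smooth and
harmonic. This settles the gradient field at once. For the curl field, `curl curl S = grad div S -
ΔS`, so it remains to see that `div S = ∫_Γ u·(n × B)` vanishes. That integral is the flux of `B ×
u`, hence equals `∫_Ω u·J` since `curl u = 0`; and `∫_Ω u·J` is, up to sign, the integral of `∇φ·J`
with `φ(y) = G_ε(x - y)`, which equals the boundary integral of `φ J·n = 0`.

In the last step `J` is merely continuous, with divergence zero only in the weak sense. The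
divergence theorem is therefore proved for continuous fields with an integrable weak divergence
(`IsSmoothlyBounded.integral_weakDivergence`). A partition of unity reduces it to boundary charts
that are graphs of slope at most `δ`. There, testing with a cutoff that vanishes in a thin layer
below the graph produces the flux as an integral over the tangent plane. Since the projection is
1-Lipschitz and the graph map is `(1 + δ)`-Lipschitz, plane measure and surface measure agree up to
the factor `(1 + δ)²`; the total error is at most `4δ` times a fixed constant, and `δ` is arbitrary.
No exact area formula is needed. -/

open Filter Topology Metric
open scoped NNReal ENNReal

/-! ### Orthogonal splittings and graph charts of the boundary. -/

/-- The Euclidean plane. -/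
abbrev R2 : Type := EuclideanSpace ℝ (Fin 2)

/-- An orthogonal splitting of space into the line spanned by the unit vector `ν` and a plane:
`T` embeds the plane and `π` is the orthogonal projection onto it. -/
structure IsOrthoSplit (ν : R3) (T : R2 →ₗᵢ[ℝ] R3) (π : R3 →L[ℝ] R2) : Prop where
  norm_eq : ‖ν‖ = 1
  proj_embed : ∀ x, π (T x) = x
  proj_normal : π ν = 0
  inner_embed : ∀ x, ⟪ν, T x⟫ = 0
  decomp : ∀ y, T (π y) + ⟪ν, y⟫ • ν = y
  measurePreserving : MeasurePreserving (fun q : R2 × ℝ => T q.1 + q.2 • ν)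

/-- An orthonormal basis of the orthogonal complement of `ν` gives the embedding, and its adjoint is
the projection. -/
theorem exists_isOrthoSplit {ν : R3} (hν : ‖ν‖ = 1) : ∃ T π, IsOrthoSplit ν T π := by
  have : Fact (Module.finrank ℝ R3 = 2 + 1) := ⟨by simp⟩
  have hν0 : ν ≠ 0 := by
    intro h; simp [h] at hν
  have hfr : Module.finrank ℝ (ℝ ∙ ν)ᗮ = 2 := Submodule.finrank_orthogonal_span_singleton hν0
  let e : R2 ≃ₗᵢ[ℝ] (ℝ ∙ ν)ᗮ := ((stdOrthonormalBasis ℝ (ℝ ∙ ν)ᗮ).reindex (finCongr hfr)).repr.symm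
  let T : R2 →ₗᵢ[ℝ] R3 := (ℝ ∙ ν)ᗮ.subtypeₗᵢ.comp e.toLinearIsometry
  have hT : ∀ x, ⟪ν, T x⟫ = 0 := fun x =>
    (Submodule.mem_orthogonal_singleton_iff_inner_right.1 (e x).2)
  let π : R3 →L[ℝ] R2 := ContinuousLinearMap.adjoint T.toContinuousLinearMap
  have hπ : ∀ y x, ⟪π y, x⟫ = ⟪y, T x⟫ := fun y x => by
    simp [π, ContinuousLinearMap.adjoint_inner_left]
  have h1 : ∀ x, π (T x) = x := fun x => ext_inner_right ℝ fun w => by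
    rw [hπ, T.inner_map_map]
  have h2 : π ν = 0 := ext_inner_right ℝ fun w => by rw [hπ, hT, inner_zero_left]
  -- The product carries the `L²` norm here, so that the map is an isometry and hence preserves
  -- volume; the passage from the plain product is volume preserving too.
  let S₀ : WithLp 2 (R2 × ℝ) →ₗ[ℝ] R3 :=
    { toFun := fun q => T q.fst + q.snd • ν
      map_add' := fun a b => by simp [add_smul]; abel
      map_smul' := fun c a => by simp [mul_smul] }
  let S₁ : WithLp 2 (R2 × ℝ) →ₗᵢ[ℝ] R3 :=
    { S₀ with
      norm_map' := fun q => by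
        have h := hT q.fst
        have key : ‖T q.fst + q.snd • ν‖ ^ 2 = ‖q‖ ^ 2 := by
          rw [WithLp.prod_norm_sq_eq_of_L2, norm_add_sq_real, inner_smul_right, real_inner_comm,
            h, norm_smul, hν, T.norm_map]
          simp
        exact (sq_eq_sq₀ (norm_nonneg _) (norm_nonneg _)).1 key }
  have hdim : Module.finrank ℝ (WithLp 2 (R2 × ℝ)) = Module.finrank ℝ R3 := by
    rw [(WithLp.linearEquiv 2 ℝ (R2 × ℝ)).finrank_eq]; simp
  let S : WithLp 2 (R2 × ℝ) ≃ₗᵢ[ℝ] R3 := S₁.toLinearIsometryEquiv hdim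
  have hS : ∀ q, S q = T q.fst + q.snd • ν := fun q => rfl
  refine ⟨T, π, hν, h1, h2, hT, fun y => ?_, ?_⟩
  · obtain ⟨q, rfl⟩ := S.surjective y
    simp [hS, h1, h2, inner_add_right, inner_smul_right, hT, hν]
  · exact S.measurePreserving.comp (WithLp.volume_preserving_toLp R2 ℝ)

namespace IsOrthoSplit

variable {ν : R3} {T : R2 →ₗᵢ[ℝ] R3} {π : R3 →L[ℝ] R2}

theorem inner_normal (hS : IsOrthoSplit ν T π) (x : R2) (s : ℝ) : ⟪ν, T x + s • ν⟫ = s := by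
  simp [inner_add_right, inner_smul_right, hS.inner_embed, hS.norm_eq]

theorem proj_apply (hS : IsOrthoSplit ν T π) (x : R2) (s : ℝ) : π (T x + s • ν) = x := by
  simp [hS.proj_embed, hS.proj_normal]

theorem norm_proj_le (hS : IsOrthoSplit ν T π) (y : R3) : ‖π y‖ ≤ ‖y‖ := by
  have h : ‖y‖ ^ 2 = ‖π y‖ ^ 2 + ⟪ν, y⟫ ^ 2 := by
    conv_lhs => rw [← hS.decomp y]
    rw [norm_add_sq_real, inner_smul_right, real_inner_comm ν (T _), hS.inner_embed, norm_smul,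
      hS.norm_eq, T.norm_map]
    simp
  exact le_of_sq_le_sq (by nlinarith [sq_nonneg ⟪ν, y⟫]) (norm_nonneg _)

end IsOrthoSplit

/-- Near the points of `W` the set `Ω` is the subgraph of `h` over the plane of the splitting, and
the slope of `h` is at most `δ`. -/
structure IsGraphChart (Ω : Set R3) (δ : ℝ) (ν : R3) (T : R2 →ₗᵢ[ℝ] R3) (π : R3 →L[ℝ] R2)
    (h : R2 → ℝ) (V : Set R2) (W : Set R3) : Prop where
  split : IsOrthoSplit ν T π
  smooth : ContDiff ℝ ∞ h
  convex : Convex ℝ V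
  slope_le : ∀ x ∈ V, ‖fderiv ℝ h x‖ ≤ δ
  isOpen : IsOpen W
  isBounded : Bornology.IsBounded W
  proj_mem : ∀ y ∈ W, π y ∈ V
  mem_iff : ∀ y ∈ W, y ∈ Ω ↔ ⟪ν, y⟫ < h (π y)

theorem IsLocalDefiningFunction.eq_zero {Ω : Set R3} (hΩ : IsOpen Ω) {p : R3} (hp : p ∈ frontier Ω)
    {U : Set R3} {ρ : R3 → ℝ} (hρ : IsLocalDefiningFunction Ω p U ρ) : ρ p = 0 := by
  have hc : ContinuousAt ρ p := (hρ.smooth.contDiffAt (hρ.isOpen.mem_nhds hρ.mem)).continuousAt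
  apply le_antisymm
  · have hcl : p ∈ closure (Ω ∩ U) := by
      rw [Set.inter_comm]
      exact hρ.isOpen.inter_closure ⟨hρ.mem, hp.1⟩
    exact ContinuousWithinAt.closure_le (f := ρ) (g := fun _ => (0 : ℝ)) hcl
      hc.continuousWithinAt continuousWithinAt_const (fun y hy => by
        rw [hρ.inter_eq] at hy
        exact hy.2.le)
  · by_contra hneg
    have : p ∈ Ω ∩ U := by rw [hρ.inter_eq]; exact ⟨hρ.mem, not_le.1 hneg⟩
    rw [hΩ.frontier_eq] at hp
    exact hp.2 this.1

/-- A smooth implicit function is smooth near the base point. -/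
theorem exists_smooth_implicit {f : R2 × ℝ → ℝ} {u : R2 × ℝ} {N : Set (R2 × ℝ)} (hN : IsOpen N)
    (hu : u ∈ N) (hf : ContDiffOn ℝ ∞ f N) (hfu : f u = 0)
    (hd : ∀ v ∈ N, 0 < fderiv ℝ f v (0, 1)) (hd1 : ∀ w, fderiv ℝ f u (w, 0) = 0) :
    ∃ h : R2 → ℝ, ∃ r > 0, ∃ V : Set R2, IsOpen V ∧ u.1 ∈ V ∧ ContDiffOn ℝ ∞ h V ∧
      HasFDerivAt h (0 : R2 →L[ℝ] ℝ) u.1 ∧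
      ∀ x ∈ V, ∀ s, |s - u.2| < r → (x, s) ∈ N ∧ (f (x, s) < 0 ↔ s < h x) := by
  have cda : ∀ v ∈ N, ContDiffAt ℝ ∞ f v := fun v hv => hf.contDiffAt (hN.mem_nhds hv)
  have inv : ∀ v ∈ N, (fderiv ℝ f v ∘L .inr ℝ R2 ℝ).IsInvertible := by
    intro v hv
    have hne : fderiv ℝ f v (0, 1) ≠ 0 := (hd v hv).ne'
    refine ⟨ContinuousLinearEquiv.unitsEquivAut ℝ (Units.mk0 _ hne), ?_⟩
    ext
    simp
  have hne : (∞ : ℕ∞ω) ≠ 0 := by simp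
  set h := (cda u hu).implicitFunction hne (inv u hu) with hh
  have h0 : h u.1 = u.2 := (cda u hu).implicitFunction_apply_self hne (inv u hu)
  obtain ⟨r, hr, hrN⟩ : ∃ r > 0, ball u r ⊆ N := Metric.isOpen_iff.1 hN u hu
  have hcd : ContDiffAt ℝ 1 h u.1 :=
    ((cda u hu).contDiffAt_implicitFunction hne (inv u hu)).of_le (by simp)
  have hcont : ∀ᶠ x in 𝓝 u.1, ContinuousAt h x :=
    (hcd.eventually (by simp)).mono fun x hx => hx.continuousAt
  have hzero : ∀ᶠ x in 𝓝 u.1, f (x, h x) = 0 := by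
    rw [← hfu]; exact (cda u hu).eventually_apply_implicitFunction hne (inv u hu)
  have hball : ∀ᶠ x in 𝓝 u.1, h x ∈ ball u.2 r := by
    have := hcd.continuousAt.eventually (p := fun s => s ∈ ball u.2 r)
    rw [h0] at this
    exact this (ball_mem_nhds _ hr)
  obtain ⟨V, hV, hVo, huV⟩ := _root_.eventually_nhds_iff.1
    (((hcont.and hzero).and hball).and (ball_mem_nhds u.1 hr : ∀ᶠ x in 𝓝 u.1, x ∈ ball u.1 r))
  have hmem : ∀ x ∈ V, ∀ s, |s - u.2| < r → (x, s) ∈ N := by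
    intro x hx s hs
    apply hrN
    rw [← ball_prod_same]
    exact ⟨(hV x hx).2, by simpa [Real.dist_eq] using hs⟩
  refine ⟨h, r, hr, V, hVo, huV, ?_, ?_, fun x hx s hs => ⟨hmem x hx s hs, ?_⟩⟩
  · intro x hx
    have hvN : (x, h x) ∈ N := hmem x hx _ (by simpa [Real.dist_eq] using (hV x hx).1.2)
    -- The implicit function theorem gives smoothness at its own base point only. Near each `x ∈ V`,
    -- `h` coincides with the implicit function based at `(x, h x)`, which is smooth at `x`.
    have e1 := (cda _ hvN).eventually_apply_eq_iff_implicitFunction hne (inv _ hvN)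
    have hc : ContinuousAt (fun y => (y, h y)) x := continuousAt_id.prodMk (hV x hx).1.1.1
    have e2 : h =ᶠ[𝓝 x] (cda _ hvN).implicitFunction hne (inv _ hvN) := by
      filter_upwards [hc.eventually e1, hVo.mem_nhds hx] with y hy hyV
      refine (hy.1 ?_).symm
      rw [(hV y hyV).1.1.2, (hV x hx).1.1.2]
    exact (((cda _ hvN).contDiffAt_implicitFunction hne
      (inv _ hvN)).congr_of_eventuallyEq e2).contDiffWithinAt
  · have := ((cda u hu).hasStrictFDerivAt_implicitFunction hne (inv u hu)).hasFDerivAt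
    convert! this using 1
    have : fderiv ℝ f u ∘L .inl ℝ R2 ℝ = 0 := by ext w; simp [hd1]
    rw [this]; simp
  -- On each vertical segment `f` is strictly increasing and vanishes at `h x`, so its sign tells
  -- the side of the graph.
  · have hmono : StrictMonoOn (fun t => f (x, t)) (ball u.2 r) := by
      have hder : ∀ t ∈ ball u.2 r,
          HasDerivAt (fun t => f (x, t)) (fderiv ℝ f (x, t) (0, 1)) t := by
        intro t ht
        have hN' := hmem x hx t (by simpa [Real.dist_eq] using ht)
        have := ((cda _ hN').differentiableAt (by simp)).hasFDerivAt
        exact this.comp_hasDerivAt t ((hasDerivAt_const t x).prodMk (hasDerivAt_id t))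
      apply strictMonoOn_of_deriv_pos (convex_ball _ _)
      · exact fun t ht => (hder t ht).continuousAt.continuousWithinAt
      · intro t ht
        have ht := interior_subset ht
        rw [(hder t ht).deriv]
        exact hd _ (hmem x hx t (by simpa [Real.dist_eq] using ht))
    have := hmono.lt_iff_lt (a := s) (b := h x) (by simpa [Real.dist_eq] using hs) (hV x hx).1.2
    simp only [(hV x hx).1.1.2] at this
    exact this

/-- With `ν` the normalized gradient at `p`, the defining function increases along `ν` near `p`, so
its zero set is a graph over the tangent plane. The slope vanishes at the base point and is
therefore below any prescribed `δ` nearby. -/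
theorem IsSmoothlyBounded.exists_isGraphChart {Ω : Set R3} (hΩ : IsSmoothlyBounded Ω) {p : R3}
    (hp : p ∈ frontier Ω) {δ : ℝ} (hδ : 0 < δ) :
    ∃ ν T π h V W, IsGraphChart Ω δ ν T π h V W ∧ p ∈ W := by
  obtain ⟨U, ρ, hρ⟩ := hΩ.exists_defining p hp
  have hρ0 := hρ.eq_zero hΩ.isOpen hp
  have hg := norm_pos_iff.2 hρ.gradient_ne_zero
  set ν : R3 := ‖∇ ρ p‖⁻¹ • ∇ ρ p with hν
  have hν1 : ‖ν‖ = 1 := by rw [hν, norm_smul, norm_inv, norm_norm, inv_mul_cancel₀ hg.ne']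
  obtain ⟨T, π, hS⟩ := exists_isOrthoSplit hν1
  have hgν : ∇ ρ p = ‖∇ ρ p‖ • ν := by rw [hν, smul_smul, mul_inv_cancel₀ hg.ne', one_smul]
  let Φ : R2 × ℝ →L[ℝ] R3 := T.toContinuousLinearMap.coprod
    ((ContinuousLinearMap.id ℝ ℝ).smulRight ν)
  have hΦ : ∀ q, Φ q = T q.1 + q.2 • ν := fun q => by simp [Φ]
  let u : R2 × ℝ := (π p, ⟪ν, p⟫)
  have hΦu : Φ u = p := by rw [hΦ]; exact hS.decomp p
  let f : R2 × ℝ → ℝ := fun q => ρ (Φ q)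
  have hρd : ∀ y ∈ U, DifferentiableAt ℝ ρ y := fun y hy =>
    (hρ.smooth.contDiffAt (hρ.isOpen.mem_nhds hy)).differentiableAt (by simp)
  have hfd : ∀ q, Φ q ∈ U → ∀ w, fderiv ℝ f q w = fderiv ℝ ρ (Φ q) (Φ w) := by
    intro q hq w
    have : HasFDerivAt f ((fderiv ℝ ρ (Φ q)).comp Φ) q :=
      ((hρd _ hq).hasFDerivAt).comp q Φ.hasFDerivAt
    rw [this.fderiv]; rfl
  have hpg : ∀ w, fderiv ℝ ρ p w = ‖∇ ρ p‖ * ⟪ν, w⟫ := by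
    intro w
    have := (hρd p hρ.mem).hasGradientAt.hasFDerivAt.fderiv
    rw [this, InnerProductSpace.toDual_apply_apply]
    conv_lhs => rw [hgν]
    rw [inner_smul_left]; simp
  have hcont : ContinuousOn (fun y => fderiv ℝ ρ y ν) U :=
    ((hρ.smooth.continuousOn_fderiv_of_isOpen hρ.isOpen (by simp)).clm_apply continuousOn_const)
  let M : Set R3 := U ∩ (fun y => fderiv ℝ ρ y ν) ⁻¹' Ioi 0
  have hM : IsOpen M := hcont.isOpen_inter_preimage hρ.isOpen isOpen_Ioi
  have hpM : p ∈ M := ⟨hρ.mem, by simp [hpg, hν1, hρ.gradient_ne_zero]⟩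
  obtain ⟨h₀, r, hr, V₀, hV₀, huV, hh₀, hdh, hiff⟩ := exists_smooth_implicit (f := f) (u := u)
    (N := Φ ⁻¹' M) (hM.preimage Φ.continuous) (by simpa [hΦu] using hpM)
    (hρ.smooth.comp Φ.contDiff.contDiffOn fun q hq => hq.1) (by simp [f, hΦu, hρ0])
    (fun v hv => by
      rw [hfd v hv.1]
      have : Φ (0, 1) = ν := by simp [hΦ]
      rw [this]; exact hv.2)
    (fun w => by
      have : Φ (w, 0) = T w := by simp [hΦ]
      rw [hfd u (by rw [hΦu]; exact hρ.mem), hΦu, this, hpg, hS.inner_embed, mul_zero])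
  -- The implicit function is smooth only near `u.1`; multiplying by a bump function makes it smooth
  -- on the whole plane without changing it near `u.1`.
  obtain ⟨χ, hχV⟩ : ∃ χ : ContDiffBump u.1, closedBall u.1 χ.rOut ⊆ V₀ := by
    obtain ⟨ε, hε, hb⟩ := Metric.nhds_basis_closedBall.mem_iff.1 (hV₀.mem_nhds huV)
    exact ⟨⟨ε / 2, ε, by positivity, by linarith⟩, hb⟩
  let h : R2 → ℝ := fun x => χ x * h₀ x
  have hhs : ContDiff ℝ ∞ h := by
    rw [contDiff_iff_contDiffAt]
    intro x
    by_cases hx : x ∈ V₀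
    · exact χ.contDiffAt.mul (hh₀.contDiffAt (hV₀.mem_nhds hx))
    · have : h =ᶠ[𝓝 x] fun _ => 0 := by
        filter_upwards [isClosed_closedBall.isOpen_compl.mem_nhds (fun hx' => hx (hχV hx'))]
          with y hy
        have : χ y = 0 := χ.zero_of_le_dist (not_le.1 fun h => hy (mem_closedBall.2 h)).le
        simp [h, this]
      exact contDiffAt_const.congr_of_eventuallyEq this
  have heq : ∀ x ∈ ball u.1 χ.rIn, h x = h₀ x := fun x hx => by
    simp [h, χ.one_of_mem_closedBall (ball_subset_closedBall hx)]
  have hdh' : fderiv ℝ h u.1 = 0 := by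
    have : h =ᶠ[𝓝 u.1] h₀ := by
      filter_upwards [ball_mem_nhds u.1 χ.rIn_pos] with x hx using heq x hx
    exact (hdh.congr_of_eventuallyEq this).fderiv
  have hsmall : ∀ᶠ x in 𝓝 u.1, ‖fderiv ℝ h x‖ < δ := by
    have : Continuous fun x => ‖fderiv ℝ h x‖ := (hhs.continuous_fderiv (by simp)).norm
    exact this.continuousAt.eventually_lt continuousAt_const (by simpa [hdh'] using hδ)
  obtain ⟨ε, hε, hVε⟩ := Metric.eventually_nhds_iff_ball.1
    (hsmall.and ((eventually_mem_set.2 (ball_mem_nhds u.1 χ.rIn_pos)).and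
      (eventually_mem_set.2 (hV₀.mem_nhds huV))))
  -- The three constraints keep the slope small, keep the height in the range where the sign
  -- criterion holds, and make `W` bounded.
  let W : Set R3 := π ⁻¹' ball u.1 ε ∩ {y | |⟪ν, y⟫ - u.2| < r} ∩ ball p 1
  refine ⟨ν, T, π, h, ball u.1 ε, W, ⟨hS, hhs, convex_ball _ _, fun x hx => (hVε x hx).1.le,
    ?_, isBounded_ball.subset inter_subset_right, fun y hy => hy.1.1, fun y hy => ?_⟩, ?_⟩
  · exact ((isOpen_ball.preimage π.continuous).inter
      (isOpen_lt (by fun_prop) continuous_const)).inter isOpen_ball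
  · obtain ⟨hyM, hyi⟩ := hiff (π y) (hVε _ hy.1.1).2.2 ⟪ν, y⟫ hy.1.2
    have hΦy : Φ (π y, ⟪ν, y⟫) = y := by rw [hΦ]; exact hS.decomp y
    rw [mem_preimage, hΦy] at hyM
    rw [heq _ (hVε _ hy.1.1).2.1, ← hyi]
    simp only [f, hΦy]
    have := hρ.inter_eq
    constructor
    · intro hyΩ
      have : y ∈ Ω ∩ U := ⟨hyΩ, hyM.1⟩
      rw [hρ.inter_eq] at this
      exact this.2
    · intro hlt
      have : y ∈ Ω ∩ U := by rw [hρ.inter_eq]; exact ⟨hyM.1, hlt⟩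
      exact this.1
  · refine ⟨⟨?_, ?_⟩, mem_ball_self one_pos⟩
    · exact mem_ball_self (α := R2) hε
    · change |⟪ν, p⟫ - ⟪ν, p⟫| < r
      rwa [sub_self, abs_zero]

/-! ### Boundary layers in a half space. -/

/-- A smooth cutoff that is `1` on `(-∞, -2]` and `0` on `[-1, ∞)`. -/
noncomputable def inwardCutoff (t : ℝ) : ℝ := Real.smoothTransition (-1 - t)

theorem contDiff_inwardCutoff : ContDiff ℝ ∞ inwardCutoff :=
  Real.smoothTransition.contDiff.comp (contDiff_const.sub contDiff_id)

theorem inwardCutoff_of_le {t : ℝ} (h : t ≤ -2) : inwardCutoff t = 1 :=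
  Real.smoothTransition.one_of_one_le (by linarith)

theorem inwardCutoff_of_ge {t : ℝ} (h : -1 ≤ t) : inwardCutoff t = 0 :=
  Real.smoothTransition.zero_of_nonpos (by linarith)

theorem abs_inwardCutoff_le (t : ℝ) : |inwardCutoff t| ≤ 1 := by
  rw [inwardCutoff, abs_of_nonneg (Real.smoothTransition.nonneg _)]
  exact Real.smoothTransition.le_one _

theorem hasDerivAt_inwardCutoff (t : ℝ) : HasDerivAt inwardCutoff (deriv inwardCutoff t) t :=
  (contDiff_inwardCutoff.differentiable (by simp) t).hasDerivAt

theorem continuous_deriv_inwardCutoff : Continuous (deriv inwardCutoff) :=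
  contDiff_inwardCutoff.continuous_deriv (by simp)

theorem deriv_inwardCutoff_of_gt {t : ℝ} (h : -1 < t) : deriv inwardCutoff t = 0 := by
  have : inwardCutoff =ᶠ[𝓝 t] fun _ => 0 := by
    filter_upwards [Ioi_mem_nhds h] with s hs using inwardCutoff_of_ge (le_of_lt hs)
  rw [this.deriv_eq, deriv_const]

theorem deriv_inwardCutoff_of_lt {t : ℝ} (h : t < -2) : deriv inwardCutoff t = 0 := by
  have : inwardCutoff =ᶠ[𝓝 t] fun _ => 1 := by
    filter_upwards [Iio_mem_nhds h] with s hs using inwardCutoff_of_le (le_of_lt hs)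
  rw [this.deriv_eq, deriv_const]

theorem deriv_inwardCutoff_of_notMem {t : ℝ} (h : t ∉ Icc (-2 : ℝ) (-1)) :
    deriv inwardCutoff t = 0 := by
  rcases lt_or_ge t (-2) with h2 | h2
  · exact deriv_inwardCutoff_of_lt h2
  · exact deriv_inwardCutoff_of_gt (not_le.1 fun h1 => h ⟨h2, h1⟩)

theorem integral_deriv_inwardCutoff : ∫ t, deriv inwardCutoff t = -1 := by
  have hi : Integrable (deriv inwardCutoff) :=
    continuous_deriv_inwardCutoff.integrable_of_hasCompactSupport
      (HasCompactSupport.intro isCompact_Icc fun t ht => deriv_inwardCutoff_of_notMem ht)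
  have h1 : Tendsto inwardCutoff atBot (𝓝 1) := by
    refine tendsto_const_nhds.congr' ?_
    filter_upwards [eventually_le_atBot (-2 : ℝ)] with t ht using (inwardCutoff_of_le ht).symm
  have h2 : Tendsto inwardCutoff atTop (𝓝 0) := by
    refine tendsto_const_nhds.congr' ?_
    filter_upwards [eventually_ge_atTop (-1 : ℝ)] with t ht using (inwardCutoff_of_ge ht).symm
  rw [integral_of_hasDerivAt_of_tendsto hasDerivAt_inwardCutoff hi h1 h2]
  norm_num

section BoundaryLayer

variable {q : R2 × ℝ → ℝ} {K : Set (R2 × ℝ)}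

/-- The function `q` is continuous only on the closed lower half space, but the cutoff derivative
vanishes near `p.2 ≥ 0`, so the product extends continuously by zero. -/
theorem continuous_cutoff_mul (hq : ContinuousOn q {p | p.2 ≤ 0}) {a b : ℝ} (ha : 0 < a)
    (hb : 0 < b) :
    Continuous fun p : R2 × ℝ => deriv inwardCutoff (a * p.2) * q (p.1, b * p.2) := by
  rw [continuous_iff_continuousAt]
  intro p
  rcases lt_or_ge p.2 0 with hp | hp
  · have h1 : ContinuousAt q (p.1, b * p.2) := hq.continuousAt
      (mem_of_superset ((isOpen_lt continuous_snd continuous_const).mem_nhds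
        (mul_neg_of_pos_of_neg hb hp : b * p.2 < 0)) fun x (hx : x.2 < 0) => hx.le)
    have h2 : ContinuousAt (fun p : R2 × ℝ => (p.1, b * p.2)) p := by fun_prop
    exact ((continuous_deriv_inwardCutoff.comp (by fun_prop)).continuousAt).mul
      (ContinuousAt.comp (f := fun p : R2 × ℝ => (p.1, b * p.2)) h1 h2)
  · have : (fun p : R2 × ℝ => deriv inwardCutoff (a * p.2) * q (p.1, b * p.2))
        =ᶠ[𝓝 p] fun _ => 0 := by
      have : {p : R2 × ℝ | -1 < a * p.2} ∈ 𝓝 p :=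
        (isOpen_lt continuous_const (by fun_prop)).mem_nhds (by
          have := mul_nonneg ha.le hp
          change -1 < a * p.2
          linarith)
      filter_upwards [this] with x hx
      rw [deriv_inwardCutoff_of_gt hx, zero_mul]
    exact continuousAt_const.congr this.symm

theorem integrable_cutoff_mul (hq : ContinuousOn q {p | p.2 ≤ 0}) (hK : IsCompact K)
    (hqK : ∀ p ∉ K, q p = 0) {a b : ℝ} (ha : 0 < a) (hb : 0 < b) :
    Integrable fun p : R2 × ℝ => deriv inwardCutoff (a * p.2) * q (p.1, b * p.2) := by
  refine (continuous_cutoff_mul hq ha hb).integrable_of_hasCompactSupport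
    (HasCompactSupport.intro (hK.image (f := fun p : R2 × ℝ => (p.1, b⁻¹ * p.2)) (by fun_prop)) ?_)
  intro p hp
  rw [hqK, mul_zero]
  intro hm
  exact hp ⟨_, hm, by simp [hb.ne']⟩

/-- Layers that shrink to the boundary of a half space from inside see the boundary values. -/
theorem tendsto_integral_boundary_layer (hq : ContinuousOn q {p | p.2 ≤ 0}) (hK : IsCompact K)
    (hqK : ∀ p ∉ K, q p = 0) :
    Tendsto (fun k : ℕ => ∫ p : R2 × ℝ, k * deriv inwardCutoff (k * p.2) * q p) atTop
      (𝓝 (-∫ x : R2, q (x, 0))) := by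
  -- Substituting `t = k s` in the vertical variable absorbs the factor `k` and moves the scaling
  -- into `q`; the layer is then fixed.
  have key : ∀ k : ℕ, 0 < k → ∫ p : R2 × ℝ, k * deriv inwardCutoff (k * p.2) * q p =
      ∫ p : R2 × ℝ, deriv inwardCutoff p.2 * q (p.1, (k : ℝ)⁻¹ * p.2) := by
    intro k hk
    have hk' : (0 : ℝ) < k := by exact_mod_cast hk
    have i1 := (integrable_cutoff_mul hq hK hqK hk' one_pos).const_mul (k : ℝ)
    have i2 := integrable_cutoff_mul hq hK hqK one_pos (inv_pos.2 hk')
    simp only [one_mul, Prod.mk.eta, ← mul_assoc] at i1 i2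
    rw [Measure.volume_eq_prod] at i1 i2 ⊢
    rw [integral_prod _ i1, integral_prod _ i2]
    congr 1 with x
    have := Measure.integral_comp_mul_left
      (fun t => k * (deriv inwardCutoff t * q (x, (k : ℝ)⁻¹ * t))) (k : ℝ)
    simp only [inv_mul_cancel_left₀ hk'.ne', abs_of_pos (inv_pos.2 hk'), integral_const_mul,
      smul_eq_mul] at this
    simp only [mul_assoc]
    rw [integral_const_mul, this]
  have hlim : -∫ x : R2, q (x, 0) = ∫ p : R2 × ℝ, deriv inwardCutoff p.2 * q (p.1, 0) := by
    have := integral_prod_mul (μ := (volume : Measure R2)) (ν := (volume : Measure ℝ))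
      (fun x => q (x, 0)) (deriv inwardCutoff)
    rw [integral_deriv_inwardCutoff] at this
    rw [Measure.volume_eq_prod]
    simp only [mul_comm (deriv inwardCutoff _)]
    rw [this]; ring
  rw [hlim]
  refine Tendsto.congr' (f₁ := fun k : ℕ => ∫ p : R2 × ℝ, deriv inwardCutoff p.2 *
    q (p.1, (k : ℝ)⁻¹ * p.2)) ?_ ?_
  · filter_upwards [eventually_gt_atTop 0] with k hk using (key k hk).symm
  obtain ⟨M, hM⟩ :=
    (hK.inter_right (isClosed_le continuous_snd continuous_const)).exists_bound_of_continuousOn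
    (f := q) (hq.mono inter_subset_right)
  obtain ⟨C, hC⟩ := (isCompact_Icc (a := (-2 : ℝ)) (b := -1)).exists_bound_of_continuousOn
    continuous_deriv_inwardCutoff.continuousOn
  -- After rescaling, all the integrands live over the shadow of `K` and at heights in `[-2, -1]`;
  -- this compact set carries the constant dominating function.
  have hK₂ : IsCompact ((Prod.fst '' K) ×ˢ Icc (-2 : ℝ) (-1)) :=
    (hK.image continuous_fst).prod isCompact_Icc
  refine tendsto_integral_filter_of_dominated_convergence
    (((Prod.fst '' K) ×ˢ Icc (-2 : ℝ) (-1)).indicator fun _ => C * |M|) ?_ ?_ ?_ ?_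
  · filter_upwards [eventually_gt_atTop 0] with k hk
    have hk' : (0 : ℝ) < k := by exact_mod_cast hk
    have := continuous_cutoff_mul hq one_pos (inv_pos.2 hk')
    simp only [one_mul] at this
    exact this.aestronglyMeasurable
  · filter_upwards with k
    refine ae_of_all _ fun p => ?_
    by_cases hp : p.2 ∈ Icc (-2 : ℝ) (-1)
    · by_cases hx : (p.1, (k : ℝ)⁻¹ * p.2) ∈ K
      · have hneg : (k : ℝ)⁻¹ * p.2 ≤ 0 :=
          mul_nonpos_of_nonneg_of_nonpos (by positivity) (by linarith [hp.2])
        rw [indicator_of_mem (show p ∈ (Prod.fst '' K) ×ˢ Icc (-2 : ℝ) (-1) from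
          ⟨⟨_, hx, rfl⟩, hp⟩), norm_mul]
        exact mul_le_mul (hC _ hp) ((hM _ ⟨hx, hneg⟩).trans (le_abs_self M)) (norm_nonneg _)
          ((norm_nonneg _).trans (hC _ hp))
      · rw [hqK _ hx, mul_zero, norm_zero]
        by_cases hp1 : p ∈ (Prod.fst '' K) ×ˢ Icc (-2 : ℝ) (-1)
        · rw [indicator_of_mem hp1]
          exact mul_nonneg ((norm_nonneg _).trans (hC _ hp)) (abs_nonneg M)
        · rw [indicator_of_notMem hp1]
    · rw [deriv_inwardCutoff_of_notMem hp, zero_mul, norm_zero, indicator_of_notMem]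
      exact fun h => hp h.2
  · exact (integrable_indicator_iff hK₂.measurableSet).2
      (integrableOn_const hK₂.measure_lt_top.ne)
  · refine ae_of_all _ fun p => ?_
    by_cases hp : p.2 ∈ Icc (-2 : ℝ) (-1)
    · refine tendsto_const_nhds.mul ?_
      have h0 : ContinuousWithinAt q {p | p.2 ≤ 0} (p.1, 0) := hq _ (le_refl (0 : ℝ))
      refine Tendsto.comp h0 (tendsto_nhdsWithin_iff.2 ⟨?_, Eventually.of_forall fun k => ?_⟩)
      · refine tendsto_const_nhds.prodMk_nhds ?_
        simpa using (tendsto_inv_atTop_nhds_zero_nat (𝕜 := ℝ)).mul_const p.2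
      · have h1 : p.2 ≤ 0 := by linarith [hp.2]
        exact mul_nonpos_of_nonneg_of_nonpos (inv_nonneg.2 (Nat.cast_nonneg k)) h1
    · simp [deriv_inwardCutoff_of_notMem hp]

end BoundaryLayer

/-! ### Geometry and surface measure in a graph chart. -/

/-- The height of a point above the graph of `h`. -/
noncomputable def graphHeight (ν : R3) (π : R3 →L[ℝ] R2) (h : R2 → ℝ) (y : R3) : ℝ :=
  ⟪ν, y⟫ - h (π y)

/-- The parametrization of the graph of `h`. -/
noncomputable def graphMap (ν : R3) (T : R2 →ₗᵢ[ℝ] R3) (h : R2 → ℝ) (x : R2) : R3 :=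
  T x + h x • ν

namespace IsGraphChart

variable {Ω : Set R3} {δ : ℝ} {ν : R3} {T : R2 →ₗᵢ[ℝ] R3} {π : R3 →L[ℝ] R2} {h : R2 → ℝ}
  {V : Set R2} {W : Set R3}

theorem mem_iff_height (C : IsGraphChart Ω δ ν T π h V W) {y : R3} (hy : y ∈ W) :
    y ∈ Ω ↔ graphHeight ν π h y < 0 := by
  rw [C.mem_iff y hy, graphHeight, sub_neg]

theorem contDiff_height (C : IsGraphChart Ω δ ν T π h V W) :
    ContDiff ℝ ∞ (graphHeight ν π h) :=
  (contDiff_const.inner ℝ contDiff_id).sub (C.smooth.comp π.contDiff)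

theorem continuous_graphMap (C : IsGraphChart Ω δ ν T π h V W) : Continuous (graphMap ν T h) :=
  T.continuous.add (C.smooth.continuous.smul continuous_const)

theorem height_add (C : IsGraphChart Ω δ ν T π h V W) (x : R2) (s : ℝ) :
    graphHeight ν π h (graphMap ν T h x + s • ν) = s := by
  have e : graphMap ν T h x + s • ν = T x + (h x + s) • ν := by
    rw [graphMap, add_smul, add_assoc]
  rw [graphHeight, e, C.split.inner_normal, C.split.proj_apply]
  ring

theorem height_graphMap (C : IsGraphChart Ω δ ν T π h V W) (x : R2) :
    graphHeight ν π h (graphMap ν T h x) = 0 := by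
  simpa using C.height_add x 0

theorem proj_graphMap (C : IsGraphChart Ω δ ν T π h V W) (x : R2) :
    π (graphMap ν T h x) = x := C.split.proj_apply _ _

theorem graphMap_proj_add (C : IsGraphChart Ω δ ν T π h V W) (y : R3) :
    graphMap ν T h (π y) + graphHeight ν π h y • ν = y := by
  rw [graphMap, graphHeight, add_assoc, ← add_smul, add_sub_cancel, C.split.decomp]

theorem graphMap_proj (C : IsGraphChart Ω δ ν T π h V W) {y : R3}
    (hy : graphHeight ν π h y = 0) : graphMap ν T h (π y) = y := by
  simpa [hy] using C.graphMap_proj_add y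

/-- Taking the closure relaxes the strict inequality; conversely, a point of nonpositive height is
the limit of the points `y - t • ν`, which lie strictly below the graph. -/
theorem mem_closure_iff (C : IsGraphChart Ω δ ν T π h V W) {y : R3} (hy : y ∈ W) :
    y ∈ closure Ω ↔ graphHeight ν π h y ≤ 0 := by
  constructor
  · intro hc
    have h1 : y ∈ closure (W ∩ Ω) := C.isOpen.inter_closure ⟨hy, hc⟩
    exact closure_lt_subset_le C.contDiff_height.continuous continuous_const
      (closure_mono (fun z hz => (C.mem_iff_height hz.1).1 hz.2) h1)
  · intro hle
    have ht : Tendsto (fun t : ℝ => y - t • ν) (𝓝[>] 0) (𝓝 y) := by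
      have : Continuous fun t : ℝ => y - t • ν := by fun_prop
      simpa using (this.tendsto 0).mono_left nhdsWithin_le_nhds
    refine mem_closure_of_tendsto ht ?_
    filter_upwards [ht (C.isOpen.mem_nhds hy), self_mem_nhdsWithin] with t htW ht0
    refine (C.mem_iff_height htW).2 ?_
    have e : y - t • ν = graphMap ν T h (π y) + (graphHeight ν π h y - t) • ν := by
      conv_lhs => rw [← C.graphMap_proj_add y]
      rw [sub_smul, add_sub_assoc]
    change graphHeight ν π h (y - t • ν) < 0
    rw [e, C.height_add]
    have : (0 : ℝ) < t := ht0
    linarith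

theorem mem_frontier_iff (C : IsGraphChart Ω δ ν T π h V W) (hΩ : IsOpen Ω) {y : R3}
    (hy : y ∈ W) : y ∈ frontier Ω ↔ graphHeight ν π h y = 0 := by
  rw [hΩ.frontier_eq, Set.mem_sdiff, C.mem_closure_iff hy, C.mem_iff_height hy]
  constructor
  · rintro ⟨h1, h2⟩; linarith
  · intro h; exact ⟨h.le, by linarith⟩

theorem fderiv_height_apply (C : IsGraphChart Ω δ ν T π h V W) (y w : R3) :
    fderiv ℝ (graphHeight ν π h) y w = ⟪ν, w⟫ - fderiv ℝ h (π y) (π w) := by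
  have h1 : HasFDerivAt h (fderiv ℝ h (π y)) (π y) :=
    (C.smooth.differentiable (by simp) _).hasFDerivAt
  have : HasFDerivAt (graphHeight ν π h)
      ((innerSL ℝ ν : R3 →L[ℝ] ℝ) - (fderiv ℝ h (π y)).comp π) y :=
    ((innerSL ℝ ν : R3 →L[ℝ] ℝ).hasFDerivAt).sub (h1.comp y π.hasFDerivAt)
  rw [this.fderiv]; simp

theorem inner_gradient_height (C : IsGraphChart Ω δ ν T π h V W) (y w : R3) :
    ⟪∇ (graphHeight ν π h) y, w⟫ = fderiv ℝ (graphHeight ν π h) y w := by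
  have := (C.contDiff_height.differentiable (by simp) y).hasGradientAt.hasFDerivAt.fderiv
  rw [this, InnerProductSpace.toDual_apply_apply]

/-- The derivative of the height in the unit direction `ν` is `1`. -/
theorem one_le_norm_gradient (C : IsGraphChart Ω δ ν T π h V W) (y : R3) :
    1 ≤ ‖∇ (graphHeight ν π h) y‖ := by
  have h1 : ⟪∇ (graphHeight ν π h) y, ν⟫ = 1 := by
    rw [C.inner_gradient_height, C.fderiv_height_apply, C.split.proj_normal]
    simp [C.split.norm_eq]
  have h2 := real_inner_le_norm (∇ (graphHeight ν π h) y) ν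
  rw [h1, C.split.norm_eq, mul_one] at h2
  exact h2

/-- Evaluate the derivative of the height on its own gradient `g`: the vertical part is at most
`‖g‖` and the slope part at most `δ ‖g‖`. -/
theorem norm_gradient_le (C : IsGraphChart Ω δ ν T π h V W) {y : R3} (hy : y ∈ W) :
    ‖∇ (graphHeight ν π h) y‖ ≤ 1 + δ := by
  set g := ∇ (graphHeight ν π h) y
  have hpos : 0 < ‖g‖ := one_pos.trans_le (C.one_le_norm_gradient y)
  have h1 : ‖g‖ * ‖g‖ ≤ (1 + δ) * ‖g‖ := by
    rw [← real_inner_self_eq_norm_mul_norm, C.inner_gradient_height, C.fderiv_height_apply]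
    have a := (abs_real_inner_le_norm ν g)
    rw [C.split.norm_eq, one_mul] at a
    have b := (fderiv ℝ h (π y)).le_opNorm (π g)
    have c : ‖fderiv ℝ h (π y)‖ * ‖π g‖ ≤ δ * ‖g‖ :=
      mul_le_mul (C.slope_le _ (C.proj_mem y hy)) (C.split.norm_proj_le g) (norm_nonneg _)
        ((norm_nonneg _).trans (C.slope_le _ (C.proj_mem y hy)))
    rw [Real.norm_eq_abs] at b
    have := abs_le.1 a
    have := abs_le.1 b
    linarith [this.1]
  exact le_of_mul_le_mul_right h1 hpos

theorem continuous_gradient (C : IsGraphChart Ω δ ν T π h V W) :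
    Continuous (∇ (graphHeight ν π h)) := by
  have := C.contDiff_height.continuous_fderiv (by simp)
  exact (InnerProductSpace.toDual ℝ R3).symm.continuous.comp this

theorem isLocalDefiningFunction (C : IsGraphChart Ω δ ν T π h V W) {y : R3} (hy : y ∈ W) :
    IsLocalDefiningFunction Ω y W (graphHeight ν π h) where
  isOpen := C.isOpen
  mem := hy
  smooth := C.contDiff_height.contDiffOn
  gradient_ne_zero := norm_pos_iff.1 (one_pos.trans_le (C.one_le_norm_gradient y))
  inter_eq := by
    ext z
    exact ⟨fun hz => ⟨hz.2, (C.mem_iff_height hz.2).1 hz.1⟩,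
      fun hz => ⟨(C.mem_iff_height hz.1).2 hz.2, hz.1⟩⟩

theorem outwardNormal_eq (C : IsGraphChart Ω δ ν T π h V W) {y : R3} (hy : y ∈ W)
    (hyΓ : y ∈ frontier Ω) :
    outwardNormal Ω y = ‖∇ (graphHeight ν π h) y‖⁻¹ • ∇ (graphHeight ν π h) y :=
  (C.isLocalDefiningFunction hy).outwardNormal_eq hyΓ

/-- The normal is the normalized gradient `g`, so the difference has length `‖g‖ - 1`, and `1 ≤ ‖g‖
≤ 1 + δ`. -/
theorem norm_gradient_sub_normal_le (C : IsGraphChart Ω δ ν T π h V W) {y : R3} (hy : y ∈ W)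
    (hyΓ : y ∈ frontier Ω) : ‖∇ (graphHeight ν π h) y - outwardNormal Ω y‖ ≤ δ := by
  rw [C.outwardNormal_eq hy hyΓ]
  set g := ∇ (graphHeight ν π h) y
  have h1 : 1 ≤ ‖g‖ := C.one_le_norm_gradient y
  have h2 : ‖g‖ ≤ 1 + δ := C.norm_gradient_le hy
  have e : g - ‖g‖⁻¹ • g = (1 - ‖g‖⁻¹) • g := by rw [sub_smul, one_smul]
  rw [e, norm_smul, Real.norm_eq_abs, abs_of_nonneg (sub_nonneg.2 (inv_le_one_of_one_le₀ h1)),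
    sub_mul, inv_mul_cancel₀ (by linarith)]
  linarith

theorem continuousWithinAt_normal (C : IsGraphChart Ω δ ν T π h V W) {y : R3} (hy : y ∈ W)
    (hyΓ : y ∈ frontier Ω) : ContinuousWithinAt (outwardNormal Ω) (frontier Ω) y := by
  have h1 : ContinuousAt (fun y => ‖∇ (graphHeight ν π h) y‖⁻¹ • ∇ (graphHeight ν π h) y) y := by
    refine ContinuousAt.smul (ContinuousAt.inv₀ C.continuous_gradient.norm.continuousAt ?_)
      C.continuous_gradient.continuousAt
    linarith [C.one_le_norm_gradient y]
  refine h1.continuousWithinAt.congr_of_eventuallyEq ?_ (C.outwardNormal_eq hy hyΓ)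
  filter_upwards [self_mem_nhdsWithin, mem_nhdsWithin_of_mem_nhds (C.isOpen.mem_nhds hy)]
    with z hz hzW using C.outwardNormal_eq hzW hz

/-- The flattening map carries a half space into `closure Ω` near `y`, and its derivative is onto,
so unique differentiability is inherited. This makes derivatives up to the boundary well defined and
continuous. -/
theorem uniqueDiffWithinAt (C : IsGraphChart Ω δ ν T π h V W) {y : R3} (hy : y ∈ W)
    (hyΓ : graphHeight ν π h y = 0) : UniqueDiffWithinAt ℝ (closure Ω) y := by
  have hder : HasFDerivAt (fun q : R2 × ℝ => graphMap ν T h q.1 + q.2 • ν)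
      (T.toContinuousLinearMap.comp (.fst ℝ R2 ℝ) + ((fderiv ℝ h (π y)).comp
        (.fst ℝ R2 ℝ)).smulRight ν + (ContinuousLinearMap.snd ℝ R2 ℝ).smulRight ν) (π y, 0) := by
    have h1 : HasFDerivAt h (fderiv ℝ h (π y)) (π y) :=
      (C.smooth.differentiable (by simp) _).hasFDerivAt
    refine HasFDerivAt.add (HasFDerivAt.add ?_ ?_) ?_
    · exact T.toContinuousLinearMap.hasFDerivAt.comp (π y, (0 : ℝ)) hasFDerivAt_fst
    · exact (h1.comp (f := Prod.fst) (π y, (0 : ℝ)) hasFDerivAt_fst).smul_const ν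
    · exact hasFDerivAt_snd.smul_const ν
  have hs : UniqueDiffWithinAt ℝ ((univ : Set R2) ×ˢ Iic (0 : ℝ)) (π y, 0) :=
    (uniqueDiffWithinAt_univ).prod (uniqueDiffOn_Iic 0 0 self_mem_Iic)
  have := hder.hasFDerivWithinAt.uniqueDiffWithinAt hs (by
    refine Function.Surjective.denseRange fun z =>
      ⟨(π z, ⟪ν, z⟫ - fderiv ℝ h (π y) (π z)), ?_⟩
    conv_rhs => rw [← C.split.decomp z]
    simp [sub_smul])
  simp only [zero_smul, add_zero, C.graphMap_proj hyΓ] at this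
  rw [← uniqueDiffWithinAt_inter (C.isOpen.mem_nhds hy)] at this ⊢
  refine this.mono ?_
  rintro z ⟨⟨q, hq, rfl⟩, hzW⟩
  refine ⟨(C.mem_closure_iff hzW).2 ?_, hzW⟩
  rw [C.height_add]
  exact hq.2

/-- Flattening the graph preserves volume. -/
theorem integral_flatten (C : IsGraphChart Ω δ ν T π h V W) (f : R3 → ℝ) :
    ∫ q : R2 × ℝ, f (graphMap ν T h q.1 + q.2 • ν) = ∫ y, f y := by
  -- Flattening is a vertical shear followed by the splitting isometry; both preserve volume.
  have hshear : MeasurePreserving (fun q : R2 × ℝ => (q.1, h q.1 + q.2)) :=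
    (MeasurePreserving.id volume).skew_product (g := fun x s => h x + s)
      ((C.smooth.continuous.comp continuous_fst).add continuous_snd).measurable
      (ae_of_all _ fun x => (measurePreserving_add_left volume (h x)).map_eq)
  have hmp : MeasurePreserving (fun q : R2 × ℝ => graphMap ν T h q.1 + q.2 • ν) := by
    have := C.split.measurePreserving.comp hshear
    convert! this using 2 with q
    simp [graphMap, add_smul, add_assoc]
  refine hmp.integral_comp (Continuous.measurableEmbedding ?_ ?_) f
  · exact (C.continuous_graphMap.comp continuous_fst).add (by fun_prop)
  · intro q r hqr
    have h1 := congrArg (graphHeight ν π h) hqr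
    simp only [C.height_add] at h1
    have h2 := congrArg π hqr
    simp only [map_add, map_smul, C.proj_graphMap, C.split.proj_normal, smul_zero, add_zero] at h2
    exact Prod.ext h2 h1

/-- Layers shrinking to the graph from inside `Ω` see the values on the graph. -/
theorem tendsto_integral_layer (C : IsGraphChart Ω δ ν T π h V W) {q : R3 → ℝ} {K : Set R3}
    (hq : ContinuousOn q (closure Ω)) (hK : IsCompact K) (hKW : K ⊆ W)
    (hqK : ∀ y ∉ K, q y = 0) :
    Tendsto (fun k : ℕ => ∫ y in Ω, k * deriv inwardCutoff (k * graphHeight ν π h y) * q y) atTop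
      (𝓝 (-∫ x : R2, q (graphMap ν T h x))) := by
  have hcont : Continuous fun p : R2 × ℝ => graphMap ν T h p.1 + p.2 • ν :=
    (C.continuous_graphMap.comp continuous_fst).add (by fun_prop)
  have hcinv : Continuous fun y : R3 => (π y, graphHeight ν π h y) :=
    π.continuous.prodMk C.contDiff_height.continuous
  have main := tendsto_integral_boundary_layer
    (q := fun p : R2 × ℝ => q (graphMap ν T h p.1 + p.2 • ν))
    (K := (fun y : R3 => (π y, graphHeight ν π h y)) '' K) ?_ (hK.image hcinv) ?_
  · simp only [zero_smul, add_zero] at main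
    refine main.congr fun k => ?_
    -- The restriction to `Ω` can be dropped: on the part of `K` outside `Ω` the height is
    -- nonnegative, where the cutoff derivative vanishes.
    rw [setIntegral_eq_integral_of_forall_compl_eq_zero, ← C.integral_flatten]
    · simp only [C.height_add]
    · intro y hy
      by_cases hyK : y ∈ K
      · have : 0 ≤ graphHeight ν π h y := by
          have := (C.mem_iff_height (hKW hyK)).not.1 hy
          linarith
        rw [deriv_inwardCutoff_of_gt (neg_one_lt_zero.trans_le
          (mul_nonneg (Nat.cast_nonneg k) this))]
        simp
      · rw [hqK y hyK, mul_zero]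
  · intro p hp
    have hp : p.2 ≤ 0 := hp
    by_cases hpK : graphMap ν T h p.1 + p.2 • ν ∈ K
    · have h1 := hq _ ((C.mem_closure_iff (hKW hpK)).2 (by rwa [C.height_add]))
      rw [← continuousWithinAt_inter (C.isOpen.mem_nhds (hKW hpK))] at h1
      rw [← continuousWithinAt_inter ((C.isOpen.preimage hcont).mem_nhds (hKW hpK))]
      refine ContinuousWithinAt.comp (t := closure Ω ∩ W) h1 hcont.continuousWithinAt ?_
      rintro z ⟨hz, hzW⟩
      exact ⟨(C.mem_closure_iff hzW).2 (by rw [C.height_add]; exact hz), hzW⟩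
    · refine ContinuousAt.continuousWithinAt (continuousAt_const (y := (0 : ℝ)) |>.congr ?_)
      filter_upwards [(hK.isClosed.isOpen_compl.preimage hcont).mem_nhds hpK] with z hz
      exact (hqK _ hz).symm
  · intro p hp
    refine hqK _ fun hm => hp ⟨_, hm, ?_⟩
    refine Prod.ext ?_ (C.height_add _ _)
    simp [C.proj_graphMap, C.split.proj_normal]

theorem graphMap_preimage_subset (C : IsGraphChart Ω δ ν T π h V W) {A : Set R3}
    (hA : A ⊆ W) : graphMap ν T h ⁻¹' A ⊆ V := by
  intro x hx
  have := C.proj_mem _ (hA hx)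
  rwa [C.proj_graphMap] at this

/-- The preimage of `A` under the graph map lies in the projection of `A`, and the projection is
1-Lipschitz. Together with `area_le` this compares surface measure and plane measure. -/
theorem volume_preimage_le (C : IsGraphChart Ω δ ν T π h V W) (A : Set R3) :
    volume (graphMap ν T h ⁻¹' A) ≤ μHE[2] A := by
  have hsub : graphMap ν T h ⁻¹' A ⊆ π '' A := fun x hx => ⟨_, hx, C.proj_graphMap x⟩
  have hlip : LipschitzWith 1 π := LipschitzWith.of_dist_le_mul fun x y => by
    rw [dist_eq_norm, dist_eq_norm, ← map_sub, NNReal.coe_one, one_mul]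
    exact C.split.norm_proj_le _
  refine (measure_mono hsub).trans ?_
  rw [← EuclideanSpace.euclideanHausdorffMeasure_eq_volume, Measure.euclideanHausdorffMeasure_def,
    Measure.euclideanHausdorffMeasure_def, Measure.smul_apply, Measure.smul_apply]
  have := hlip.hausdorffMeasure_image_le (d := (2 : ℕ)) (by simp) A
  simp only [ENNReal.coe_one, ENNReal.one_rpow, one_mul] at this
  gcongr

/-- On the convex set `V` the slope bound makes the graph map `(1 + δ)`-Lipschitz, and
two-dimensional measure scales by the square of the Lipschitz constant. -/
theorem area_le (C : IsGraphChart Ω δ ν T π h V W) (hδ : 0 ≤ δ) (hΩ : IsOpen Ω) {A : Set R3}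
    (hA : A ⊆ frontier Ω ∩ W) :
    μHE[2] A ≤ (Real.toNNReal (1 + δ) ^ 2 : ℝ≥0) • volume (graphMap ν T h ⁻¹' A) := by
  have hsub : A ⊆ graphMap ν T h '' (graphMap ν T h ⁻¹' A) := fun y hy =>
    have e := C.graphMap_proj ((C.mem_frontier_iff hΩ (hA hy).2).1 (hA hy).1)
    ⟨π y, by rwa [mem_preimage, e], e⟩
  have hh : LipschitzOnWith (Real.toNNReal δ) h V :=
    C.convex.lipschitzOnWith_of_nnnorm_fderiv_le
      (fun x _ => C.smooth.differentiable (by simp) x) fun x hx => by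
        rw [← norm_toNNReal]; exact Real.toNNReal_le_toNNReal (C.slope_le x hx)
  have hlip : LipschitzOnWith (Real.toNNReal (1 + δ)) (graphMap ν T h) V := by
    refine LipschitzOnWith.of_dist_le_mul fun x hx y hy => ?_
    rw [Real.coe_toNNReal _ (by positivity), dist_eq_norm, dist_eq_norm]
    have e : graphMap ν T h x - graphMap ν T h y = T (x - y) + (h x - h y) • ν := by
      simp only [graphMap, map_sub, sub_smul]; abel
    have h1 := hh.dist_le_mul x hx y hy
    rw [Real.coe_toNNReal _ hδ, dist_eq_norm, dist_eq_norm] at h1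
    calc ‖graphMap ν T h x - graphMap ν T h y‖ ≤ ‖T (x - y)‖ + ‖(h x - h y) • ν‖ := by
          rw [e]; exact norm_add_le _ _
      _ ≤ ‖x - y‖ + δ * ‖x - y‖ := by
          rw [T.norm_map, norm_smul, C.split.norm_eq, mul_one]
          gcongr
      _ = (1 + δ) * ‖x - y‖ := by ring
  refine (measure_mono hsub).trans ?_
  have :=
    (hlip.mono (C.graphMap_preimage_subset (hA.trans inter_subset_right))).hausdorffMeasure_image_le
    (d := (2 : ℕ)) (by simp)
  rw [← EuclideanSpace.euclideanHausdorffMeasure_eq_volume, Measure.euclideanHausdorffMeasure_def,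
    Measure.euclideanHausdorffMeasure_def, Measure.smul_apply, Measure.smul_apply,
    smul_comm]
  rw [ENNReal.rpow_natCast] at this
  gcongr
  simpa [ENNReal.smul_def] using this

end IsGraphChart

/-- For a nonnegative `u` the difference of the integrals lies between `0` and `(c - 1) ∫ u ∂μ₂ ≤ (c
- 1) ∫ u ∂μ₁`; apply this to the positive and negative parts. -/
theorem abs_integral_sub_le_of_measure_le {α : Type*} [MeasurableSpace α] {μ₁ μ₂ : Measure α}
    {c : ℝ≥0} (hc : 1 ≤ c) (h21 : μ₂ ≤ μ₁) (h12 : μ₁ ≤ c • μ₂) {f : α → ℝ}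
    (hf : Integrable f μ₁) :
    |∫ x, f x ∂μ₁ - ∫ x, f x ∂μ₂| ≤ (c - 1) * ∫ x, |f x| ∂μ₁ := by
  have hf2 := hf.mono_measure h21
  have key : ∀ u : α → ℝ, (∀ x, 0 ≤ u x) → Integrable u μ₁ →
      0 ≤ ∫ x, u x ∂μ₁ - ∫ x, u x ∂μ₂ ∧
      ∫ x, u x ∂μ₁ - ∫ x, u x ∂μ₂ ≤ (c - 1) * ∫ x, u x ∂μ₁ := by
    intro u hu hi
    have a : ∫ x, u x ∂μ₂ ≤ ∫ x, u x ∂μ₁ :=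
      integral_mono_measure h21 (ae_of_all _ hu) hi
    have b : ∫ x, u x ∂μ₁ ≤ ∫ x, u x ∂(c • μ₂) :=
      integral_mono_measure h12 (ae_of_all _ hu) ((hi.mono_measure h21).smul_measure_nnreal)
    rw [integral_smul_nnreal_measure, NNReal.smul_def, smul_eq_mul] at b
    have hc' : (1 : ℝ) ≤ c := by exact_mod_cast hc
    refine ⟨by linarith, ?_⟩
    nlinarith
  obtain ⟨p1, p2⟩ := key (fun x => max (f x) 0) (fun x => le_max_right _ _) hf.pos_part
  obtain ⟨n1, n2⟩ := key (fun x => max (-f x) 0) (fun x => le_max_right _ _) hf.neg_part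
  have e : ∀ x, f x = max (f x) 0 - max (-f x) 0 := fun x => by
    rcases le_total (f x) 0 with h | h
    · rw [max_eq_right h, max_eq_left (by linarith)]; ring
    · rw [max_eq_left h, max_eq_right (by linarith)]; ring
  have e' : ∀ x, |f x| = max (f x) 0 + max (-f x) 0 := fun x => by
    rcases le_total (f x) 0 with h | h
    · rw [max_eq_right h, max_eq_left (by linarith), abs_of_nonpos h]; ring
    · rw [max_eq_left h, max_eq_right (by linarith), abs_of_nonneg h]; ring
  have i1 : ∫ x, f x ∂μ₁ = ∫ x, max (f x) 0 ∂μ₁ - ∫ x, max (-f x) 0 ∂μ₁ := by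
    rw [← integral_sub hf.pos_part hf.neg_part]; exact integral_congr_ae (ae_of_all _ e)
  have i2 : ∫ x, f x ∂μ₂ = ∫ x, max (f x) 0 ∂μ₂ - ∫ x, max (-f x) 0 ∂μ₂ := by
    rw [← integral_sub hf2.pos_part hf2.neg_part]; exact integral_congr_ae (ae_of_all _ e)
  have i3 : ∫ x, |f x| ∂μ₁ = ∫ x, max (f x) 0 ∂μ₁ + ∫ x, max (-f x) 0 ∂μ₁ := by
    rw [← integral_add hf.pos_part hf.neg_part]; exact integral_congr_ae (ae_of_all _ e')
  rw [i1, i2, i3, abs_le]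
  constructor <;> linarith

/-! ### The divergence theorem for weak divergences. -/

/-- `g` is the weak divergence of `A` in `Ω`. -/
def HasWeakDivergence (Ω : Set R3) (A : R3 → R3) (g : R3 → ℝ) : Prop :=
  ∀ φ : R3 → ℝ, ContDiff ℝ ∞ φ → HasCompactSupport φ → tsupport φ ⊆ Ω →
    ∫ y in Ω, (fderiv ℝ φ y (A y) + g y * φ y) = 0

namespace IsSmoothlyBounded

variable {Ω : Set R3}

theorem isCompact_closure (hΩ : IsSmoothlyBounded Ω) : IsCompact (closure Ω) :=
  hΩ.isBounded.isCompact_closure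

theorem isCompact_frontier (hΩ : IsSmoothlyBounded Ω) : IsCompact (frontier Ω) :=
  hΩ.isCompact_closure.of_isClosed_subset isClosed_frontier frontier_subset_closure

theorem continuousOn_outwardNormal (hΩ : IsSmoothlyBounded Ω) :
    ContinuousOn (outwardNormal Ω) (frontier Ω) := fun p hp => by
  obtain ⟨ν, T, π, h, V, W, C, hpW⟩ := hΩ.exists_isGraphChart hp one_pos
  exact C.continuousWithinAt_normal hpW hp

theorem uniqueDiffOn_closure (hΩ : IsSmoothlyBounded Ω) : UniqueDiffOn ℝ (closure Ω) := by
  intro p hp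
  by_cases hpΩ : p ∈ Ω
  · exact (hΩ.isOpen.uniqueDiffWithinAt hpΩ).mono subset_closure
  · have hpf : p ∈ frontier Ω := by rw [hΩ.isOpen.frontier_eq]; exact ⟨hp, hpΩ⟩
    obtain ⟨ν, T, π, h, V, W, C, hpW⟩ := hΩ.exists_isGraphChart hpf one_pos
    exact C.uniqueDiffWithinAt hpW ((C.mem_frontier_iff hΩ.isOpen hpW).1 hpf)

/-- By compactness a local bound suffices; in a chart of slope at most `1` the area is at most four
times that of a bounded plane set. -/
theorem area_frontier_lt_top (hΩ : IsSmoothlyBounded Ω) : μHE[2] (frontier Ω) < ⊤ := by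
  refine hΩ.isCompact_frontier.measure_lt_top_of_nhdsWithin fun p hp => ?_
  obtain ⟨ν, T, π, h, V, W, C, hpW⟩ := hΩ.exists_isGraphChart hp one_pos
  refine ⟨frontier Ω ∩ W, inter_mem_nhdsWithin _ (C.isOpen.mem_nhds hpW), ?_⟩
  refine (C.area_le zero_le_one hΩ.isOpen subset_rfl).trans_lt ?_
  have hsub : graphMap ν T h ⁻¹' (frontier Ω ∩ W) ⊆ π '' W :=
    fun x hx => ⟨_, hx.2, C.proj_graphMap x⟩
  have hb : Bornology.IsBounded (π '' W) := π.lipschitz.isBounded_image C.isBounded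
  exact ENNReal.mul_lt_top (by simp) ((measure_mono hsub).trans_lt hb.measure_lt_top)

theorem isFiniteMeasure_area (hΩ : IsSmoothlyBounded Ω) :
    IsFiniteMeasure ((μHE[2] : Measure R3).restrict (frontier Ω)) :=
  ⟨by simpa using hΩ.area_frontier_lt_top⟩

theorem integrableOn_frontier (hΩ : IsSmoothlyBounded Ω) {F : Type*} [NormedAddCommGroup F]
    {f : R3 → F} (hf : ContinuousOn f (frontier Ω)) : IntegrableOn f (frontier Ω) μHE[2] := by
  have := hΩ.isFiniteMeasure_area
  obtain ⟨M, hM⟩ := hΩ.isCompact_frontier.exists_bound_of_continuousOn hf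
  refine Integrable.of_bound (hf.aestronglyMeasurable_of_isCompact hΩ.isCompact_frontier
    hΩ.isCompact_frontier.measurableSet) M ?_
  exact (ae_restrict_iff' hΩ.isCompact_frontier.measurableSet).2 (ae_of_all _ hM)

theorem integrableOn_of_continuousOn (hΩ : IsSmoothlyBounded Ω) {F : Type*} [NormedAddCommGroup F]
    {f : R3 → F} (hf : ContinuousOn f (closure Ω)) : IntegrableOn f Ω :=
  (hf.integrableOn_compact hΩ.isCompact_closure).mono_set subset_closure

theorem integrableOn_weakDivergence (hΩ : IsSmoothlyBounded Ω) {A : R3 → R3} {g : R3 → ℝ}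
    (hA : ContinuousOn A (closure Ω)) (hg : IntegrableOn g Ω) {φ : R3 → ℝ}
    (hφ : ContDiff ℝ ∞ φ) : IntegrableOn (fun y => fderiv ℝ φ y (A y) + g y * φ y) Ω := by
  obtain ⟨M, hM⟩ := hΩ.isCompact_closure.exists_bound_of_continuousOn hφ.continuous.continuousOn
  refine (hΩ.integrableOn_of_continuousOn
    ((hφ.continuous_fderiv (by simp)).continuousOn.clm_apply hA)).add
    (hg.mul_bdd (c := M) hφ.continuous.aestronglyMeasurable ?_)
  exact (ae_restrict_iff' hΩ.isOpen.measurableSet).2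
    (ae_of_all _ fun y hy => hM y (subset_closure hy))

end IsSmoothlyBounded

namespace IsGraphChart

variable {Ω : Set R3} {δ : ℝ} {ν : R3} {T : R2 →ₗᵢ[ℝ] R3} {π : R3 →L[ℝ] R2} {h : R2 → ℝ}
  {V : Set R2} {W : Set R3}

/-- The flux through the boundary in a chart, as a plane integral. -/
theorem integral_weakDivergence (C : IsGraphChart Ω δ ν T π h V W) (hΩ : IsSmoothlyBounded Ω)
    {A : R3 → R3} {g : R3 → ℝ} (hA : ContinuousOn A (closure Ω)) (hg : IntegrableOn g Ω)
    (hw : HasWeakDivergence Ω A g) {φ : R3 → ℝ} (hφ : ContDiff ℝ ∞ φ) (hsupp : tsupport φ ⊆ W) :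
    ∫ y in Ω, (fderiv ℝ φ y (A y) + g y * φ y) = ∫ x : R2, φ (graphMap ν T h x) *
      ⟪∇ (graphHeight ν π h) (graphMap ν T h x), A (graphMap ν T h x)⟫ := by
  set σ := graphHeight ν π h with hσ
  have hσd : ∀ y, HasFDerivAt σ (fderiv ℝ σ y) y := fun y =>
    (C.contDiff_height.differentiable (by simp) y).hasFDerivAt
  have hφd : ∀ y, HasFDerivAt φ (fderiv ℝ φ y) y := fun y =>
    (hφ.differentiable (by simp) y).hasFDerivAt
  have hK : IsCompact (tsupport φ) :=
    Metric.isCompact_of_isClosed_isBounded (isClosed_tsupport φ) (C.isBounded.subset hsupp)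
  set q : R3 → ℝ := fun y => φ y * fderiv ℝ σ y (A y) with hq
  have hqc : ContinuousOn q (closure Ω) :=
    hφ.continuous.continuousOn.mul
      ((C.contDiff_height.continuous_fderiv (by simp)).continuousOn.clm_apply hA)
  have hI := hΩ.integrableOn_weakDivergence hA hg hφ
  have hcut : ∀ k : ℕ, Continuous fun y => inwardCutoff (k * σ y) := fun k =>
    contDiff_inwardCutoff.continuous.comp (continuous_const.mul C.contDiff_height.continuous)
  have step : ∀ k : ℕ, 0 < k →
      ∫ y in Ω, inwardCutoff (k * σ y) * (fderiv ℝ φ y (A y) + g y * φ y) =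
      - ∫ y in Ω, k * deriv inwardCutoff (k * σ y) * q y := by
    intro k hk
    have hk' : (0 : ℝ) < k := by exact_mod_cast hk
    -- The product of `φ` with the cutoff at depth `1 / k` is supported in the compact set where `φ`
    -- lives and `k * σ y ≤ -1`, which lies inside `Ω`; so it is an admissible test function.
    have hsm : ContDiff ℝ ∞ fun y => φ y * inwardCutoff (k * σ y) :=
      hφ.mul (contDiff_inwardCutoff.comp (contDiff_const.mul C.contDiff_height))
    have hts : tsupport (fun y => φ y * inwardCutoff (k * σ y)) ⊆
        tsupport φ ∩ {y | k * σ y ≤ -1} := by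
      refine closure_minimal ?_ ((isClosed_tsupport φ).inter
        (isClosed_le (continuous_const.mul C.contDiff_height.continuous) continuous_const))
      intro y hy
      refine ⟨subset_tsupport φ (left_ne_zero_of_mul hy),
        le_of_not_gt (a := k * σ y) (b := (-1 : ℝ)) fun hlt => ?_⟩
      exact right_ne_zero_of_mul hy (inwardCutoff_of_ge hlt.le)
    have hz := hw _ hsm (hK.of_isClosed_subset (isClosed_tsupport _)
      (hts.trans inter_subset_left)) fun y hy => by
        refine (C.mem_iff_height (hsupp (hts hy).1)).2 ?_
        have h1 : k * σ y ≤ -1 := (hts hy).2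
        by_contra hneg
        have := mul_nonneg hk'.le (not_lt.1 hneg)
        linarith
    have hder : ∀ y, fderiv ℝ (fun y => φ y * inwardCutoff (k * σ y)) y (A y) =
        inwardCutoff (k * σ y) * fderiv ℝ φ y (A y) +
        k * deriv inwardCutoff (k * σ y) * q y := by
      intro y
      have h1 : HasFDerivAt (fun y => inwardCutoff (k * σ y))
          (deriv inwardCutoff (k * σ y) • ((k : ℝ) • fderiv ℝ σ y)) y :=
        (hasDerivAt_inwardCutoff _).comp_hasFDerivAt y ((hσd y).const_mul (k : ℝ))
      rw [show (fun y => φ y * inwardCutoff (k * σ y)) =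
        φ * fun y => inwardCutoff (k * σ y) from rfl,
        ((hφd y).mul h1).fderiv]
      simp [hq]; ring
    have i2 : IntegrableOn (fun y => k * deriv inwardCutoff (k * σ y) * q y) Ω :=
      hΩ.integrableOn_of_continuousOn ((continuous_const.mul (continuous_deriv_inwardCutoff.comp
        (continuous_const.mul C.contDiff_height.continuous))).continuousOn.mul hqc)
    have i1 : IntegrableOn (fun y => inwardCutoff (k * σ y) *
        (fderiv ℝ φ y (A y) + g y * φ y)) Ω :=
      hI.bdd_mul (hcut k).aestronglyMeasurable
        (ae_of_all _ fun y => abs_inwardCutoff_le _)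
    rw [eq_neg_iff_add_eq_zero, ← integral_add i1 i2, ← hz]
    refine integral_congr_ae (ae_of_all _ fun y => ?_)
    simp only [hder]; ring
  have lim1 : Tendsto (fun k : ℕ => ∫ y in Ω, inwardCutoff (k * σ y) *
      (fderiv ℝ φ y (A y) + g y * φ y)) atTop
      (𝓝 (∫ y in Ω, (fderiv ℝ φ y (A y) + g y * φ y))) := by
    refine tendsto_integral_of_dominated_convergence
      (fun y => ‖fderiv ℝ φ y (A y) + g y * φ y‖)
      (fun k => (hcut k).aestronglyMeasurable.mul hI.aestronglyMeasurable) hI.norm ?_ ?_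
    · refine fun k => ae_of_all _ fun y => ?_
      rw [norm_mul]
      exact mul_le_of_le_one_left (norm_nonneg _) (abs_inwardCutoff_le _)
    · refine (ae_restrict_iff' hΩ.isOpen.measurableSet).2 (ae_of_all _ fun y hy => ?_)
      by_cases hyK : y ∈ tsupport φ
      · have hneg : σ y < 0 := (C.mem_iff_height (hsupp hyK)).1 hy
        refine tendsto_const_nhds.congr' ?_
        -- The cutoff equals `1` at `y` as soon as `k * σ y ≤ -2`.
        obtain ⟨N, hN⟩ := exists_nat_ge (2 / -σ y)
        filter_upwards [eventually_ge_atTop N] with k hk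
        have h1 : 2 / -σ y ≤ k := hN.trans (by exact_mod_cast hk)
        rw [div_le_iff₀ (by linarith)] at h1
        rw [inwardCutoff_of_le (by linarith), one_mul]
      · have h1 : φ y = 0 := image_eq_zero_of_notMem_tsupport hyK
        have h2 : fderiv ℝ φ y = 0 :=
          image_eq_zero_of_notMem_tsupport fun hm => hyK (tsupport_fderiv_subset ℝ hm)
        simp [h1, h2]
  have lim2 := (C.tendsto_integral_layer (q := q) hqc hK hsupp fun y hy => by
    simp [hq, image_eq_zero_of_notMem_tsupport hy]).neg
  rw [neg_neg] at lim2
  have := tendsto_nhds_unique (lim1.congr' (by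
    filter_upwards [eventually_gt_atTop 0] with k hk using step k hk)) lim2
  rw [this]
  simp only [hq, C.inner_gradient_height, hσ]

/-- Two replacements are made: the gradient of the height by the unit normal, at relative cost `δ`,
and plane measure by surface measure, at relative cost `(1 + δ)² - 1 ≤ 3δ`. -/
theorem abs_flux_sub_le (C : IsGraphChart Ω δ ν T π h V W) (hΩ : IsSmoothlyBounded Ω)
    (hδ : 0 ≤ δ) (hδ1 : δ ≤ 1)
    {A : R3 → R3} {g : R3 → ℝ} (hA : ContinuousOn A (closure Ω)) (hg : IntegrableOn g Ω)
    (hw : HasWeakDivergence Ω A g) {φ : R3 → ℝ} (hφ : ContDiff ℝ ∞ φ) (hsupp : tsupport φ ⊆ W) :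
    |(∫ y in Ω, (fderiv ℝ φ y (A y) + g y * φ y)) -
      ∫ y in frontier Ω, φ y * ⟪outwardNormal Ω y, A y⟫ ∂μHE[2]| ≤
      4 * δ * ∫ y in frontier Ω, |φ y| * ‖A y‖ ∂μHE[2] := by
  rw [C.integral_weakDivergence hΩ hA hg hw hφ hsupp]
  set ψ := graphMap ν T h with hψ
  have hAΓ : ContinuousOn A (frontier Ω) := hA.mono frontier_subset_closure
  have hmΓ : MeasurableSet (frontier Ω ∩ W) :=
    isClosed_frontier.measurableSet.inter C.isOpen.measurableSet
  set μ₁ : Measure R3 := (μHE[2]).restrict (frontier Ω ∩ W) with hμ₁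
  set μ₂ : Measure R3 := (volume.map ψ).restrict (frontier Ω ∩ W) with hμ₂
  have hψm : Measurable ψ := C.continuous_graphMap.measurable
  -- The measure `μ₂` is plane measure carried to the graph, `μ₁` the surface measure; they are
  -- squeezed by the two Lipschitz bounds.
  have h21 : μ₂ ≤ μ₁ := Measure.le_iff.2 fun s hs => by
    rw [Measure.restrict_apply hs, Measure.restrict_apply hs, Measure.map_apply hψm (hs.inter hmΓ)]
    exact C.volume_preimage_le _
  have h12 : μ₁ ≤ (Real.toNNReal (1 + δ) ^ 2 : ℝ≥0) • μ₂ := Measure.le_iff.2 fun s hs => by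
    rw [Measure.smul_apply, Measure.restrict_apply hs, Measure.restrict_apply hs,
      Measure.map_apply hψm (hs.inter hmΓ)]
    exact C.area_le hδ hΩ.isOpen inter_subset_right
  have toΓ : ∀ f : R3 → ℝ, (∀ y, y ∉ W → f y = 0) →
      ∫ y in frontier Ω, f y ∂μHE[2] = ∫ y, f y ∂μ₁ := by
    intro f hf
    rw [hμ₁, ← Measure.restrict_restrict_of_subset
      (inter_subset_left : frontier Ω ∩ W ⊆ frontier Ω)]
    refine (setIntegral_eq_integral_of_ae_compl_eq_zero ?_).symm
    refine (ae_restrict_iff' isClosed_frontier.measurableSet).2 (ae_of_all _ fun y hy hy' => ?_)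
    exact hf y fun hyW => hy' ⟨hy, hyW⟩
  have toPlane : ∀ f : R3 → ℝ, (∀ y, y ∉ W → f y = 0) → ContinuousOn f (frontier Ω) →
      ∫ x, f (ψ x) = ∫ y, f y ∂μ₂ := by
    intro f hf hfc
    have hpre : ∀ x, ψ x ∈ W → ψ x ∈ frontier Ω := fun x hx =>
      (C.mem_frontier_iff hΩ.isOpen hx).2 (C.height_graphMap x)
    have hfm : AEStronglyMeasurable f ((volume.map ψ).restrict (frontier Ω ∩ W)) :=
      (hfc.mono inter_subset_left).aestronglyMeasurable hmΓ
    rw [hμ₂, ← integral_indicator hmΓ, integral_map hψm.aemeasurable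
      ((aestronglyMeasurable_indicator_iff hmΓ).2 hfm)]
    refine integral_congr_ae (ae_of_all _ fun x => ?_)
    by_cases hx : ψ x ∈ W
    · exact (indicator_of_mem (s := frontier Ω ∩ W) ⟨hpre x hx, hx⟩ f).symm
    · exact (hf _ hx).trans (indicator_of_notMem (s := frontier Ω ∩ W) (fun h => hx h.2) f).symm
  have hφ0 : ∀ y, y ∉ W → φ y = 0 := fun y hy =>
    image_eq_zero_of_notMem_tsupport fun h => hy (hsupp h)
  have int1 : ∀ f : R3 → ℝ, ContinuousOn f (frontier Ω) → Integrable f μ₁ := fun f hf =>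
    (hΩ.integrableOn_frontier hf).mono_set inter_subset_left
  have c1 : ContinuousOn (fun y => φ y * ⟪∇ (graphHeight ν π h) y, A y⟫) (frontier Ω) :=
    hφ.continuous.continuousOn.mul (C.continuous_gradient.continuousOn.inner hAΓ)
  have c2 : ContinuousOn (fun y => φ y * ⟪outwardNormal Ω y, A y⟫) (frontier Ω) :=
    hφ.continuous.continuousOn.mul (hΩ.continuousOn_outwardNormal.inner hAΓ)
  have c3 : ContinuousOn (fun y => |φ y| * ‖A y‖) (frontier Ω) :=
    hφ.continuous.abs.continuousOn.mul hAΓ.norm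
  have e1 := toPlane _ (fun y hy => by simp [hφ0 y hy]) c1
  rw [e1, toΓ _ (fun y hy => by simp [hφ0 y hy]), toΓ _ (fun y hy => by simp [hφ0 y hy])]
  have i2 := int1 _ c2
  have i3 := int1 _ c3
  have b1 : |∫ y, φ y * ⟪∇ (graphHeight ν π h) y, A y⟫ ∂μ₂ -
      ∫ y, φ y * ⟪outwardNormal Ω y, A y⟫ ∂μ₂| ≤ δ * ∫ y, |φ y| * ‖A y‖ ∂μ₂ := by
    rw [← integral_sub ((int1 _ c1).mono_measure h21) (i2.mono_measure h21), ← Real.norm_eq_abs,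
      ← integral_const_mul]
    refine norm_integral_le_of_norm_le ((i3.mono_measure h21).const_mul δ) ?_
    refine (ae_restrict_iff' hmΓ).2 (ae_of_all _ fun y hy => ?_)
    rw [← mul_sub, ← inner_sub_left, norm_mul, Real.norm_eq_abs, mul_left_comm]
    gcongr
    exact (norm_inner_le_norm _ _).trans (by
      gcongr; exact C.norm_gradient_sub_normal_le hy.2 hy.1)
  have b2 := abs_integral_sub_le_of_measure_le (c := Real.toNNReal (1 + δ) ^ 2)
    (one_le_pow₀ (by rw [← Real.toNNReal_one]; exact Real.toNNReal_le_toNNReal (by linarith)))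
    h21 h12 i2
  have b3 : ∫ y, |φ y * ⟪outwardNormal Ω y, A y⟫| ∂μ₁ ≤ ∫ y, |φ y| * ‖A y‖ ∂μ₁ := by
    refine integral_mono_ae i2.abs i3 ((ae_restrict_iff' hmΓ).2 (ae_of_all _ fun y hy => ?_))
    have hn : ‖outwardNormal Ω y‖ = 1 := by
      rw [C.outwardNormal_eq hy.2 hy.1, norm_smul, norm_inv, norm_norm,
        inv_mul_cancel₀ (one_pos.trans_le (C.one_le_norm_gradient y)).ne']
    simp only [abs_mul]
    gcongr
    simpa [hn] using abs_real_inner_le_norm (outwardNormal Ω y) (A y)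
  have b4 : ∫ y, |φ y| * ‖A y‖ ∂μ₂ ≤ ∫ y, |φ y| * ‖A y‖ ∂μ₁ :=
    integral_mono_measure h21 (ae_of_all _ fun y => by positivity) i3
  have b5 : 0 ≤ ∫ y, |φ y| * ‖A y‖ ∂μ₁ := integral_nonneg fun y => by positivity
  -- Here `δ ≤ 1` is used to bound `2δ + δ²` by `3δ`.
  have hc : ((Real.toNNReal (1 + δ) ^ 2 : ℝ≥0) : ℝ) - 1 ≤ 3 * δ := by
    rw [NNReal.coe_pow, Real.coe_toNNReal _ (by linarith)]
    nlinarith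
  have b6 := b2.trans ((mul_le_mul_of_nonneg_right hc
    (integral_nonneg fun y => abs_nonneg _)).trans (mul_le_mul_of_nonneg_left b3 (by linarith)))
  have b7 := b1.trans (mul_le_mul_of_nonneg_left b4 hδ)
  rw [abs_le] at b6 b7 ⊢
  constructor <;> linarith [b6.1, b6.2, b7.1, b7.2]

end IsGraphChart

/-- The divergence theorem for fields that are continuous up to the boundary and have a weak
divergence. -/
theorem IsSmoothlyBounded.integral_weakDivergence {Ω : Set R3} (hΩ : IsSmoothlyBounded Ω)
    {A : R3 → R3} {g : R3 → ℝ} (hA : ContinuousOn A (closure Ω)) (hg : IntegrableOn g Ω)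
    (hw : HasWeakDivergence Ω A g) {φ : R3 → ℝ} (hφ : ContDiff ℝ ∞ φ) :
    ∫ y in Ω, (fderiv ℝ φ y (A y) + g y * φ y) =
      ∫ y in frontier Ω, φ y * ⟪outwardNormal Ω y, A y⟫ ∂μHE[2] := by
  have hAΓ : ContinuousOn A (frontier Ω) := hA.mono frontier_subset_closure
  have hΓm : MeasurableSet (frontier Ω) := isClosed_frontier.measurableSet
  set M := ∫ y in frontier Ω, |φ y| * ‖A y‖ ∂μHE[2] with hM
  have hM0 : 0 ≤ M := integral_nonneg fun y => by positivity
  suffices H : ∀ δ : ℝ, 0 < δ → δ ≤ 1 → |(∫ y in Ω, (fderiv ℝ φ y (A y) + g y * φ y)) -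
      ∫ y in frontier Ω, φ y * ⟪outwardNormal Ω y, A y⟫ ∂μHE[2]| ≤ 4 * δ * M by
    have h0 : Tendsto (fun δ : ℝ => 4 * δ * M) (𝓝[>] 0) (𝓝 0) := by
      have : Continuous fun δ : ℝ => 4 * δ * M := by fun_prop
      simpa using (this.tendsto 0).mono_left nhdsWithin_le_nhds
    have := ge_of_tendsto h0 (by
      filter_upwards [Ioc_mem_nhdsGT one_pos] with δ hδ using H δ hδ.1 hδ.2)
    exact sub_eq_zero.1 (abs_nonpos_iff.1 this)
  intro δ hδ hδ1
  -- Around an interior point the estimate is trivial: a test function supported in `Ω` gives zero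
  -- on both sides.
  have loc : ∀ p : closure Ω, ∃ W : Set R3, IsOpen W ∧ (p : R3) ∈ W ∧ ∀ χ : R3 → ℝ,
      ContDiff ℝ ∞ χ → tsupport χ ⊆ W →
      |(∫ y in Ω, (fderiv ℝ χ y (A y) + g y * χ y)) -
        ∫ y in frontier Ω, χ y * ⟪outwardNormal Ω y, A y⟫ ∂μHE[2]| ≤
        4 * δ * ∫ y in frontier Ω, |χ y| * ‖A y‖ ∂μHE[2] := by
    rintro ⟨p, hp⟩
    by_cases hpΩ : p ∈ Ω
    · refine ⟨Ω, hΩ.isOpen, hpΩ, fun χ hχ hsupp => ?_⟩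
      rw [hw χ hχ (Metric.isCompact_of_isClosed_isBounded (isClosed_tsupport χ)
        (hΩ.isBounded.subset hsupp)) hsupp, setIntegral_eq_zero_of_forall_eq_zero]
      · simp only [sub_zero, abs_zero]
        exact mul_nonneg (by linarith) (integral_nonneg fun y => by positivity)
      · intro y hy
        rw [hΩ.isOpen.frontier_eq] at hy
        rw [image_eq_zero_of_notMem_tsupport fun h => hy.2 (hsupp h), zero_mul]
    · have hpf : p ∈ frontier Ω := by rw [hΩ.isOpen.frontier_eq]; exact ⟨hp, hpΩ⟩
      obtain ⟨ν, T, π, h, V, W, C, hpW⟩ := hΩ.exists_isGraphChart hpf hδ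
      exact ⟨W, C.isOpen, hpW, fun χ hχ hsupp =>
        C.abs_flux_sub_le hΩ hδ.le hδ1 hA hg hw hχ hsupp⟩
  choose W hWo hpW hW using loc
  obtain ⟨t, ht⟩ := hΩ.isCompact_closure.elim_finite_subcover W hWo
    fun y hy => mem_iUnion.2 ⟨⟨y, hy⟩, hpW ⟨y, hy⟩⟩
  obtain ⟨f, hf⟩ := SmoothPartitionOfUnity.exists_isSubordinate (modelWithCornersSelf ℝ R3)
    (s := closure Ω) isClosed_closure (fun i : t => W i) (fun i => hWo i) (by
      intro y hy
      obtain ⟨i, hi, hyi⟩ := mem_iUnion₂.1 (ht hy)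
      exact mem_iUnion.2 ⟨⟨i, hi⟩, hyi⟩)
  have hfs : ∀ i, ContDiff ℝ ∞ (f i) := fun i => (f i).contMDiff.contDiff
  have hsum : ∀ y ∈ closure Ω, ∑ i, f i y = 1 := fun y hy => by
    rw [← finsum_eq_sum_of_fintype]; exact f.sum_eq_one hy
  have hχs : ∀ i, ContDiff ℝ ∞ fun y => f i y * φ y := fun i => (hfs i).mul hφ
  have est := fun i : t => hW i _ (hχs i) ((tsupport_mul_subset_left).trans (hf i))
  have s1 : ∑ i, ∫ y in Ω, (fderiv ℝ (fun y => f i y * φ y) y (A y) + g y * (f i y * φ y)) =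
      ∫ y in Ω, (fderiv ℝ φ y (A y) + g y * φ y) := by
    rw [← integral_finsetSum _ fun i _ => hΩ.integrableOn_weakDivergence hA hg (hχs i)]
    refine setIntegral_congr_fun hΩ.isOpen.measurableSet fun y hy => ?_
    have e1 : (fun y => ∑ i, f i y * φ y) =ᶠ[𝓝 y] φ := by
      filter_upwards [hΩ.isOpen.mem_nhds hy] with z hz
      rw [← Finset.sum_mul, hsum z (subset_closure hz), one_mul]
    have e2 : ∑ i, fderiv ℝ (fun y => f i y * φ y) y = fderiv ℝ φ y := by
      rw [← e1.fderiv_eq, fderiv_fun_sum fun i _ => (hχs i).differentiable (by simp) y]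
    rw [← e2, Finset.sum_add_distrib, ← Finset.mul_sum, ← Finset.sum_mul,
      hsum y (subset_closure hy), one_mul, _root_.sum_apply]
  have s2 : ∑ i, ∫ y in frontier Ω, f i y * φ y * ⟪outwardNormal Ω y, A y⟫ ∂μHE[2] =
      ∫ y in frontier Ω, φ y * ⟪outwardNormal Ω y, A y⟫ ∂μHE[2] := by
    have hi : ∀ i, IntegrableOn (fun y => f i y * φ y * ⟪outwardNormal Ω y, A y⟫) (frontier Ω)
        μHE[2] := fun i => hΩ.integrableOn_frontier
      ((hχs i).continuous.continuousOn.mul (hΩ.continuousOn_outwardNormal.inner hAΓ))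
    rw [← integral_finsetSum _ fun i _ => hi i]
    refine setIntegral_congr_fun hΓm fun y hy => ?_
    simp only [mul_assoc]
    rw [← Finset.sum_mul, hsum y (frontier_subset_closure hy), one_mul]
  -- The partition functions are nonnegative with sum one, so the local errors add up to `4 * δ * M`
  -- whatever the number of charts, which itself depends on `δ`.
  have s3 : ∑ i, ∫ y in frontier Ω, |f i y * φ y| * ‖A y‖ ∂μHE[2] = M := by
    have hi : ∀ i, IntegrableOn (fun y => |f i y * φ y| * ‖A y‖) (frontier Ω) μHE[2] :=
      fun i => hΩ.integrableOn_frontier ((hχs i).continuous.abs.continuousOn.mul hAΓ.norm)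
    rw [← integral_finsetSum _ fun i _ => hi i]
    refine setIntegral_congr_fun hΓm fun y hy => ?_
    simp only [abs_mul, abs_of_nonneg (f.nonneg _ y), mul_assoc]
    rw [← Finset.sum_mul, hsum y (frontier_subset_closure hy), one_mul]
  rw [← s1, ← s2, ← s3, ← Finset.sum_sub_distrib, Finset.mul_sum]
  exact (Finset.abs_sum_le_sum_abs _ _).trans (Finset.sum_le_sum fun i _ => est i)

/-! ### The regularized Newton kernel. -/

/-- The softened length `√(|z|² + ε²)`. -/
noncomputable def softNorm (ε : ℝ) (z : R3) : ℝ := √(‖z‖ ^ 2 + ε ^ 2)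

/-- The regularized Newton kernel; `ε = 0` is the Newton kernel. -/
noncomputable def softKernel (ε : ℝ) (z : R3) : ℝ := (4 * Real.pi)⁻¹ * (softNorm ε z)⁻¹

/-- The gradient of the regularized Newton kernel. -/
noncomputable def softGrad (ε : ℝ) (z : R3) : R3 := (-(4 * Real.pi)⁻¹ * (softNorm ε z)⁻¹ ^ 3) • z

/-- The Hessian of the regularized Newton kernel. -/
noncomputable def softHess (ε : ℝ) (z : R3) : R3 →L[ℝ] R3 :=
  (-(4 * Real.pi)⁻¹ * (softNorm ε z)⁻¹ ^ 3) • ContinuousLinearMap.id ℝ R3 +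
    ((3 * (4 * Real.pi)⁻¹ * (softNorm ε z)⁻¹ ^ 5) • innerSL ℝ z).smulRight z

/-- Minus the Laplacian of the regularized Newton kernel. -/
noncomputable def softDelta (ε : ℝ) (z : R3) : ℝ :=
  3 * (4 * Real.pi)⁻¹ * ε ^ 2 * (softNorm ε z)⁻¹ ^ 5

theorem softNorm_sq (ε : ℝ) (z : R3) : softNorm ε z ^ 2 = ‖z‖ ^ 2 + ε ^ 2 :=
  Real.sq_sqrt (by positivity)

theorem softNorm_nonneg (ε : ℝ) (z : R3) : 0 ≤ softNorm ε z := Real.sqrt_nonneg _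

theorem softNorm_zero (z : R3) : softNorm 0 z = ‖z‖ := by simp [softNorm]

theorem norm_le_softNorm (ε : ℝ) (z : R3) : ‖z‖ ≤ softNorm ε z :=
  Real.le_sqrt_of_sq_le (by nlinarith [sq_nonneg ε])

theorem le_softNorm (ε : ℝ) (z : R3) : ε ≤ softNorm ε z :=
  Real.le_sqrt_of_sq_le (by nlinarith [sq_nonneg ‖z‖])

theorem softNorm_pos_of_ne {ε : ℝ} {z : R3} (hz : z ≠ 0) : 0 < softNorm ε z :=
  (norm_pos_iff.2 hz).trans_le (norm_le_softNorm ε z)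

theorem softNorm_pos_of_pos {ε : ℝ} (hε : 0 < ε) (z : R3) : 0 < softNorm ε z :=
  hε.trans_le (le_softNorm ε z)

theorem newtonKernel_eq (x y : R3) : newtonKernel x y = softKernel 0 (x - y) := by
  rw [newtonKernel, softKernel, softNorm_zero, one_div, mul_inv]

theorem contDiffAt_softNorm {ε : ℝ} {z : R3} (h : 0 < softNorm ε z) :
    ContDiffAt ℝ ∞ (softNorm ε) z := by
  have h0 : ‖z‖ ^ 2 + ε ^ 2 ≠ 0 := (Real.sqrt_pos.1 h).ne'
  exact ((contDiff_norm_sq ℝ).contDiffAt.add contDiffAt_const).sqrt h0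

theorem contDiffAt_softKernel {ε : ℝ} {z : R3} (h : 0 < softNorm ε z) :
    ContDiffAt ℝ ∞ (softKernel ε) z :=
  contDiffAt_const.mul ((contDiffAt_softNorm h).inv h.ne')

theorem contDiffAt_softGrad {ε : ℝ} {z : R3} (h : 0 < softNorm ε z) :
    ContDiffAt ℝ ∞ (softGrad ε) z :=
  (contDiffAt_const.mul (((contDiffAt_softNorm h).inv h.ne').pow 3)).smul contDiffAt_id

theorem hasFDerivAt_softNorm {ε : ℝ} {z : R3} (h : 0 < softNorm ε z) :
    HasFDerivAt (softNorm ε) ((softNorm ε z)⁻¹ • innerSL ℝ z : R3 →L[ℝ] ℝ) z := by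
  have h0 : ‖z‖ ^ 2 + ε ^ 2 ≠ 0 := (Real.sqrt_pos.1 h).ne'
  have h1 : HasFDerivAt (fun z : R3 => ‖z‖ ^ 2 + ε ^ 2) (2 • innerSL ℝ z : R3 →L[ℝ] ℝ) z :=
    ((hasStrictFDerivAt_norm_sq z).hasFDerivAt).add_const _
  have := h1.sqrt h0
  convert! this using 1
  ext w
  simp [softNorm]
  ring

theorem hasFDerivAt_softNorm_inv {ε : ℝ} {z : R3} (h : 0 < softNorm ε z) :
    HasFDerivAt (fun z => (softNorm ε z)⁻¹)
      (-((softNorm ε z)⁻¹ ^ 3) • innerSL ℝ z : R3 →L[ℝ] ℝ) z := by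
  have := (hasDerivAt_inv h.ne').comp_hasFDerivAt z (hasFDerivAt_softNorm h)
  convert! this using 1
  ext w
  simp
  ring

theorem hasFDerivAt_softKernel {ε : ℝ} {z : R3} (h : 0 < softNorm ε z) :
    HasFDerivAt (softKernel ε) (innerSL ℝ (softGrad ε z)) z := by
  have := (hasFDerivAt_softNorm_inv h).const_mul (4 * Real.pi)⁻¹
  convert! this using 1
  ext w
  simp [softGrad]
  ring

theorem hasFDerivAt_softGrad {ε : ℝ} {z : R3} (h : 0 < softNorm ε z) :
    HasFDerivAt (softGrad ε) (softHess ε z) z := by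
  have h1 := ((hasFDerivAt_softNorm_inv h).pow 3).const_mul (-(4 * Real.pi)⁻¹)
  have := h1.smul (hasFDerivAt_id z)
  convert! this using 1
  ext w i
  simp only [softHess, _root_.add_apply, _root_.smul_apply,
    ContinuousLinearMap.smulRight_apply, PiLp.add_apply, PiLp.smul_apply, smul_eq_mul, id_eq,
    nsmul_eq_mul]
  norm_num
  left
  ring

theorem softHess_symm (ε : ℝ) (z v w : R3) : ⟪softHess ε z v, w⟫ = ⟪v, softHess ε z w⟫ := by
  simp [softHess, inner_add_left, inner_add_right, inner_smul_left, inner_smul_right]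
  rw [real_inner_comm v z]; ring

/-- With `s = softNorm ε z`, the trace is `-3/(4π)` times `s⁻³ - |z|² s⁻⁵`, and `s² = |z|² + ε²`
leaves `ε² s⁻⁵`. At `ε = 0` this is the harmonicity of the Newton kernel away from the origin. -/
theorem softHess_trace {ε : ℝ} {z : R3} (h : 0 < softNorm ε z) :
    ∑ i : Fin 3, softHess ε z (stdVec i) i = -softDelta ε z := by
  have h1 : (softNorm ε z)⁻¹ ^ 3 = (softNorm ε z)⁻¹ ^ 5 * (‖z‖ ^ 2 + ε ^ 2) := by
    rw [← softNorm_sq]; field_simp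
  have h2 : ‖z‖ ^ 2 = z 0 ^ 2 + z 1 ^ 2 + z 2 ^ 2 := by
    simp [EuclideanSpace.norm_sq_eq, Fin.sum_univ_three]
  simp [softHess, softDelta, stdVec, Fin.sum_univ_three, EuclideanSpace.inner_single_right, h1, h2]
  ring

theorem norm_softGrad (ε : ℝ) (z : R3) :
    ‖softGrad ε z‖ = (4 * Real.pi)⁻¹ * (softNorm ε z)⁻¹ ^ 3 * ‖z‖ := by
  have := softNorm_nonneg ε z
  rw [softGrad, norm_smul, Real.norm_eq_abs, abs_mul, abs_neg, abs_of_nonneg (by positivity),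
    abs_of_nonneg (by positivity)]

theorem softKernel_nonneg (ε : ℝ) (z : R3) : 0 ≤ softKernel ε z := by
  have := softNorm_nonneg ε z
  unfold softKernel; positivity

theorem softKernel_le {ε : ℝ} {z : R3} (hz : z ≠ 0) : softKernel ε z ≤ softKernel 0 z := by
  have hz' := norm_pos_iff.2 hz
  have := norm_le_softNorm ε z
  rw [softKernel, softKernel, softNorm_zero]
  gcongr

/-- The bound is uniform in `ε`, so the singular gradient dominates the limit `ε → 0`. -/
theorem norm_softGrad_le {ε : ℝ} {z : R3} (hz : z ≠ 0) : ‖softGrad ε z‖ ≤ ‖softGrad 0 z‖ := by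
  have hz' := norm_pos_iff.2 hz
  have := norm_le_softNorm ε z
  have h0 := softNorm_nonneg ε z
  rw [norm_softGrad, norm_softGrad, softNorm_zero]
  gcongr

theorem norm_softGrad_le_of_pos {ε : ℝ} (hε : 0 < ε) (z : R3) :
    ‖softGrad ε z‖ ≤ (4 * Real.pi)⁻¹ * ε⁻¹ ^ 2 := by
  have h0 := softNorm_pos_of_pos hε z
  have h1 := norm_le_softNorm ε z
  have h2 := le_softNorm ε z
  rw [norm_softGrad, mul_assoc]
  gcongr
  calc (softNorm ε z)⁻¹ ^ 3 * ‖z‖ ≤ (softNorm ε z)⁻¹ ^ 3 * softNorm ε z := by gcongr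
    _ = (softNorm ε z)⁻¹ ^ 2 := by field_simp
    _ ≤ ε⁻¹ ^ 2 := by gcongr

theorem continuous_softNorm_left (z : R3) : Continuous fun ε => softNorm ε z :=
  by unfold softNorm; fun_prop

theorem continuous_softNorm_right (ε : ℝ) : Continuous (softNorm ε) :=
  by unfold softNorm; fun_prop

theorem tendsto_softKernel {z : R3} (hz : z ≠ 0) :
    Tendsto (fun ε => softKernel ε z) (𝓝 0) (𝓝 (softKernel 0 z)) :=
  (((continuous_softNorm_left z).tendsto 0).inv₀ (softNorm_pos_of_ne hz).ne').const_mul _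

theorem tendsto_softGrad {z : R3} (hz : z ≠ 0) :
    Tendsto (fun ε => softGrad ε z) (𝓝 0) (𝓝 (softGrad 0 z)) :=
  ((((continuous_softNorm_left z).tendsto 0).inv₀ (softNorm_pos_of_ne hz).ne').pow 3
    |>.const_mul _).smul_const z

theorem measurable_softKernel (ε : ℝ) : Measurable (softKernel ε) :=
  (continuous_softNorm_right ε).measurable.inv.const_mul _

theorem measurable_softGrad (ε : ℝ) : Measurable (softGrad ε) :=
  (((continuous_softNorm_right ε).measurable.inv.pow_const 3).const_mul _).smul measurable_id

/-- In polar coordinates the weight `t²` turns the singularity `t⁻¹` into `t`; for the gradient,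
`t⁻²` becomes a constant. -/
theorem integrableOn_softKernel (R : ℝ) : IntegrableOn (softKernel 0) (ball (0 : R3) R) := by
  have : softKernel 0 = fun z : R3 => (fun t : ℝ => (4 * Real.pi)⁻¹ * t⁻¹) ‖z‖ := by
    funext z; simp [softKernel, softNorm_zero]
  rw [this, integrableOn_fun_norm_addHaar volume (f := fun t : ℝ => (4 * Real.pi)⁻¹ * t⁻¹)]
  refine IntegrableOn.congr_fun (f := fun t : ℝ => (4 * Real.pi)⁻¹ * t) ?_ ?_ measurableSet_Ioo
  · exact ((continuous_const.mul continuous_id).integrableOn_Icc).mono_set Ioo_subset_Icc_self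
  · intro t ht
    have : t ≠ 0 := ht.1.ne'
    simp; field_simp

theorem integrableOn_softGrad (R : ℝ) : IntegrableOn (softGrad 0) (ball (0 : R3) R) := by
  rw [IntegrableOn, ← integrable_norm_iff (measurable_softGrad 0).aestronglyMeasurable]
  have : (fun z => ‖softGrad 0 z‖) =
      fun z : R3 => (fun t : ℝ => (4 * Real.pi)⁻¹ * t⁻¹ ^ 3 * t) ‖z‖ := by
    funext z; rw [norm_softGrad, softNorm_zero]
  change IntegrableOn _ _ _
  rw [this, integrableOn_fun_norm_addHaar volume (f := fun t : ℝ => (4 * Real.pi)⁻¹ * t⁻¹ ^ 3 * t)]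
  refine IntegrableOn.congr_fun (f := fun t : ℝ => (4 * Real.pi)⁻¹) ?_ ?_ measurableSet_Ioo
  · exact (continuous_const.integrableOn_Icc).mono_set Ioo_subset_Icc_self
  · intro t ht
    have : t ≠ 0 := ht.1.ne'
    simp; field_simp

/-- In polar coordinates the radial integrand is the derivative of `(4π)⁻¹ (t / √(t² + 1))³`, which
rises from `0` to `(4π)⁻¹`; the sphere contributes `4π`. -/
theorem integral_softDelta_one : ∫ z : R3, softDelta 1 z = 1 := by
  have : (fun z : R3 => softDelta 1 z) =
      fun z : R3 => (fun t : ℝ => 3 * (4 * Real.pi)⁻¹ * (√(t ^ 2 + 1))⁻¹ ^ 5) ‖z‖ := by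
    funext z; simp [softDelta, softNorm]
  rw [this, integral_fun_norm_addHaar volume
    (fun t : ℝ => 3 * (4 * Real.pi)⁻¹ * (√(t ^ 2 + 1))⁻¹ ^ 5)]
  have hb : (volume : Measure R3).real (ball 0 1) = 4 / 3 * Real.pi := by
    rw [measureReal_def, EuclideanSpace.volume_ball_fin_three]
    rw [ENNReal.ofReal_one, one_pow, one_mul, ENNReal.toReal_ofReal (by positivity)]
    ring
  have hI : ∫ t in Ioi (0 : ℝ), t ^ 2 * (3 * (4 * Real.pi)⁻¹ * (√(t ^ 2 + 1))⁻¹ ^ 5) =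
      (4 * Real.pi)⁻¹ := by
    have hd : ∀ t ∈ Ici (0 : ℝ), HasDerivAt
        (fun t : ℝ => (4 * Real.pi)⁻¹ * (t * (√(t ^ 2 + 1))⁻¹) ^ 3)
        (t ^ 2 * (3 * (4 * Real.pi)⁻¹ * (√(t ^ 2 + 1))⁻¹ ^ 5)) t := by
      intro t _
      have hp : (0 : ℝ) < t ^ 2 + 1 := by positivity
      have hs : √(t ^ 2 + 1) ≠ 0 := (Real.sqrt_pos.2 hp).ne'
      have hsq : √(t ^ 2 + 1) ^ 2 = t ^ 2 + 1 := Real.sq_sqrt hp.le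
      have h1 : HasDerivAt (fun t : ℝ => t ^ 2 + 1) (2 * t) t := by
        simpa using (hasDerivAt_pow 2 t).add_const 1
      have h2 : HasDerivAt (fun t : ℝ => t * (√(t ^ 2 + 1))⁻¹) ((√(t ^ 2 + 1))⁻¹ ^ 3) t := by
        refine ((hasDerivAt_id t).mul ((h1.sqrt hp.ne').inv hs)).congr_deriv ?_
        simp only [id, Pi.inv_apply]
        generalize √(t ^ 2 + 1) = s at *
        field_simp
        linarith
      refine ((h2.pow 3).const_mul (4 * Real.pi)⁻¹).congr_deriv ?_
      push_cast
      ring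
    have hlim : Tendsto (fun t : ℝ => (4 * Real.pi)⁻¹ * (t * (√(t ^ 2 + 1))⁻¹) ^ 3) atTop
        (𝓝 (4 * Real.pi)⁻¹) := by
      have h1 : Tendsto (fun t : ℝ => (√(1 + t⁻¹ ^ 2))⁻¹) atTop (𝓝 1) := by
        have : Tendsto (fun t : ℝ => 1 + t⁻¹ ^ 2) atTop (𝓝 (1 + 0 ^ 2)) :=
          (tendsto_inv_atTop_zero.pow 2).const_add 1
        have := (this.sqrt).inv₀ (by simp)
        simpa using this
      have h2 := (h1.pow 3).const_mul (4 * Real.pi)⁻¹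
      rw [one_pow, mul_one] at h2
      refine h2.congr' ?_
      filter_upwards [eventually_gt_atTop 0] with t ht
      congr 2
      have : t ^ 2 + 1 = t ^ 2 * (1 + t⁻¹ ^ 2) := by field_simp
      rw [this, Real.sqrt_mul (by positivity), Real.sqrt_sq ht.le]
      field_simp
    rw [integral_Ioi_of_hasDerivAt_of_nonneg' hd (fun t _ => by positivity) hlim]
    simp
  have h3 : Module.finrank ℝ R3 = 3 := by simp
  simp only [h3, smul_eq_mul, nsmul_eq_mul]
  rw [hb]
  change (3 : ℕ) * (4 / 3 * Real.pi * ∫ t in Ioi (0 : ℝ),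
    t ^ 2 * (3 * (4 * Real.pi)⁻¹ * (√(t ^ 2 + 1))⁻¹ ^ 5)) = 1
  rw [hI]
  push_cast
  field_simp

/-! ### Differentiating potentials away from the singularity. -/

section KernelIntegral

variable {E E' F : Type*} [NormedAddCommGroup E] [NormedSpace ℝ E] [NormedAddCommGroup E']
  [NormedSpace ℝ E'] [NormedAddCommGroup F] [NormedSpace ℝ F]

theorem norm_precompR_apply_le (L : E →L[ℝ] E' →L[ℝ] F) (u : E) (g : R3 →L[ℝ] E') :
    ‖L.precompR R3 u g‖ ≤ ‖L‖ * ‖u‖ * ‖g‖ := by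
  have : L.precompR R3 u g = (L u).comp g := by ext; simp
  rw [this]
  exact (ContinuousLinearMap.opNorm_comp_le (L u) g).trans (by gcongr; exact L.le_opNorm u)

/-- Differentiation under the integral for convolution-type integrals with a bounded kernel. -/
theorem hasFDerivAt_kernel_integral (L : E →L[ℝ] E' →L[ℝ] F) {μ : Measure R3} {σ : R3 → E}
    (hσ : Integrable σ μ) {k : R3 → E'} (hk : ContDiff ℝ 1 k) {C₀ C : ℝ} (hC₀ : ∀ z, ‖k z‖ ≤ C₀)
    (hC : ∀ z, ‖fderiv ℝ k z‖ ≤ C) (x : R3) :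
    HasFDerivAt (fun x => ∫ y, L (σ y) (k (x - y)) ∂μ)
      (∫ y, L.precompR R3 (σ y) (fderiv ℝ k (x - y)) ∂μ) x := by
  have hkm : ∀ x, AEStronglyMeasurable (fun y => k (x - y)) μ := fun x =>
    (hk.continuous.comp (by fun_prop)).aestronglyMeasurable
  refine hasFDerivAt_integral_of_dominated_of_fderiv_le (𝕜 := ℝ)
    (F := fun x y => L (σ y) (k (x - y)))
    (F' := fun x y => L.precompR R3 (σ y) (fderiv ℝ k (x - y))) (s := univ) univ_mem
    (bound := fun y => ‖L‖ * ‖σ y‖ * C)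
    (Eventually.of_forall fun x => L.aestronglyMeasurable_comp₂ hσ.aestronglyMeasurable (hkm x))
    ?_ ?_ ?_ ?_ ?_
  · refine (hσ.norm.const_mul ‖L‖ |>.mul_const C₀).mono'
      (L.aestronglyMeasurable_comp₂ hσ.aestronglyMeasurable (hkm x)) (ae_of_all _ fun y => ?_)
    exact (L.le_opNorm₂ _ _).trans (by gcongr; exact hC₀ _)
  · exact (L.precompR R3).aestronglyMeasurable_comp₂ hσ.aestronglyMeasurable
      ((hk.continuous_fderiv (by simp)).comp (by fun_prop)).aestronglyMeasurable
  · exact ae_of_all _ fun y x _ => (norm_precompR_apply_le L _ _).trans (by gcongr; exact hC _)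
  · exact (hσ.norm.const_mul _).mul_const _
  · refine ae_of_all _ fun y x _ => ?_
    have h1 : HasFDerivAt (fun x => k (x - y)) (fderiv ℝ k (x - y)) x := by
      have := (hk.differentiable (by simp) (x - y)).hasFDerivAt.comp x
        ((hasFDerivAt_id x).sub_const y)
      simpa [Function.comp_def] using this
    exact (L (σ y)).hasFDerivAt.comp x h1

/-- Multiplying by this cutoff removes the singularity and the tail of a kernel without changing it
on an annulus. -/
theorem exists_annulus_cutoff {r R : ℝ} (hr : 0 < r) (hR : 0 < R) : ∃ χ : R3 → ℝ,
    ContDiff ℝ ∞ χ ∧ HasCompactSupport χ ∧ (∀ z, ‖z‖ < r / 2 → χ z = 0) ∧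
      ∀ z, r ≤ ‖z‖ → ‖z‖ ≤ R → χ z = 1 := by
  let χ₁ : ContDiffBump (0 : R3) := ⟨R, R + 1, hR, by linarith⟩
  let χ₂ : ContDiffBump (0 : R3) := ⟨r / 2, r, by linarith, by linarith⟩
  refine ⟨fun z => χ₁ z * (1 - χ₂ z), χ₁.contDiff.mul (contDiff_const.sub χ₂.contDiff),
    χ₁.hasCompactSupport.mul_right, fun z hz => ?_, fun z h1 h2 => ?_⟩
  · simp only
    rw [χ₂.one_of_mem_closedBall (by simpa using hz.le)]; simp
  · simp only
    rw [χ₁.one_of_mem_closedBall (by simpa using h2), χ₂.zero_of_le_dist (by simpa using h1)]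
    simp

/-- For `x` near `x₀`, the vectors `x - y` with `y ∈ Γ` stay in an annulus around the origin. The
kernel may thus be replaced by a smooth compactly supported one, for which the integral is a smooth
convolution. -/
theorem contDiffAt_and_hasFDerivAt_layer (L : E →L[ℝ] E' →L[ℝ] F) {μ : Measure R3} {Γ : Set R3}
    (hΓ : IsCompact Γ) {σ : R3 → E} (hσ : IntegrableOn σ Γ μ) {k : R3 → E'}
    (hk : ∀ z ≠ 0, ContDiffAt ℝ ∞ k z) {x₀ : R3} (hx₀ : x₀ ∉ Γ) :
    ContDiffAt ℝ ∞ (fun x => ∫ y in Γ, L (σ y) (k (x - y)) ∂μ) x₀ ∧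
    HasFDerivAt (fun x => ∫ y in Γ, L (σ y) (k (x - y)) ∂μ)
      (∫ y in Γ, L.precompR R3 (σ y) (fderiv ℝ k (x₀ - y)) ∂μ) x₀ := by
  -- The margins `2 * r` here and `R - r` below leave room for `x` to move by `r` within the annulus
  -- from `r` to `R`.
  obtain ⟨r, hr, hrΓ⟩ : ∃ r > 0, ∀ y ∈ Γ, 2 * r ≤ ‖x₀ - y‖ := by
    obtain ⟨ε, hε, hb⟩ := Metric.isOpen_iff.1 hΓ.isClosed.isOpen_compl x₀ hx₀
    refine ⟨ε / 2, by positivity, fun y hy => ?_⟩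
    by_contra hlt
    refine hb (mem_ball.2 ?_) hy
    rw [dist_comm, dist_eq_norm]; linarith
  obtain ⟨R, hR, hRΓ⟩ : ∃ R > r, ∀ y ∈ Γ, ‖x₀ - y‖ ≤ R - r := by
    obtain ⟨M, hM⟩ := hΓ.exists_bound_of_continuousOn (f := fun y => x₀ - y) (by fun_prop)
    exact ⟨|M| + 2 * r, by have := abs_nonneg M; linarith,
      fun y hy => (hM y hy).trans (by have := le_abs_self M; linarith)⟩
  obtain ⟨χ, hχ, hχc, hχ0, hχ1⟩ := exists_annulus_cutoff hr (hr.trans hR)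
  set k' : R3 → E' := fun z => χ z • k z with hk'
  have hk's : ContDiff ℝ ∞ k' := by
    rw [contDiff_iff_contDiffAt]
    intro z
    by_cases hz : z = 0
    · refine contDiffAt_const (c := (0 : E')).congr_of_eventuallyEq ?_
      subst hz
      filter_upwards [ball_mem_nhds (0 : R3) (show 0 < r / 2 by linarith)] with w hw
      simp [hk', hχ0 w (by simpa using hw)]
    · exact hχ.contDiffAt.smul (hk z hz)
  have hk'c : HasCompactSupport k' := hχc.smul_right
  have hk'1 : ContDiff ℝ 1 k' := hk's.of_le (by simp)
  have heq : (fun x => ∫ y in Γ, L (σ y) (k (x - y)) ∂μ) =ᶠ[𝓝 x₀]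
      fun x => ∫ y in Γ, L (σ y) (k' (x - y)) ∂μ := by
    filter_upwards [ball_mem_nhds x₀ hr] with x hx
    refine setIntegral_congr_fun hΓ.measurableSet fun y hy => ?_
    rw [mem_ball, dist_eq_norm] at hx
    have h1 : ‖x₀ - y‖ ≤ ‖x - y‖ + ‖x - x₀‖ := by
      have : x₀ - y = (x - y) - (x - x₀) := by abel
      rw [this]; exact norm_sub_le _ _
    have h2 : ‖x - y‖ ≤ ‖x₀ - y‖ + ‖x - x₀‖ := by
      have : x - y = (x₀ - y) + (x - x₀) := by abel
      rw [this]; exact norm_add_le _ _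
    have := hrΓ y hy
    have := hRΓ y hy
    simp only [hk']
    rw [hχ1 _ (by linarith) (by linarith), one_smul]
  constructor
  · have := hk'c.contDiff_convolution_right (n := (⊤ : ℕ∞)) L (μ := μ.restrict Γ) (f := σ)
      hσ.locallyIntegrable hk's
    exact (this.contDiffAt (x := x₀)).congr_of_eventuallyEq heq
  · obtain ⟨C₀, hC₀⟩ := hk's.continuous.bounded_above_of_compact_support hk'c
    obtain ⟨C, hC⟩ := (hk's.continuous_fderiv (by simp)).bounded_above_of_compact_support
      (hk'c.fderiv ℝ)
    have := (hasFDerivAt_kernel_integral L hσ hk'1 hC₀ hC x₀).congr_of_eventuallyEq heq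
    convert! this using 1
    refine setIntegral_congr_fun hΓ.measurableSet fun y hy => ?_
    have hyk : k' =ᶠ[𝓝 (x₀ - y)] k := by
      have h1 := hrΓ y hy
      have h2 := hRΓ y hy
      have hn : Continuous fun z : R3 => ‖z‖ := continuous_norm
      filter_upwards [(isOpen_lt continuous_const hn).mem_nhds (show r < ‖x₀ - y‖ by linarith),
        (isOpen_lt hn continuous_const).mem_nhds (show ‖x₀ - y‖ < R by linarith)] with z hz1 hz2
      change χ z • k z = k z
      rw [hχ1 z (le_of_lt hz1) (le_of_lt hz2), one_smul]
    rw [hyk.fderiv_eq]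

end KernelIntegral

/-- Scalar kernel times density. -/
noncomputable abbrev densityL (F : Type*) [NormedAddCommGroup F] [NormedSpace ℝ F] :
    F →L[ℝ] ℝ →L[ℝ] F := (ContinuousLinearMap.lsmul ℝ ℝ).flip

section SingleLayer

variable {F : Type*} [NormedAddCommGroup F] [NormedSpace ℝ F]

theorem singleLayer_eq (Γ : Set R3) (σ : R3 → F) (x : R3) :
    singleLayer Γ σ x = ∫ y in Γ, densityL F (σ y) (softKernel 0 (x - y)) ∂μHE[2] := by
  simp [singleLayer, newtonKernel_eq, densityL]

variable {Γ : Set R3} {σ : R3 → F}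

theorem contDiffAt_singleLayer (hΓ : IsCompact Γ) (hσ : IntegrableOn σ Γ μHE[2]) {x : R3}
    (hx : x ∉ Γ) : ContDiffAt ℝ ∞ (singleLayer Γ σ) x := by
  have := (contDiffAt_and_hasFDerivAt_layer (densityL F) hΓ hσ
    (fun z hz => contDiffAt_softKernel (ε := 0) (softNorm_pos_of_ne hz)) hx).1
  exact this.congr_of_eventuallyEq (Eventually.of_forall fun x => singleLayer_eq Γ σ x)

theorem hasFDerivAt_singleLayer (hΓ : IsCompact Γ) (hσ : IntegrableOn σ Γ μHE[2]) {x : R3}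
    (hx : x ∉ Γ) : HasFDerivAt (singleLayer Γ σ) (∫ y in Γ, (densityL F).precompR R3 (σ y)
      (fderiv ℝ (softKernel 0) (x - y)) ∂μHE[2]) x := by
  have := (contDiffAt_and_hasFDerivAt_layer (densityL F) hΓ hσ
    (fun z hz => contDiffAt_softKernel (ε := 0) (softNorm_pos_of_ne hz)) hx).2
  exact this.congr_of_eventuallyEq (Eventually.of_forall fun x => singleLayer_eq Γ σ x)

theorem hasFDerivAt_fderiv_singleLayer (hΓ : IsCompact Γ) (hσ : IntegrableOn σ Γ μHE[2]) {x : R3}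
    (hx : x ∉ Γ) : HasFDerivAt (fderiv ℝ (singleLayer Γ σ))
      (∫ y in Γ, ((densityL F).precompR R3).precompR R3 (σ y)
      (fderiv ℝ (fderiv ℝ (softKernel 0)) (x - y)) ∂μHE[2]) x := by
  have := (contDiffAt_and_hasFDerivAt_layer ((densityL F).precompR R3) hΓ hσ
    (k := fderiv ℝ (softKernel 0)) (fun z hz =>
      (contDiffAt_softKernel (ε := 0) (softNorm_pos_of_ne hz)).fderiv_right (by simp)) hx).2
  refine this.congr_of_eventuallyEq ?_
  filter_upwards [hΓ.isClosed.isOpen_compl.mem_nhds hx] with z hz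
    using (hasFDerivAt_singleLayer hΓ hσ hz).fderiv

theorem fderiv_softKernel {ε : ℝ} {z : R3} (h : 0 < softNorm ε z) :
    fderiv ℝ (softKernel ε) z = innerSL ℝ (softGrad ε z) := (hasFDerivAt_softKernel h).fderiv

theorem fderiv_fderiv_softKernel {z : R3} (hz : z ≠ 0) (v w : R3) :
    fderiv ℝ (fderiv ℝ (softKernel 0)) z v w = ⟪softHess 0 z v, w⟫ := by
  have h1 : fderiv ℝ (softKernel 0) =ᶠ[𝓝 z] fun z => innerSL ℝ (softGrad 0 z) := by
    filter_upwards [isOpen_ne.mem_nhds hz] with y hy using fderiv_softKernel (softNorm_pos_of_ne hy)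
  have h2 : HasFDerivAt (fun z => innerSL ℝ (softGrad 0 z))
      (((innerSL ℝ : R3 →L[ℝ] R3 →L[ℝ] ℝ)).comp (softHess 0 z)) z :=
    ((innerSL ℝ : R3 →L[ℝ] R3 →L[ℝ] ℝ)).hasFDerivAt.comp z
      (hasFDerivAt_softGrad (softNorm_pos_of_ne hz))
  rw [h1.fderiv_eq, h2.fderiv]
  simp

theorem sub_ne_zero_of_notMem {x y : R3} (hx : x ∉ Γ) (hy : y ∈ Γ) : x - y ≠ 0 := by
  rintro h; rw [sub_eq_zero] at h; exact hx (h ▸ hy)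

/-- Integrals of continuous functions of `x - y` against the density. -/
theorem integrableOn_smul_density {F' F'' : Type*} [NormedAddCommGroup F'] [NormedSpace ℝ F']
    [NormedAddCommGroup F''] [NormedSpace ℝ F''] (L : F →L[ℝ] F' →L[ℝ] F'')
    (hΓ : IsCompact Γ) (hσ : IntegrableOn σ Γ μHE[2])
    {k : R3 → F'} (hk : ContinuousOn k Γ) : IntegrableOn (fun y => L (σ y) (k y)) Γ μHE[2] := by
  obtain ⟨M, hM⟩ := hΓ.exists_bound_of_continuousOn hk
  have hkm : AEStronglyMeasurable k (Measure.restrict μHE[2] Γ) :=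
    hk.aestronglyMeasurable_of_isCompact hΓ hΓ.measurableSet
  refine (hσ.norm.const_mul ‖L‖ |>.mul_const M).mono'
    (L.aestronglyMeasurable_comp₂ hσ.aestronglyMeasurable hkm) ?_
  refine (ae_restrict_iff' hΓ.measurableSet).2 (ae_of_all _ fun y hy => ?_)
  exact (L.le_opNorm₂ _ _).trans (by gcongr; exact hM y hy)

end SingleLayer

/-! ### Differentiability of the volume potential. -/

section VolumePotential

variable {Ω : Set R3} {R : ℝ}

theorem integrableOn_comp_sub_left (hm : MeasurableSet Ω) (hR : Ω ⊆ ball 0 R) {x : R3}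
    (hx : x ∈ ball 0 R) {F : Type*} [NormedAddCommGroup F] {k : R3 → F}
    (hk : IntegrableOn k (ball 0 (2 * R))) : IntegrableOn (fun y => k (x - y)) Ω := by
  have h1 : Integrable fun y => (ball (0 : R3) (2 * R)).indicator k (x - y) :=
    ((integrable_indicator_iff measurableSet_ball).2 hk).comp_sub_left x
  refine (h1.integrableOn (s := Ω)).congr_fun (fun y hy => ?_) hm
  refine indicator_of_mem (mem_ball_zero_iff.2 ?_) k
  have h2 := mem_ball_zero_iff.1 (hR hy)
  have h3 := mem_ball_zero_iff.1 hx
  linarith [norm_sub_le x y]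

/-- The set `x - Ω` lies in the ball of radius `2 * R`. The bound does not depend on `x`, which
turns `L¹` convergence of kernels into uniform convergence of potentials. -/
theorem setIntegral_comp_sub_left_le (hm : MeasurableSet Ω) (hR : Ω ⊆ ball 0 R) {x : R3}
    (hx : x ∈ ball 0 R) {k : R3 → ℝ} (hk0 : ∀ z, 0 ≤ k z)
    (hk : IntegrableOn k (ball 0 (2 * R))) :
    ∫ y in Ω, k (x - y) ≤ ∫ z in ball 0 (2 * R), k z := by
  have h1 : Integrable fun y => (ball (0 : R3) (2 * R)).indicator k (x - y) :=
    ((integrable_indicator_iff measurableSet_ball).2 hk).comp_sub_left x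
  have h2 : ∫ y in Ω, k (x - y) = ∫ y in Ω, (ball (0 : R3) (2 * R)).indicator k (x - y) := by
    refine setIntegral_congr_fun hm fun y hy => (indicator_of_mem (mem_ball_zero_iff.2 ?_) k).symm
    have h2 := mem_ball_zero_iff.1 (hR hy)
    have h3 := mem_ball_zero_iff.1 hx
    linarith [norm_sub_le x y]
  rw [h2, ← integral_indicator measurableSet_ball,
    ← integral_sub_left_eq_self ((ball (0 : R3) (2 * R)).indicator k) volume x]
  exact setIntegral_le_integral h1 (ae_of_all _ fun y => indicator_nonneg (fun z _ => hk0 z) _)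

theorem ae_ne_zero : ∀ᵐ z : R3, z ≠ 0 := by
  rw [ae_iff]; simp

theorem integrableOn_softGrad_sub (ε : ℝ) :
    IntegrableOn (fun z => ‖softGrad ε z - softGrad 0 z‖) (ball (0 : R3) R) := by
  refine ((integrableOn_softGrad R).norm.const_mul 2).mono'
    ((measurable_softGrad ε).sub (measurable_softGrad 0)).norm.aestronglyMeasurable
    (ae_restrict_of_ae ?_)
  filter_upwards [ae_ne_zero] with z hz
  rw [norm_norm]
  exact (norm_sub_le _ _).trans (by linarith [norm_softGrad_le (ε := ε) hz])

theorem tendsto_integral_softGrad_sub :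
    Tendsto (fun ε => ∫ z in ball (0 : R3) R, ‖softGrad ε z - softGrad 0 z‖) (𝓝[>] 0) (𝓝 0) := by
  suffices key : Tendsto (fun ε => ∫ z in ball (0 : R3) R, ‖softGrad ε z - softGrad 0 z‖) (𝓝[>] 0)
      (𝓝 (∫ z in ball (0 : R3) R, ‖softGrad 0 z - softGrad 0 z‖)) by
    simpa using key
  refine tendsto_integral_filter_of_dominated_convergence (fun z => 2 * ‖softGrad 0 z‖)
    (Eventually.of_forall fun ε =>
      ((measurable_softGrad ε).sub (measurable_softGrad 0)).norm.aestronglyMeasurable)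
    (Eventually.of_forall fun ε => ?_) ((integrableOn_softGrad R).norm.const_mul 2)
    (ae_restrict_of_ae ?_)
  · refine ae_restrict_of_ae ?_
    filter_upwards [ae_ne_zero] with z hz
    rw [norm_norm]
    exact (norm_sub_le _ _).trans (by linarith [norm_softGrad_le (ε := ε) hz])
  · filter_upwards [ae_ne_zero] with z hz
    exact (((tendsto_softGrad hz).mono_left nhdsWithin_le_nhds).sub_const _).norm

variable {J : R3 → R3} {M : ℝ}

theorem integrableOn_newtonKernel_smul (hm : MeasurableSet Ω) (hR : Ω ⊆ ball 0 R)
    (hJm : AEStronglyMeasurable J (volume.restrict Ω)) (hJ : ∀ y ∈ Ω, ‖J y‖ ≤ M) {x : R3}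
    (hx : x ∈ ball 0 R) : IntegrableOn (fun y => newtonKernel x y • J y) Ω := by
  simp only [newtonKernel_eq]
  exact (integrableOn_comp_sub_left hm hR hx (integrableOn_softKernel _)).smul_bdd M hJm
    ((ae_restrict_iff' hm).2 (ae_of_all _ hJ))

theorem integrable_density_softGrad (hm : MeasurableSet Ω) (hR : Ω ⊆ ball 0 R)
    (hJm : AEStronglyMeasurable J (volume.restrict Ω)) (hJ : ∀ y ∈ Ω, ‖J y‖ ≤ M) {x : R3}
    (hx : x ∈ ball 0 R) (ε : ℝ) : IntegrableOn (fun y => (densityL R3).precompR R3 (J y)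
      (innerSL ℝ (softGrad ε (x - y)))) Ω := by
  have h1 : IntegrableOn (softGrad ε) (ball 0 (2 * R)) := by
    refine (integrableOn_softGrad _).norm.mono' (measurable_softGrad ε).aestronglyMeasurable
      (ae_restrict_of_ae ?_)
    filter_upwards [ae_ne_zero] with z hz using norm_softGrad_le hz
  have h2 := integrableOn_comp_sub_left hm hR hx h1
  have hm2 : AEStronglyMeasurable (fun y => (innerSL ℝ (softGrad ε (x - y)) : R3 →L[ℝ] ℝ))
      (volume.restrict Ω) :=
    (innerSL ℝ : R3 →L[ℝ] R3 →L[ℝ] ℝ).continuous.comp_aestronglyMeasurable h2.aestronglyMeasurable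
  refine (h2.norm.const_mul (‖densityL R3‖ * M)).mono'
    (((densityL R3).precompR R3).aestronglyMeasurable_comp₂ hJm hm2) ?_
  refine (ae_restrict_iff' hm).2 (ae_of_all _ fun y hy => ?_)
  refine (norm_precompR_apply_le _ _ _).trans ?_
  rw [innerSL_apply_norm]
  gcongr
  exact hJ y hy

/-- The regularized potentials are differentiable under the integral sign. Their derivatives
converge uniformly on the ball, with error bounded by a constant times the `L¹` norm of `softGrad ε
- softGrad 0`, and their values converge pointwise; hence the limit is differentiable with the limit
derivative. -/
theorem hasFDerivAt_volumePotential (hm : MeasurableSet Ω) (hR : Ω ⊆ ball 0 R)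
    (hJm : AEStronglyMeasurable J (volume.restrict Ω)) (hM : 0 ≤ M) (hJ : ∀ y ∈ Ω, ‖J y‖ ≤ M)
    {x : R3} (hx : x ∈ ball 0 R) :
    HasFDerivAt (volumePotential Ω J) (∫ y in Ω, (densityL R3).precompR R3 (J y)
      (innerSL ℝ (softGrad 0 (x - y)))) x ∧
    Tendsto (fun ε => ∫ y in Ω, (densityL R3).precompR R3 (J y)
      (innerSL ℝ (softGrad ε (x - y)))) (𝓝[>] 0) (𝓝 (∫ y in Ω, (densityL R3).precompR R3 (J y)
      (innerSL ℝ (softGrad 0 (x - y))))) := by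
  have hfin : volume Ω ≠ ⊤ := (isBounded_ball.subset hR).measure_lt_top.ne
  have hJi : IntegrableOn J Ω := by
    have : IsFiniteMeasure (volume.restrict Ω) := ⟨by simpa using hfin.lt_top⟩
    exact Integrable.of_bound hJm M ((ae_restrict_iff' hm).2 (ae_of_all _ hJ))
  have hu : TendstoUniformlyOn (fun ε x => ∫ y in Ω, (densityL R3).precompR R3 (J y)
      (innerSL ℝ (softGrad ε (x - y)))) (fun x => ∫ y in Ω, (densityL R3).precompR R3 (J y)
      (innerSL ℝ (softGrad 0 (x - y)))) (𝓝[>] 0) (ball 0 R) := by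
    rw [Metric.tendstoUniformlyOn_iff]
    intro η hη
    have h1 := (tendsto_integral_softGrad_sub (R := 2 * R)).const_mul (‖densityL R3‖ * M)
    rw [mul_zero] at h1
    filter_upwards [h1.eventually_lt_const hη] with ε hε x hx
    rw [dist_comm, dist_eq_norm, ← integral_sub (integrable_density_softGrad hm hR hJm hJ hx ε)
      (integrable_density_softGrad hm hR hJm hJ hx 0)]
    refine lt_of_le_of_lt ?_ hε
    have h2 := integrableOn_comp_sub_left hm hR hx (integrableOn_softGrad_sub (R := 2 * R) ε)
    refine (norm_integral_le_of_norm_le (h2.const_mul (‖densityL R3‖ * M)) ?_).trans ?_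
    · refine (ae_restrict_iff' hm).2 (ae_of_all _ fun y hy => ?_)
      rw [← map_sub, ← map_sub]
      refine (norm_precompR_apply_le _ _ _).trans ?_
      rw [innerSL_apply_norm]
      gcongr
      exact hJ y hy
    · rw [integral_const_mul]
      gcongr
      exact setIntegral_comp_sub_left_le hm hR hx (k := fun z => ‖softGrad ε z - softGrad 0 z‖)
        (fun z => norm_nonneg _) (integrableOn_softGrad_sub ε)
  -- Along the sequence `1 / (n + 1)` every parameter is positive, so every approximant is
  -- differentiable.
  have hseq : Tendsto (fun n : ℕ => 1 / ((n : ℝ) + 1)) atTop (𝓝[>] 0) :=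
    tendsto_nhdsWithin_iff.2 ⟨tendsto_one_div_add_atTop_nhds_zero_nat,
      Eventually.of_forall fun n => mem_Ioi.2 Nat.one_div_pos_of_nat⟩
  refine ⟨hasFDerivAt_of_tendstoUniformlyOn (l := atTop) (s := ball 0 R) isOpen_ball
    (f' := fun (n : ℕ) x => ∫ y in Ω, (densityL R3).precompR R3 (J y)
      (innerSL ℝ (softGrad (1 / ((n : ℝ) + 1)) (x - y))))
    (f := fun (n : ℕ) x => ∫ y in Ω, densityL R3 (J y) (softKernel (1 / ((n : ℝ) + 1)) (x - y)))
    (fun u hu' => hseq.eventually (hu u hu')) ?_ ?_ hx, hu.tendsto_at hx⟩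
  · intro n x _
    have hε : (0 : ℝ) < 1 / ((n : ℝ) + 1) := Nat.one_div_pos_of_nat
    generalize 1 / ((n : ℝ) + 1) = ε at hε
    have hs : ContDiff ℝ 1 (softKernel ε) := contDiff_iff_contDiffAt.2 fun z =>
      (contDiffAt_softKernel (softNorm_pos_of_pos hε z)).of_le (by simp)
    have := hasFDerivAt_kernel_integral (densityL R3) hJi hs
      (C₀ := (4 * Real.pi)⁻¹ * ε⁻¹) (C := (4 * Real.pi)⁻¹ * ε⁻¹ ^ 2) (fun z => ?_) (fun z => ?_) x
    · simpa only [fderiv_softKernel (softNorm_pos_of_pos hε _)] using this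
    · rw [Real.norm_of_nonneg (softKernel_nonneg _ _), softKernel]
      have := le_softNorm ε z
      gcongr
    · rw [fderiv_softKernel (softNorm_pos_of_pos hε z), innerSL_apply_norm]
      exact norm_softGrad_le_of_pos hε z
  · intro x hx
    have hk := integrableOn_comp_sub_left hm hR hx (integrableOn_softKernel (2 * R))
    have hae : ∀ᵐ y ∂(volume.restrict Ω), x - y ≠ 0 := by
      refine ae_restrict_of_ae (ae_iff.2 ?_)
      have : {y : R3 | ¬ x - y ≠ 0} = {x} := by ext y; simp [sub_eq_zero, eq_comm]
      rw [this]; simp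
    refine Tendsto.comp (y := 𝓝[>] (0 : ℝ)) (g := fun ε => ∫ y in Ω, densityL R3 (J y)
      (softKernel ε (x - y))) ?_ hseq
    have e : volumePotential Ω J x = ∫ y in Ω, densityL R3 (J y) (softKernel 0 (x - y)) := by
      simp [volumePotential, newtonKernel_eq]
    rw [e]
    refine tendsto_integral_filter_of_dominated_convergence
      (fun y => ‖densityL R3‖ * M * softKernel 0 (x - y)) (Eventually.of_forall fun ε => ?_)
      (Eventually.of_forall fun ε => ?_) (hk.const_mul _) ?_
    · exact (densityL R3).aestronglyMeasurable_comp₂ hJm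
        ((measurable_softKernel ε).comp (by fun_prop)).aestronglyMeasurable
    · filter_upwards [hae, (ae_restrict_iff' hm).2 (ae_of_all _ hJ)] with y hy hJy
      refine ((densityL R3).le_opNorm₂ _ _).trans ?_
      rw [Real.norm_of_nonneg (softKernel_nonneg _ _)]
      gcongr
      · exact softKernel_nonneg _ _
      · exact softKernel_le hy
    · filter_upwards [hae] with y hy
      exact ((densityL R3 (J y)).continuous.tendsto _).comp
        ((tendsto_softKernel hy).mono_left nhdsWithin_le_nhds)

end VolumePotential

/-! ### The approximate identity. -/

theorem softNorm_one_smul {c : ℝ} (hc : 0 < c) (z : R3) :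
    softNorm 1 (c • z) = c * softNorm c⁻¹ z := by
  have : ‖c • z‖ ^ 2 + 1 ^ 2 = c ^ 2 * (‖z‖ ^ 2 + c⁻¹ ^ 2) := by
    rw [norm_smul, Real.norm_eq_abs, mul_pow, sq_abs]; field_simp
  rw [softNorm, this, Real.sqrt_mul (by positivity), Real.sqrt_sq hc.le, softNorm]

theorem softDelta_one_smul {c : ℝ} (hc : 0 < c) (z : R3) :
    c ^ 3 * softDelta 1 (c • z) = softDelta c⁻¹ z := by
  rw [softDelta, softDelta, softNorm_one_smul hc, mul_inv c, mul_pow c⁻¹]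
  field_simp

theorem softDelta_nonneg (ε : ℝ) (z : R3) : 0 ≤ softDelta ε z := by
  have := softNorm_nonneg ε z
  unfold softDelta; positivity

/-- Minus the Laplacian of the regularized kernel is an approximate identity. -/
theorem tendsto_integral_softDelta {Ω : Set R3} (hΩ : IsOpen Ω) {B : R3 → R3}
    (hB : IntegrableOn B Ω) {x : R3} (hx : x ∈ Ω) (hBx : ContinuousAt B x) :
    Tendsto (fun ε => ∫ y in Ω, softDelta ε (x - y) • B y) (𝓝[>] 0) (𝓝 (B x)) := by
  -- The regularized delta decays like `|z|⁻⁵`, two powers faster than the dimension requires.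
  have hdec : Tendsto (fun z : R3 => ‖z‖ ^ Module.finrank ℝ R3 * softDelta 1 z)
      (Bornology.cobounded R3) (𝓝 0) := by
    have h1 : Tendsto (fun z : R3 => 3 * (4 * Real.pi)⁻¹ * ‖z‖⁻¹ ^ 2) (Bornology.cobounded R3)
        (𝓝 0) := by
      have := ((tendsto_inv_atTop_zero.comp
        (tendsto_norm_cobounded_atTop (E := R3))).pow 2).const_mul
        (3 * (4 * Real.pi)⁻¹)
      simpa [Function.comp_def] using this
    refine squeeze_zero' (Eventually.of_forall fun z =>
      mul_nonneg (by positivity) (softDelta_nonneg 1 z)) ?_ h1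
    filter_upwards [(tendsto_norm_cobounded_atTop (E := R3)).eventually_gt_atTop 0] with z hz
    have h2 := norm_le_softNorm 1 z
    have h3 : Module.finrank ℝ R3 = 3 := by simp
    rw [h3]
    calc ‖z‖ ^ 3 * softDelta 1 z = 3 * (4 * Real.pi)⁻¹ * (‖z‖ ^ 3 * (softNorm 1 z)⁻¹ ^ 5) := by
          rw [softDelta]; ring
      _ ≤ 3 * (4 * Real.pi)⁻¹ * (‖z‖ ^ 3 * ‖z‖⁻¹ ^ 5) := by
          have := hz.trans_le h2
          gcongr
      _ = 3 * (4 * Real.pi)⁻¹ * ‖z‖⁻¹ ^ 2 := by field_simp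
  have hind : Ω.indicator B =ᶠ[𝓝 x] B := by
    filter_upwards [hΩ.mem_nhds hx] with y hy using indicator_of_mem hy B
  have main := tendsto_integral_comp_smul_smul_of_integrable' (softDelta_nonneg 1)
    integral_softDelta_one hdec ((integrable_indicator_iff hΩ.measurableSet).2 hB)
    (hBx.congr hind.symm)
  rw [indicator_of_mem hx] at main
  -- The dilation parameter is `c = ε⁻¹`: by scaling, `c³ δ_1(c z) = δ_ε(z)`.
  refine (main.comp tendsto_inv_nhdsGT_zero).congr' ?_
  filter_upwards [self_mem_nhdsWithin] with ε hε
  have hε : 0 < ε := hε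
  rw [← integral_indicator hΩ.measurableSet]
  refine integral_congr_ae (ae_of_all _ fun y => ?_)
  have h3 : Module.finrank ℝ R3 = 3 := by simp
  simp only [h3, softDelta_one_smul (inv_pos.2 hε), inv_inv]
  by_cases hy : y ∈ Ω
  · rw [indicator_of_mem hy, indicator_of_mem hy]
  · rw [indicator_of_notMem hy, indicator_of_notMem hy, smul_zero]

/-! ### Cross product and curl as continuous linear maps. -/

theorem cross_eq (v w : R3) : cross v w = !₂[v 1 * w 2 - v 2 * w 1, v 2 * w 0 - v 0 * w 2,
    v 0 * w 1 - v 1 * w 0] := by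
  rw [cross, crossProduct]; rfl

@[simp] theorem cross_apply_zero (v w : R3) : cross v w 0 = v 1 * w 2 - v 2 * w 1 := by
  simp [cross_eq]

@[simp] theorem cross_apply_one (v w : R3) : cross v w 1 = v 2 * w 0 - v 0 * w 2 := by
  simp [cross_eq]

@[simp] theorem cross_apply_two (v w : R3) : cross v w 2 = v 0 * w 1 - v 1 * w 0 := by
  simp [cross_eq]

theorem inner_eq_sum (v w : R3) : ⟪v, w⟫ = v 0 * w 0 + v 1 * w 1 + v 2 * w 2 := by
  simp [PiLp.inner_apply, Fin.sum_univ_three]; ring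

theorem apply_eq_inner (v : R3) (i : Fin 3) : v i = ⟪v, stdVec i⟫ := by
  simp [stdVec, EuclideanSpace.inner_single_right]

/-- The cross product as a continuous bilinear map. -/
noncomputable def crossL : R3 →L[ℝ] R3 →L[ℝ] R3 :=
  LinearMap.toContinuousLinearMap ((LinearMap.toContinuousLinearMap :
    (R3 →ₗ[ℝ] R3) ≃ₗ[ℝ] (R3 →L[ℝ] R3)).toLinearMap ∘ₗ LinearMap.mk₂ ℝ cross
      (fun u v w => by ext i; fin_cases i <;> simp <;> ring)
      (fun c v w => by ext i; fin_cases i <;> simp <;> ring)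
      (fun u v w => by ext i; fin_cases i <;> simp <;> ring)
      (fun c v w => by ext i; fin_cases i <;> simp <;> ring))

@[simp] theorem crossL_apply (v w : R3) : crossL v w = cross v w := rfl

@[simp] theorem curlOf_apply_zero (L : R3 →L[ℝ] R3) :
    curlOf L 0 = (L (stdVec 1)) 2 - (L (stdVec 2)) 1 := by simp [curlOf]

@[simp] theorem curlOf_apply_one (L : R3 →L[ℝ] R3) :
    curlOf L 1 = (L (stdVec 2)) 0 - (L (stdVec 0)) 2 := by simp [curlOf]

@[simp] theorem curlOf_apply_two (L : R3 →L[ℝ] R3) :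
    curlOf L 2 = (L (stdVec 0)) 1 - (L (stdVec 1)) 0 := by simp [curlOf]

/-- The curl as a continuous linear function of the derivative. -/
noncomputable def curlL : (R3 →L[ℝ] R3) →L[ℝ] R3 :=
  LinearMap.toContinuousLinearMap
    { toFun := curlOf
      map_add' := fun a b => by ext i; fin_cases i <;> simp <;> ring
      map_smul' := fun c a => by ext i; fin_cases i <;> simp <;> ring }

@[simp] theorem curlL_apply (L : R3 →L[ℝ] R3) : curlL L = curlOf L := rfl

theorem precompR_density_apply {F : Type*} [NormedAddCommGroup F] [NormedSpace ℝ F] (u : F)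
    (g w : R3) : (densityL F).precompR R3 u (innerSL ℝ g) w = ⟪g, w⟫ • u := by
  simp [densityL]

/-- This is `curl (G u) = ∇G × u` for a constant vector `u`; with `curlL` it moves the curl under
integral signs. -/
theorem curlOf_precompR (u g : R3) :
    curlOf ((densityL R3).precompR R3 u (innerSL ℝ g)) = cross g u := by
  ext i
  fin_cases i <;>
  simp only [Fin.zero_eta, Fin.mk_one, Fin.reduceFinMk, curlOf_apply_zero, curlOf_apply_one,
    curlOf_apply_two, cross_apply_zero, cross_apply_one, cross_apply_two,
    precompR_density_apply, PiLp.smul_apply, smul_eq_mul, ← apply_eq_inner]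

/-! ### Derivatives and limits of layer potentials. -/

section Layer

variable {Γ : Set R3} {F : Type*} [NormedAddCommGroup F] [NormedSpace ℝ F] {σ : R3 → F} {x : R3}

theorem continuousOn_softGrad_sub (hx : x ∉ Γ) (ε : ℝ) :
    ContinuousOn (fun y => softGrad ε (x - y)) Γ := fun y hy =>
  (ContinuousAt.comp (f := fun y : R3 => x - y) (contDiffAt_softGrad
    (softNorm_pos_of_ne (sub_ne_zero_of_notMem hx hy))).continuousAt
    (by fun_prop)).continuousWithinAt

theorem integrableOn_layer {F' : Type*} [NormedAddCommGroup F'] [NormedSpace ℝ F']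
    (L : F →L[ℝ] R3 →L[ℝ] F') (hΓ : IsCompact Γ) (hσ : IntegrableOn σ Γ μHE[2]) (hx : x ∉ Γ)
    (ε : ℝ) : IntegrableOn (fun y => L (σ y) (softGrad ε (x - y))) Γ μHE[2] := by
  have hk := continuousOn_softGrad_sub hx ε
  obtain ⟨M, hM⟩ := hΓ.exists_bound_of_continuousOn hk
  refine (hσ.norm.const_mul ‖L‖ |>.mul_const M).mono'
    (L.aestronglyMeasurable_comp₂ hσ.aestronglyMeasurable
      (hk.aestronglyMeasurable_of_isCompact hΓ hΓ.measurableSet)) ?_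
  refine (ae_restrict_iff' hΓ.measurableSet).2 (ae_of_all _ fun y hy => ?_)
  exact (L.le_opNorm₂ _ _).trans (by gcongr; exact hM y hy)

/-- Away from `Γ` the singular kernel is bounded on the compact set `Γ`, and it dominates all the
regularized ones. -/
theorem tendsto_integral_layer {F' : Type*} [NormedAddCommGroup F'] [NormedSpace ℝ F']
    (L : F →L[ℝ] R3 →L[ℝ] F') (hΓ : IsCompact Γ) (hσ : IntegrableOn σ Γ μHE[2]) (hx : x ∉ Γ) :
    Tendsto (fun ε => ∫ y in Γ, L (σ y) (softGrad ε (x - y)) ∂μHE[2]) (𝓝[>] 0)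
      (𝓝 (∫ y in Γ, L (σ y) (softGrad 0 (x - y)) ∂μHE[2])) := by
  obtain ⟨M, hM⟩ := hΓ.exists_bound_of_continuousOn (continuousOn_softGrad_sub hx 0)
  refine tendsto_integral_filter_of_dominated_convergence (fun y => ‖L‖ * ‖σ y‖ * M)
    (Eventually.of_forall fun ε => (integrableOn_layer L hΓ hσ hx ε).aestronglyMeasurable)
    (Eventually.of_forall fun ε => ?_) (hσ.norm.const_mul ‖L‖ |>.mul_const M) ?_
  · refine (ae_restrict_iff' hΓ.measurableSet).2 (ae_of_all _ fun y hy => ?_)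
    refine (L.le_opNorm₂ _ _).trans ?_
    gcongr
    exact (norm_softGrad_le (sub_ne_zero_of_notMem hx hy)).trans (hM y hy)
  · refine (ae_restrict_iff' hΓ.measurableSet).2 (ae_of_all _ fun y hy => ?_)
    exact ((L (σ y)).continuous.tendsto _).comp
      ((tendsto_softGrad (sub_ne_zero_of_notMem hx hy)).mono_left nhdsWithin_le_nhds)

theorem integrableOn_newtonKernel_layer (hΓ : IsCompact Γ) (hσ : IntegrableOn σ Γ μHE[2])
    (hx : x ∉ Γ) : IntegrableOn (fun y => newtonKernel x y • σ y) Γ μHE[2] := by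
  have hk : ContinuousOn (fun y => softKernel 0 (x - y)) Γ := fun y hy =>
    (ContinuousAt.comp (f := fun y : R3 => x - y) (contDiffAt_softKernel
      (softNorm_pos_of_ne (sub_ne_zero_of_notMem hx hy))).continuousAt
      (by fun_prop)).continuousWithinAt
  simp only [newtonKernel_eq]
  exact integrableOn_smul_density (densityL F) hΓ hσ hk

theorem integral_fderiv_layer_congr (hΓ : IsCompact Γ) (hx : x ∉ Γ) :
    ∫ y in Γ, (densityL F).precompR R3 (σ y) (fderiv ℝ (softKernel 0) (x - y)) ∂μHE[2] =
    ∫ y in Γ, (densityL F).precompR R3 (σ y) (innerSL ℝ (softGrad 0 (x - y))) ∂μHE[2] := by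
  refine setIntegral_congr_fun hΓ.measurableSet fun y hy => ?_
  simp only [fderiv_softKernel (softNorm_pos_of_ne (sub_ne_zero_of_notMem hx hy))]

theorem integrableOn_fderiv_layer (hΓ : IsCompact Γ) (hσ : IntegrableOn σ Γ μHE[2]) (hx : x ∉ Γ) :
    IntegrableOn (fun y => (densityL F).precompR R3 (σ y) (innerSL ℝ (softGrad 0 (x - y)))) Γ
      μHE[2] :=
  integrableOn_smul_density ((densityL F).precompR R3) hΓ hσ
    ((innerSL ℝ : R3 →L[ℝ] R3 →L[ℝ] ℝ).continuous.comp_continuousOn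
      (continuousOn_softGrad_sub hx 0))

theorem fderiv_singleLayer [CompleteSpace F] (hΓ : IsCompact Γ) (hσ : IntegrableOn σ Γ μHE[2])
    (hx : x ∉ Γ) (w : R3) : fderiv ℝ (singleLayer Γ σ) x w =
      ∫ y in Γ, ⟪softGrad 0 (x - y), w⟫ • σ y ∂μHE[2] := by
  rw [(hasFDerivAt_singleLayer hΓ hσ hx).fderiv, integral_fderiv_layer_congr hΓ hx,
    ContinuousLinearMap.integral_apply (integrableOn_fderiv_layer hΓ hσ hx)]
  simp only [precompR_density_apply]

theorem fderiv_fderiv_singleLayer [CompleteSpace F] (hΓ : IsCompact Γ)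
    (hσ : IntegrableOn σ Γ μHE[2]) (hx : x ∉ Γ) (v w : R3) :
    fderiv ℝ (fderiv ℝ (singleLayer Γ σ)) x v w =
      ∫ y in Γ, ⟪softHess 0 (x - y) v, w⟫ • σ y ∂μHE[2] := by
  have hk : ContinuousOn (fun y => fderiv ℝ (fderiv ℝ (softKernel 0)) (x - y)) Γ := fun y hy =>
    (ContinuousAt.comp (f := fun y : R3 => x - y)
      (((contDiffAt_softKernel (ε := 0) (softNorm_pos_of_ne (sub_ne_zero_of_notMem hx
        hy))).fderiv_right
        (m := ∞) (by simp)).fderiv_right (m := ∞) (by simp)).continuousAt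
      (by fun_prop)).continuousWithinAt
  have hi := integrableOn_smul_density (F' := R3 →L[ℝ] R3 →L[ℝ] ℝ)
    (F'' := R3 →L[ℝ] R3 →L[ℝ] F) (((densityL F).precompR R3).precompR R3) hΓ hσ hk
  rw [(hasFDerivAt_fderiv_singleLayer hΓ hσ hx).fderiv, ContinuousLinearMap.integral_apply hi,
    ContinuousLinearMap.integral_apply (hi.apply_continuousLinearMap v)]
  refine setIntegral_congr_fun hΓ.measurableSet fun y hy => ?_
  simp [fderiv_fderiv_softKernel (sub_ne_zero_of_notMem hx hy), densityL]

theorem fderiv_fderiv_singleLayer_symm (hΓ : IsCompact Γ)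
    (hσ : IntegrableOn σ Γ μHE[2]) (hx : x ∉ Γ) (v w : R3) :
    fderiv ℝ (fderiv ℝ (singleLayer Γ σ)) x v w = fderiv ℝ (fderiv ℝ (singleLayer Γ σ)) x w v :=
  ((contDiffAt_singleLayer hΓ hσ hx).isSymmSndFDerivAt
    (by rw [minSmoothness_of_isRCLikeNormedField]
        exact WithTop.coe_le_coe.2 (le_top : (2 : ℕ∞) ≤ ⊤))) v w

theorem laplacian_singleLayer [CompleteSpace F] (hΓ : IsCompact Γ)
    (hσ : IntegrableOn σ Γ μHE[2]) (hx : x ∉ Γ) :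
    ∑ i, fderiv ℝ (fderiv ℝ (singleLayer Γ σ)) x (stdVec i) (stdVec i) = 0 := by
  simp only [fderiv_fderiv_singleLayer hΓ hσ hx]
  have hi : ∀ i, IntegrableOn (fun y => ⟪softHess 0 (x - y) (stdVec i), stdVec i⟫ • σ y) Γ
      μHE[2] := by
    intro i
    refine integrableOn_smul_density (densityL F) hΓ hσ
      (k := fun y => ⟪softHess 0 (x - y) (stdVec i), stdVec i⟫) fun y hy => ?_
    have h1 := softNorm_pos_of_ne (ε := 0) (sub_ne_zero_of_notMem hx hy)
    have h2 : ContinuousAt (fun z => ⟪softHess 0 z (stdVec i), stdVec i⟫) (x - y) := by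
      have h3 : ContinuousAt (fderiv ℝ (softGrad 0)) (x - y) :=
        ((contDiffAt_softGrad h1).fderiv_right (m := ∞) (by simp)).continuousAt
      have h4 : ContinuousAt (softHess 0) (x - y) := by
        refine h3.congr ?_
        filter_upwards [isOpen_ne.mem_nhds (sub_ne_zero_of_notMem hx hy)] with z hz
        exact (hasFDerivAt_softGrad (softNorm_pos_of_ne hz)).fderiv
      exact (h4.clm_apply continuousAt_const).inner continuousAt_const
    exact (ContinuousAt.comp (f := fun y : R3 => x - y) h2 (by fun_prop)).continuousWithinAt
  rw [← integral_finsetSum _ fun i _ => hi i]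
  refine setIntegral_eq_zero_of_forall_eq_zero fun y hy => ?_
  rw [← Finset.sum_smul]
  simp only [← apply_eq_inner]
  rw [softHess_trace (softNorm_pos_of_ne (sub_ne_zero_of_notMem hx hy))]
  simp [softDelta]

end Layer

/-! ### Harmonicity of the boundary fields. -/

/-- The gradient as a linear function of the derivative. -/
noncomputable def gradL : (R3 →L[ℝ] ℝ) →L[ℝ] R3 :=
  LinearMap.toContinuousLinearMap
    { toFun := (InnerProductSpace.toDual ℝ R3).symm
      map_add' := fun a b => map_add _ a b
      map_smul' := fun c a => by simp }

@[simp] theorem gradL_apply (ℓ : R3 →L[ℝ] ℝ) (i : Fin 3) : gradL ℓ i = ℓ (stdVec i) := by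
  rw [apply_eq_inner]; simp [gradL]

section Harmonic

variable {Γ : Set R3} {x : R3}

/-- The curl vanishes by symmetry of second derivatives, and the divergence is the Laplacian of the
potential. -/
theorem isHarmonicVectorField_gradient (hΓ : IsCompact Γ) {σ : R3 → ℝ}
    (hσ : IntegrableOn σ Γ μHE[2]) : IsHarmonicVectorField (∇ (singleLayer Γ σ)) Γᶜ := by
  have hd : ∀ x ∈ Γᶜ, ∀ v i, fderiv ℝ (∇ (singleLayer Γ σ)) x v i =
      fderiv ℝ (fderiv ℝ (singleLayer Γ σ)) x v (stdVec i) := by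
    intro x hx v i
    have h1 : HasFDerivAt (∇ (singleLayer Γ σ)) (gradL.comp
        (fderiv ℝ (fderiv ℝ (singleLayer Γ σ)) x)) x :=
      gradL.hasFDerivAt.comp x
        (hasFDerivAt_fderiv_singleLayer hΓ hσ hx).differentiableAt.hasFDerivAt
    rw [h1.fderiv]
    simp
  refine ⟨fun x hx => ?_, fun x hx => ?_, fun x hx => ?_⟩
  · have := (contDiffAt_singleLayer hΓ hσ hx).fderiv_right (m := ∞) (by simp)
    exact (gradL.contDiff.contDiffAt.comp x this).contDiffWithinAt
  · have hs := fderiv_fderiv_singleLayer_symm hΓ hσ hx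
    ext i
    fin_cases i <;> simp [curl, hd x hx, hs (stdVec 1) (stdVec 0), hs (stdVec 2) (stdVec 0),
      hs (stdVec 2) (stdVec 1)]
  · simp only [divergence, hd x hx]
    exact laplacian_singleLayer hΓ hσ hx

/-- The divergence of a curl vanishes by symmetry of second derivatives. For the curl, use `curl
curl S = grad div S - ΔS`: the potential `S` is harmonic off `Γ`, and `hdiv` says that `div S = 0`
there. -/
theorem isHarmonicVectorField_curl (hΓ : IsCompact Γ) {τ : R3 → R3}
    (hτ : IntegrableOn τ Γ μHE[2])
    (hdiv : ∀ x ∉ Γ, ∫ y in Γ, ⟪softGrad 0 (x - y), τ y⟫ ∂μHE[2] = 0) :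
    IsHarmonicVectorField (fun x => -curl (singleLayer Γ τ) x) Γᶜ := by
  have hd : ∀ x ∈ Γᶜ, ∀ v, fderiv ℝ (fun x => -curl (singleLayer Γ τ) x) x v =
      -curlOf (fderiv ℝ (fderiv ℝ (singleLayer Γ τ)) x v) := by
    intro x hx v
    have h1 : HasFDerivAt (fun x => -curl (singleLayer Γ τ) x)
        (-(curlL.comp (fderiv ℝ (fderiv ℝ (singleLayer Γ τ)) x))) x :=
      (curlL.hasFDerivAt.comp x
        (hasFDerivAt_fderiv_singleLayer hΓ hτ hx).differentiableAt.hasFDerivAt).neg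
    rw [h1.fderiv]; simp
  have hdiv' : ∀ x ∈ Γᶜ, ∑ i, fderiv ℝ (singleLayer Γ τ) x (stdVec i) i = 0 := by
    intro x hx
    rw [← hdiv x hx]
    have hi : ∀ i, IntegrableOn (fun y => ⟪softGrad 0 (x - y), stdVec i⟫ • τ y) Γ μHE[2] := fun i =>
      integrableOn_smul_density (densityL R3) hΓ hτ
        ((continuousOn_softGrad_sub hx 0).inner continuousOn_const)
    have hi' : ∀ i, IntegrableOn (fun y => softGrad 0 (x - y) i * τ y i) Γ μHE[2] := fun i => by
      have := (EuclideanSpace.proj i : R3 →L[ℝ] ℝ).integrable_comp (hi i)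
      simpa [← apply_eq_inner, IntegrableOn] using this
    have he : ∀ i, fderiv ℝ (singleLayer Γ τ) x (stdVec i) i =
        ∫ y in Γ, softGrad 0 (x - y) i * τ y i ∂μHE[2] := fun i => by
      rw [fderiv_singleLayer hΓ hτ hx]
      have := (EuclideanSpace.proj i : R3 →L[ℝ] ℝ).integral_comp_comm (hi i)
      simpa [← apply_eq_inner] using this.symm
    simp only [he]
    rw [← integral_finsetSum _ fun i _ => hi' i]
    simp only [Fin.sum_univ_three, inner_eq_sum]
  -- The identity `div S = 0` holds on the open set `Γᶜ`, so it may be differentiated.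
  have hdd : ∀ x ∈ Γᶜ, ∀ v, ∑ i, fderiv ℝ (fderiv ℝ (singleLayer Γ τ)) x v (stdVec i) i = 0 := by
    intro x hx v
    have h1 : HasFDerivAt (fun x => ∑ i, fderiv ℝ (singleLayer Γ τ) x (stdVec i) i)
        (∑ i, (EuclideanSpace.proj i : R3 →L[ℝ] ℝ).comp
          ((ContinuousLinearMap.apply ℝ R3 (stdVec i)).comp
            (fderiv ℝ (fderiv ℝ (singleLayer Γ τ)) x))) x := by
      refine HasFDerivAt.fun_sum fun i _ => ?_
      exact (EuclideanSpace.proj i : R3 →L[ℝ] ℝ).hasFDerivAt.comp x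
        ((ContinuousLinearMap.apply ℝ R3 (stdVec i)).hasFDerivAt.comp x
          (hasFDerivAt_fderiv_singleLayer hΓ hτ hx).differentiableAt.hasFDerivAt)
    have h2 : (fun x => ∑ i, fderiv ℝ (singleLayer Γ τ) x (stdVec i) i) =ᶠ[𝓝 x] fun _ => 0 := by
      filter_upwards [hΓ.isClosed.isOpen_compl.mem_nhds hx] with z hz using hdiv' z hz
    have h3 := h1.unique ((hasFDerivAt_const (0 : ℝ) x).congr_of_eventuallyEq h2)
    have := congrArg (fun L : R3 →L[ℝ] ℝ => L v) h3
    simpa [Fin.sum_univ_three] using this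
  refine ⟨fun x hx => ?_, fun x hx => ?_, fun x hx => ?_⟩
  · have := (contDiffAt_singleLayer hΓ hτ hx).fderiv_right (m := ∞) (by simp)
    exact (curlL.contDiff.contDiffAt.comp x this).neg.contDiffWithinAt
  · have hs := fderiv_fderiv_singleLayer_symm hΓ hτ hx
    have hl := laplacian_singleLayer hΓ hτ hx
    have hlc : ∀ j, (∑ i, fderiv ℝ (fderiv ℝ (singleLayer Γ τ)) x (stdVec i) (stdVec i)) j = 0 :=
      fun j => by rw [hl]; rfl
    have hv := hdd x hx
    simp only [Fin.sum_univ_three, PiLp.add_apply] at hlc hv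
    have l0 := hlc 0
    have l1 := hlc 1
    have l2 := hlc 2
    have v0 := hv (stdVec 0)
    have v1 := hv (stdVec 1)
    have v2 := hv (stdVec 2)
    ext i
    fin_cases i <;> simp only [curl, Fin.zero_eta, Fin.mk_one, Fin.reduceFinMk,
      curlOf_apply_zero, curlOf_apply_one, curlOf_apply_two, PiLp.zero_apply] <;>
    erw [hd x hx, hd x hx] <;>
    simp only [PiLp.neg_apply, curlOf_apply_zero, curlOf_apply_one, curlOf_apply_two,
      hs (stdVec 1) (stdVec 0), hs (stdVec 2) (stdVec 0),
      hs (stdVec 2) (stdVec 1)] at v0 v1 v2 ⊢ <;> linarith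
  · have hs := fderiv_fderiv_singleLayer_symm hΓ hτ hx
    simp only [divergence, hd x hx, Fin.sum_univ_three]
    simp [hs (stdVec 1) (stdVec 0), hs (stdVec 2) (stdVec 0), hs (stdVec 2) (stdVec 1)]

end Harmonic

/-! ### The divergence theorem for `C¹` fields and for curls. -/

theorem HasFDerivAt.divergence_eq {A : R3 → R3} {A' : R3 →L[ℝ] R3} {y : R3}
    (h : HasFDerivAt A A' y) : divergence A y = ∑ i, A' (stdVec i) i := by
  rw [divergence, h.fderiv]

/-- Each component is integrated by parts against the constant `1`. -/
theorem integral_divergence_eq_zero {A : R3 → R3} (hA : ContDiff ℝ 1 A)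
    (hc : HasCompactSupport A) : ∫ y, divergence A y = 0 := by
  have hd : ∀ i, HasCompactSupport (fun y => fderiv ℝ A y (stdVec i) i) := fun i =>
    (hc.fderiv_apply ℝ (stdVec i)).comp_left (g := fun v : R3 => v i) rfl
  have hi : ∀ i, Integrable (fun y => fderiv ℝ A y (stdVec i) i) := fun i => by
    refine Continuous.integrable_of_hasCompactSupport ?_ (hd i)
    have := hA.continuous_fderiv one_ne_zero
    fun_prop
  have hA0 : ∀ i, Integrable (fun y => A y i) := fun i => by
    refine Continuous.integrable_of_hasCompactSupport ?_
      (hc.comp_left (g := fun v : R3 => v i) rfl)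
    have := hA.continuous
    fun_prop
  have hp : ∀ i, ∀ y, HasFDerivAt (fun y => A y i)
      ((EuclideanSpace.proj i : R3 →L[ℝ] ℝ).comp (fderiv ℝ A y)) y := fun i y =>
    (EuclideanSpace.proj i : R3 →L[ℝ] ℝ).hasFDerivAt.comp y
      (hA.differentiable one_ne_zero y).hasFDerivAt
  simp only [divergence]
  rw [integral_finsetSum _ fun i _ => hi i]
  refine Finset.sum_eq_zero fun i _ => ?_
  have := integral_mul_fderiv_eq_neg_fderiv_mul_of_integrable (μ := (volume : Measure R3))
    (f := fun _ => (1 : ℝ)) (g := fun y => A y i) (v := stdVec i) (by simp)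
    (by simpa [(hp i _).fderiv] using hi i) (by simpa using hA0 i) (fun _ _ => by fun_prop)
    (fun y _ => (hp i y).differentiableAt)
  simpa [(hp i _).fderiv] using this

/-- As the support is inside `Ω`, the field vanishes near every point off its support and is thus
`C¹` on the whole space. -/
theorem setIntegral_divergence_eq_zero {Ω : Set R3} (hΩ : IsOpen Ω) {A : R3 → R3}
    (hA : ContDiffOn ℝ 1 A Ω) (hc : HasCompactSupport A) (hs : tsupport A ⊆ Ω) :
    ∫ y in Ω, divergence A y = 0 := by
  rw [setIntegral_eq_integral_of_forall_compl_eq_zero fun y hy => ?_]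
  · refine integral_divergence_eq_zero (contDiff_iff_contDiffAt.2 fun y => ?_) hc
    by_cases hy : y ∈ tsupport A
    · exact hA.contDiffAt (hΩ.mem_nhds (hs hy))
    · exact contDiffAt_const.congr_of_eventuallyEq (notMem_tsupport_iff_eventuallyEq.1 hy)
  · rw [divergence, fderiv_of_notMem_tsupport ℝ fun h => hy (hs h)]
    simp

section Boundary

variable {Ω : Set R3} {A : R3 → R3}

theorem ContDiffOn.hasFDerivAt_of_closure {E F : Type*} [NormedAddCommGroup E] [NormedSpace ℝ E]
    [NormedAddCommGroup F] [NormedSpace ℝ F] {f : E → F} {s : Set E} (hs : IsOpen s)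
    (hf : ContDiffOn ℝ 1 f (closure s)) {y : E} (hy : y ∈ s) :
    HasFDerivAt f (fderiv ℝ f y) y :=
  ((hf.contDiffAt (mem_of_superset (hs.mem_nhds hy) subset_closure)).differentiableAt
    one_ne_zero).hasFDerivAt

theorem fderivWithin_closure {E F : Type*} [NormedAddCommGroup E] [NormedSpace ℝ E]
    [NormedAddCommGroup F] [NormedSpace ℝ F] {f : E → F} {s : Set E} (hs : IsOpen s) {y : E}
    (hy : y ∈ s) : fderivWithin ℝ f (closure s) y = fderiv ℝ f y :=
  fderivWithin_of_mem_nhds (mem_of_superset (hs.mem_nhds hy) subset_closure)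

/-- The integrand is `div (φ A)`, and `φ A` has compact support in `Ω`. -/
theorem hasWeakDivergence_divergence (hΩ : IsOpen Ω) (hA : ContDiffOn ℝ 1 A (closure Ω)) :
    HasWeakDivergence Ω A (divergence A) := by
  intro φ hφ hc hs
  have hφA : ContDiffOn ℝ 1 (fun y => φ y • A y) Ω :=
    (hφ.of_le (by simp)).contDiffOn.smul (hA.mono subset_closure)
  have hsub : tsupport (fun y => φ y • A y) ⊆ tsupport φ := tsupport_smul_subset_left φ A
  refine Eq.trans ?_ (setIntegral_divergence_eq_zero hΩ hφA hc.smul_right (hsub.trans hs))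
  refine setIntegral_congr_fun hΩ.measurableSet fun y hy => ?_
  have h1 := (hφ.differentiable (by simp) y).hasFDerivAt.fun_smul
    (hA.hasFDerivAt_of_closure hΩ hy)
  have h2 : A y = A y 0 • stdVec 0 + A y 1 • stdVec 1 + A y 2 • stdVec 2 := by
    ext i; fin_cases i <;> simp [stdVec]
  simp only [h1.divergence_eq]
  conv_lhs => rw [h2]
  simp [Fin.sum_univ_three, divergence]
  ring

/-- The divergence theorem for vector fields of class `C¹` up to the boundary. -/
theorem IsSmoothlyBounded.integral_divergence (hΩ : IsSmoothlyBounded Ω)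
    (hA : ContDiffOn ℝ 1 A (closure Ω)) :
    ∫ y in Ω, divergence A y = ∫ y in frontier Ω, ⟪outwardNormal Ω y, A y⟫ ∂μHE[2] := by
  have hg : IntegrableOn (divergence A) Ω := by
    have h1 : ContinuousOn (fun y => ∑ i, fderivWithin ℝ A (closure Ω) y (stdVec i) i)
        (closure Ω) := by
      have := hA.continuousOn_fderivWithin hΩ.uniqueDiffOn_closure le_rfl
      fun_prop
    refine (hΩ.integrableOn_of_continuousOn h1).congr_fun (fun y hy => ?_) hΩ.isOpen.measurableSet
    simp only [fderivWithin_closure hΩ.isOpen hy, divergence]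
  have := hΩ.integral_weakDivergence hA.continuousOn hg
    (hasWeakDivergence_divergence hΩ.isOpen hA) (φ := fun _ => 1) contDiff_const
  simpa using this

end Boundary

section Curl

variable {Ω : Set R3} {B J : R3 → R3}

theorem IsSmoothlyBounded.continuousOn_curl (hΩ : IsSmoothlyBounded Ω)
    (hB : ContDiffOn ℝ 1 B (closure Ω))
    (hcurl : ∀ x ∈ closure Ω, curlWithin B (closure Ω) x = J x) :
    ContinuousOn J (closure Ω) :=
  (curlL.continuous.comp_continuousOn
    (hB.continuousOn_fderivWithin hΩ.uniqueDiffOn_closure le_rfl)).congr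
    fun y hy => (hcurl y hy).symm

theorem IsSmoothlyBounded.curlOf_fderiv (hΩ : IsSmoothlyBounded Ω)
    (hcurl : ∀ x ∈ closure Ω, curlWithin B (closure Ω) x = J x) {y : R3} (hy : y ∈ Ω) :
    curlOf (fderiv ℝ B y) = J y := by
  rw [← hcurl y (subset_closure hy), curlWithin, fderivWithin_closure hΩ.isOpen hy]

theorem HasFDerivAt.divergence_cross {U : R3 → R3} {B' U' : R3 →L[ℝ] R3} {y : R3}
    (hB : HasFDerivAt B B' y) (hU : HasFDerivAt U U' y) :
    divergence (fun y => cross (B y) (U y)) y = ⟪U y, curlOf B'⟫ - ⟪B y, curlOf U'⟫ := by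
  have h := crossL.hasFDerivAt_of_bilinear hB hU
  simp only [crossL_apply] at h
  rw [h.divergence_eq]
  simp [Fin.sum_univ_three, inner_eq_sum]
  ring

/-- A curl is divergence free in the weak sense. -/
theorem IsSmoothlyBounded.hasWeakDivergence_curl (hΩ : IsSmoothlyBounded Ω)
    (hB : ContDiffOn ℝ 1 B (closure Ω))
    (hcurl : ∀ x ∈ closure Ω, curlWithin B (closure Ω) x = J x) :
    HasWeakDivergence Ω J (fun _ => 0) := by
  intro φ hφ hc hs
  have hφ' : ContDiff ℝ ∞ (fderiv ℝ φ) := hφ.fderiv_right (by simp)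
  have hU : ContDiff ℝ 1 (fun y => gradL (fderiv ℝ φ y)) :=
    gradL.contDiff.comp (hφ'.of_le (by simp))
  -- Since `J` need not be differentiable, one uses `div (B × ∇φ) = ∇φ · curl B`, valid because
  -- `curl ∇φ = 0`; this takes only one derivative of `B`.
  have hd : ContDiffOn ℝ 1 (fun y => cross (B y) (gradL (fderiv ℝ φ y))) Ω :=
    crossL.isBoundedBilinearMap.contDiff.comp_contDiffOn
      ((hB.mono subset_closure).prodMk hU.contDiffOn)
  have hsub : Function.support (fun y => cross (B y) (gradL (fderiv ℝ φ y))) ⊆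
      tsupport φ := fun y hy => by
    by_contra h
    refine hy ?_
    simp only [fderiv_of_notMem_tsupport ℝ h, map_zero]
    exact (crossL _).map_zero
  refine Eq.trans ?_ (setIntegral_divergence_eq_zero hΩ.isOpen hd (hc.mono' hsub)
    ((closure_minimal hsub (isClosed_tsupport φ)).trans hs))
  refine setIntegral_congr_fun hΩ.isOpen.measurableSet fun y hy => ?_
  have h1 : HasFDerivAt (fun y => gradL (fderiv ℝ φ y)) (gradL.comp (fderiv ℝ (fderiv ℝ φ) y)) y :=
    gradL.hasFDerivAt.comp y (hφ'.differentiable (by simp) y).hasFDerivAt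
  have h2 : curlOf (gradL.comp (fderiv ℝ (fderiv ℝ φ) y)) = 0 := by
    have hs : ∀ v w, fderiv ℝ (fderiv ℝ φ) y v w = fderiv ℝ (fderiv ℝ φ) y w v :=
      hφ.contDiffAt.isSymmSndFDerivAt (by
        rw [minSmoothness_of_isRCLikeNormedField]
        exact WithTop.coe_le_coe.2 (le_top : (2 : ℕ∞) ≤ ⊤))
    ext i
    fin_cases i <;> simp [hs (stdVec 1) (stdVec 0), hs (stdVec 2) (stdVec 0),
      hs (stdVec 2) (stdVec 1)]
  simp only [(hB.hasFDerivAt_of_closure hΩ.isOpen hy).divergence_cross h1, h2,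
    hΩ.curlOf_fderiv hcurl hy]
  simp [gradL]

end Curl

/-! ### The regularized representation formula. -/

theorem ContinuousOn.cross {X : Type*} [TopologicalSpace X] {s : Set X} {f g : X → R3}
    (hf : ContinuousOn f s) (hg : ContinuousOn g s) :
    ContinuousOn (fun y => cross (f y) (g y)) s :=
  crossL.isBoundedBilinearMap.continuous.comp_continuousOn (hf.prodMk hg)

theorem continuous_softDelta {ε : ℝ} (hε : 0 < ε) : Continuous (softDelta ε) :=
  continuous_const.mul
    (((continuous_softNorm_right ε).inv₀ fun z => (softNorm_pos_of_pos hε z).ne').pow 5)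

section Regularized

variable {Ω : Set R3} {B J : R3 → R3} {ε : ℝ}

theorem contDiff_softGrad_sub (hε : 0 < ε) (x : R3) :
    ContDiff ℝ ∞ (fun y => softGrad ε (x - y)) :=
  (contDiff_iff_contDiffAt.2 fun z => contDiffAt_softGrad (softNorm_pos_of_pos hε z)).comp
    (contDiff_const.sub contDiff_id)

theorem hasFDerivAt_softGrad_sub (hε : 0 < ε) (x y : R3) :
    HasFDerivAt (fun y => softGrad ε (x - y)) (-softHess ε (x - y)) y := by
  have := (hasFDerivAt_softGrad (softNorm_pos_of_pos hε (x - y))).comp y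
    ((hasFDerivAt_id y).const_sub x)
  convert! this using 1
  ext; simp

theorem hasFDerivAt_softKernel_sub (hε : 0 < ε) (x y : R3) :
    HasFDerivAt (fun y => softKernel ε (x - y)) (-innerSL ℝ (softGrad ε (x - y))) y := by
  have := (hasFDerivAt_softKernel (softNorm_pos_of_pos hε (x - y))).comp y
    ((hasFDerivAt_id y).const_sub x)
  convert! this using 1
  ext; simp

theorem softHess_apply_symm (z : R3) (i j : Fin 3) :
    softHess ε z (stdVec i) j = softHess ε z (stdVec j) i := by
  rw [apply_eq_inner, apply_eq_inner, softHess_symm, real_inner_comm]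

theorem curlOf_softHess (z : R3) : curlOf (-softHess ε z) = 0 := by
  ext i
  fin_cases i <;> simp [softHess_apply_symm z 1 0, softHess_apply_symm z 2 0,
    softHess_apply_symm z 2 1]

/-- As a function of `y`, `u = softGrad ε (x - y)` has divergence `softDelta ε (x - y)` and a
symmetric derivative. The symmetry cancels the terms `B·D_c u` and `c·D_B u`; what remains of the
derivative of `B` is `u·D_c B - c·D_u B = c·(u × curl B)`. -/
theorem divergence_representation_field (hε : 0 < ε) (x c : R3) {B' : R3 →L[ℝ] R3} {y : R3}
    (hB : HasFDerivAt B B' y) (hdiv : divergence B y = 0) :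
    divergence (fun y => ⟪softGrad ε (x - y), B y⟫ • c - ⟪B y, c⟫ • softGrad ε (x - y) -
      ⟪softGrad ε (x - y), c⟫ • B y) y =
    ⟪cross (softGrad ε (x - y)) (curlOf B') - softDelta ε (x - y) • B y, c⟫ := by
  have hu := hasFDerivAt_softGrad_sub hε x y
  have hc := hasFDerivAt_const (𝕜 := ℝ) c y
  have h := (((hu.inner ℝ hB).smul hc).sub ((hB.inner ℝ hc).smul hu)).sub
    ((hu.inner ℝ hc).smul hB)
  have ht := softHess_trace (softNorm_pos_of_pos hε (x - y))
  rw [hB.divergence_eq] at hdiv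
  refine h.divergence_eq.trans ?_
  generalize softGrad ε (x - y) = u at *
  have s10 := softHess_apply_symm (ε := ε) (x - y) 1 0
  have s20 := softHess_apply_symm (ε := ε) (x - y) 2 0
  have s21 := softHess_apply_symm (ε := ε) (x - y) 2 1
  generalize softHess ε (x - y) = H at *
  generalize softDelta ε (x - y) = δ at *
  simp only [Fin.sum_univ_three] at ht hdiv
  simp [Fin.sum_univ_three, inner_eq_sum, s10, s20, s21]
  linear_combination (B y 0 * c 0 + B y 1 * c 1 + B y 2 * c 2) * ht -
    (u 0 * c 0 + u 1 * c 1 + u 2 * c 2) * hdiv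

theorem IsSmoothlyBounded.continuousOn_tangentialTrace (hΩ : IsSmoothlyBounded Ω)
    (hB : ContinuousOn B (closure Ω)) : ContinuousOn (tangentialTrace Ω B) (frontier Ω) :=
  hΩ.continuousOn_outwardNormal.cross (hB.mono frontier_subset_closure)

theorem IsSmoothlyBounded.continuousOn_normalTrace (hΩ : IsSmoothlyBounded Ω)
    (hB : ContinuousOn B (closure Ω)) : ContinuousOn (normalTrace Ω B) (frontier Ω) :=
  (hB.mono frontier_subset_closure).inner hΩ.continuousOn_outwardNormal

/-- The representation formula with the regularized kernel. -/
theorem IsSmoothlyBounded.regularized_representation (hΩ : IsSmoothlyBounded Ω)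
    (hB : ContDiffOn ℝ 1 B (closure Ω)) (hdiv : ∀ x ∈ Ω, divergence B x = 0)
    (hcurl : ∀ x ∈ closure Ω, curlWithin B (closure Ω) x = J x) (hε : 0 < ε) (x : R3) :
    ∫ y in Ω, softDelta ε (x - y) • B y = (∫ y in Ω, cross (softGrad ε (x - y)) (J y)) -
      (∫ y in frontier Ω, cross (softGrad ε (x - y)) (tangentialTrace Ω B y) ∂μHE[2]) +
      ∫ y in frontier Ω, normalTrace Ω B y • softGrad ε (x - y) ∂μHE[2] := by
  have hu := contDiff_softGrad_sub hε x
  have hJ := hΩ.continuousOn_curl hB hcurl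
  have huc : ∀ s, ContinuousOn (fun y => softGrad ε (x - y)) s := fun s =>
    hu.continuous.continuousOn
  have i1 : IntegrableOn (fun y => softDelta ε (x - y) • B y) Ω :=
    hΩ.integrableOn_of_continuousOn
      (((continuous_softDelta hε).comp (by fun_prop)).continuousOn.smul hB.continuousOn)
  have i2 : IntegrableOn (fun y => cross (softGrad ε (x - y)) (J y)) Ω :=
    hΩ.integrableOn_of_continuousOn ((huc _).cross hJ)
  have i3 : IntegrableOn (fun y => cross (softGrad ε (x - y)) (tangentialTrace Ω B y))
      (frontier Ω) μHE[2] :=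
    hΩ.integrableOn_frontier ((huc _).cross (hΩ.continuousOn_tangentialTrace hB.continuousOn))
  have i4 : IntegrableOn (fun y => normalTrace Ω B y • softGrad ε (x - y)) (frontier Ω) μHE[2] :=
    hΩ.integrableOn_frontier ((hΩ.continuousOn_normalTrace hB.continuousOn).smul (huc _))
  suffices h : (∫ y in Ω, (cross (softGrad ε (x - y)) (J y) - softDelta ε (x - y) • B y)) =
      ∫ y in frontier Ω, (cross (softGrad ε (x - y)) (tangentialTrace Ω B y) -
        normalTrace Ω B y • softGrad ε (x - y)) ∂μHE[2] by
    rw [integral_sub i2 i1, integral_sub i3 i4, sub_eq_iff_eq_add] at h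
    rw [h]; abel
  -- Pairing with a constant vector reduces the vector identity to the scalar divergence theorem.
  refine ext_inner_left ℝ fun c => ?_
  have i5 : IntegrableOn (fun y => cross (softGrad ε (x - y)) (J y) -
      softDelta ε (x - y) • B y) Ω :=
    i2.sub i1
  have i6 : IntegrableOn (fun y => cross (softGrad ε (x - y)) (tangentialTrace Ω B y) -
      normalTrace Ω B y • softGrad ε (x - y)) (frontier Ω) μHE[2] := i3.sub i4
  rw [← integral_inner i5, ← integral_inner i6]
  have hA : ContDiffOn ℝ 1 (fun y => ⟪softGrad ε (x - y), B y⟫ • c -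
      ⟪B y, c⟫ • softGrad ε (x - y) - ⟪softGrad ε (x - y), c⟫ • B y) (closure Ω) := by
    have hu1 : ContDiffOn ℝ 1 (fun y => softGrad ε (x - y)) (closure Ω) :=
      (hu.of_le (by simp)).contDiffOn
    exact (((hu1.inner ℝ hB).smul contDiffOn_const).sub
      ((hB.inner ℝ contDiffOn_const).smul hu1)).sub ((hu1.inner ℝ contDiffOn_const).smul hB)
  have main := hΩ.integral_divergence hA
  refine Eq.trans ?_ (main.trans ?_)
  · refine setIntegral_congr_fun hΩ.isOpen.measurableSet fun y hy => ?_
    simp only [divergence_representation_field hε x c (hB.hasFDerivAt_of_closure hΩ.isOpen hy)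
      (hdiv y hy), hΩ.curlOf_fderiv hcurl hy]
    rw [real_inner_comm]
  -- On the boundary the two integrands match by `u × (n × B) = (u·B)n - (u·n)B`.
  · refine setIntegral_congr_fun isClosed_frontier.measurableSet fun y _ => ?_
    simp only [normalTrace, tangentialTrace]
    generalize softGrad ε (x - y) = u
    simp [inner_eq_sum]
    ring

/-- The integrand is the flux density of `B × u`, whose divergence is `u·J` as `u` is curl free. Up
to sign, `u` is the gradient of the regularized kernel in `y`, so `∫_Ω u·J` is a boundary integral
against `J·n = 0`. The kernel is smooth everywhere, so `x` may be any point. -/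
theorem IsSmoothlyBounded.integral_softGrad_tangentialTrace (hΩ : IsSmoothlyBounded Ω)
    (hB : ContDiffOn ℝ 1 B (closure Ω))
    (hcurl : ∀ x ∈ closure Ω, curlWithin B (closure Ω) x = J x)
    (hJn : ∀ x ∈ frontier Ω, ⟪J x, outwardNormal Ω x⟫ = 0) (hε : 0 < ε) (x : R3) :
    ∫ y in frontier Ω, ⟪tangentialTrace Ω B y, softGrad ε (x - y)⟫ ∂μHE[2] = 0 := by
  have hu := contDiff_softGrad_sub hε x
  have hφ : ContDiff ℝ ∞ (fun y => softKernel ε (x - y)) :=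
    (contDiff_iff_contDiffAt.2 fun z => contDiffAt_softKernel (softNorm_pos_of_pos hε z)).comp
      (contDiff_const.sub contDiff_id)
  have h1 : ∫ y in Ω, ⟪softGrad ε (x - y), J y⟫ = 0 := by
    have := hΩ.integral_weakDivergence (hΩ.continuousOn_curl hB hcurl) integrableOn_zero
      (hΩ.hasWeakDivergence_curl hB hcurl) hφ
    simp only [(hasFDerivAt_softKernel_sub hε x _).fderiv] at this
    rw [setIntegral_eq_zero_of_forall_eq_zero (μ := μHE[2]) fun y hy => by
      rw [real_inner_comm, hJn y hy, mul_zero]] at this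
    simpa [integral_neg] using this
  have hA : ContDiffOn ℝ 1 (fun y => cross (B y) (softGrad ε (x - y))) (closure Ω) :=
    crossL.isBoundedBilinearMap.contDiff.comp_contDiffOn
      (hB.prodMk (hu.of_le (by simp)).contDiffOn)
  refine Eq.trans ?_ ((hΩ.integral_divergence hA).symm.trans (Eq.trans ?_ h1))
  · refine setIntegral_congr_fun isClosed_frontier.measurableSet fun y _ => ?_
    simp only [tangentialTrace]
    generalize softGrad ε (x - y) = u
    simp [inner_eq_sum]
    ring
  · refine setIntegral_congr_fun hΩ.isOpen.measurableSet fun y hy => ?_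
    simp only [(hB.hasFDerivAt_of_closure hΩ.isOpen hy).divergence_cross
      (hasFDerivAt_softGrad_sub hε x y), curlOf_softHess, hΩ.curlOf_fderiv hcurl hy,
      inner_zero_right, sub_zero]

end Regularized

/-! ### The limit `ε → 0`. -/

theorem theorem4 (Ω : Set R3) (hΩ : IsSmoothlyBounded Ω)
    (B J : R3 → R3)
    (hB : ContDiffOn ℝ 1 B (closure Ω))
    (hdiv : ∀ x ∈ Ω, divergence B x = 0)
    (hcurl : ∀ x ∈ closure Ω, curlWithin B (closure Ω) x = J x)
    (hJn : ∀ x ∈ frontier Ω, ⟪J x, outwardNormal Ω x⟫ = 0) :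
    -- the volume potential converges and is differentiable in `Ω`
    (∀ x ∈ Ω, IntegrableOn (fun y => newtonKernel x y • J y) Ω ∧
      DifferentiableAt ℝ (volumePotential Ω J) x) ∧
    -- the layer potentials converge and are differentiable off the boundary
    (∀ x ∈ (frontier Ω)ᶜ,
      IntegrableOn (fun y => newtonKernel x y • tangentialTrace Ω B y) (frontier Ω) μHE[2] ∧
      IntegrableOn (fun y => newtonKernel x y • normalTrace Ω B y) (frontier Ω) μHE[2] ∧
      DifferentiableAt ℝ (singleLayer (frontier Ω) (tangentialTrace Ω B)) x ∧
      DifferentiableAt ℝ (singleLayer (frontier Ω) (normalTrace Ω B)) x) ∧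
    -- the representation formula
    (∀ x ∈ Ω, B x = biotSavart Ω J x + tangentialField Ω B x + normalField Ω B x) ∧
    -- both boundary terms are harmonic vector fields off the boundary
    IsHarmonicVectorField (tangentialField Ω B) (frontier Ω)ᶜ ∧
    IsHarmonicVectorField (normalField Ω B) (frontier Ω)ᶜ := by
  have hm := hΩ.isOpen.measurableSet
  have hJ := hΩ.continuousOn_curl hB hcurl
  obtain ⟨R, hR⟩ := hΩ.isBounded.subset_ball 0
  obtain ⟨M, hM⟩ := hΩ.isCompact_closure.exists_bound_of_continuousOn hJ
  have hJM : ∀ y ∈ Ω, ‖J y‖ ≤ max M 0 := fun y hy =>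
    (hM y (subset_closure hy)).trans (le_max_left _ _)
  have hJm : AEStronglyMeasurable J (volume.restrict Ω) :=
    (hΩ.integrableOn_of_continuousOn hJ).aestronglyMeasurable
  have hV := fun x (hx : x ∈ Ω) =>
    hasFDerivAt_volumePotential hm hR hJm (le_max_right _ _) hJM (hR hx)
  have hΓ := hΩ.isCompact_frontier
  have hτ := hΩ.integrableOn_frontier (hΩ.continuousOn_tangentialTrace hB.continuousOn)
  have hν := hΩ.integrableOn_frontier (hΩ.continuousOn_normalTrace hB.continuousOn)
  refine ⟨fun x hx => ⟨integrableOn_newtonKernel_smul hm hR hJm hJM (hR hx),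
    (hV x hx).1.differentiableAt⟩, fun x hx => ⟨integrableOn_newtonKernel_layer hΓ hτ hx,
    integrableOn_newtonKernel_layer hΓ hν hx,
    (contDiffAt_singleLayer hΓ hτ hx).differentiableAt (by simp),
    (contDiffAt_singleLayer hΓ hν hx).differentiableAt (by simp)⟩, fun x hx => ?_,
    isHarmonicVectorField_curl hΓ hτ fun x hx => ?_, isHarmonicVectorField_gradient hΓ hν⟩
  · have hxΓ : x ∉ frontier Ω := by
      rw [hΩ.isOpen.frontier_eq]; exact fun h => h.2 hx
    -- Stated for all `ε`, so that `ε = 0` gives the Biot–Savart integral and `ε > 0` gives its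
    -- approximations.
    have hvol : ∀ ε, ∫ y in Ω, cross (softGrad ε (x - y)) (J y) =
        curlL (∫ y in Ω, (densityL R3).precompR R3 (J y) (innerSL ℝ (softGrad ε (x - y)))) := by
      intro ε
      rw [← curlL.integral_comp_comm (integrable_density_softGrad hm hR hJm hJM (hR hx) ε)]
      simp only [curlL_apply, curlOf_precompR]
    have e1 : biotSavart Ω J x = ∫ y in Ω, cross (softGrad 0 (x - y)) (J y) := by
      rw [hvol, biotSavart, curl, (hV x hx).1.fderiv, curlL_apply]
    have e2 : tangentialField Ω B x =
        -∫ y in frontier Ω, cross (softGrad 0 (x - y)) (tangentialTrace Ω B y) ∂μHE[2] := by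
      rw [tangentialField, curl, (hasFDerivAt_singleLayer hΓ hτ hxΓ).fderiv,
        integral_fderiv_layer_congr hΓ hxΓ, ← curlL_apply,
        ← curlL.integral_comp_comm (integrableOn_fderiv_layer hΓ hτ hxΓ)]
      simp only [curlL_apply, curlOf_precompR]
    have e3 : normalField Ω B x =
        ∫ y in frontier Ω, normalTrace Ω B y • softGrad 0 (x - y) ∂μHE[2] := by
      refine ext_inner_right ℝ fun w => ?_
      have hi : IntegrableOn (fun y => normalTrace Ω B y • softGrad 0 (x - y)) (frontier Ω)
          μHE[2] := integrableOn_layer (ContinuousLinearMap.lsmul ℝ ℝ) hΓ hν hxΓ 0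
      rw [real_inner_comm w (∫ y in frontier Ω, _ ∂μHE[2]), ← integral_inner hi, normalField,
        gradient, InnerProductSpace.toDual_symm_apply, fderiv_singleLayer hΓ hν hxΓ]
      refine integral_congr_ae (ae_of_all _ fun y => ?_)
      simp only [real_inner_smul_right, smul_eq_mul]
      rw [real_inner_comm, mul_comm]
    have hBx : ContinuousAt B x :=
      hB.continuousOn.continuousAt (mem_of_superset (hΩ.isOpen.mem_nhds hx) subset_closure)
    have l0 := tendsto_integral_softDelta hΩ.isOpen
      (hΩ.integrableOn_of_continuousOn hB.continuousOn) hx hBx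
    have l1 := (curlL.continuous.tendsto _).comp (hV x hx).2
    simp only [Function.comp_def, ← hvol] at l1
    have l2 := tendsto_integral_layer crossL.flip hΓ hτ hxΓ
    have l3 := tendsto_integral_layer (ContinuousLinearMap.lsmul ℝ ℝ) hΓ hν hxΓ
    simp only [ContinuousLinearMap.flip_apply, crossL_apply, ContinuousLinearMap.lsmul_apply]
      at l2 l3
    rw [e1, e2, e3, ← sub_eq_add_neg]
    -- Both sides of the regularized formula converge, the left one to `B x`.
    refine tendsto_nhds_unique l0 (((l1.sub l2).add l3).congr' ?_)
    filter_upwards [self_mem_nhdsWithin] with ε hε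
    exact (hΩ.regularized_representation hB hdiv hcurl hε x).symm
  -- The divergence of the tangential layer potential vanishes as the limit of its regularizations,
  -- each of which is zero.
  · have l := tendsto_integral_layer (innerSL ℝ : R3 →L[ℝ] R3 →L[ℝ] ℝ) hΓ hτ hx
    simp only [real_inner_comm (tangentialTrace Ω B _)]
    refine tendsto_nhds_unique l (tendsto_const_nhds.congr' ?_)
    filter_upwards [self_mem_nhdsWithin] with ε hε
    exact (hΩ.integral_softGrad_tangentialTrace hB hcurl hJn hε x).symm
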